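/- **Setting.** Let $P$ be a path with vertices $v_0,\dots,v_n$ and edges $e_t=(v_t,v_{t+1})$ of length (travel time) $d_t>0$ and capacity $c_t>0$, $0\le t<n$. Vertex $v_t$ lies at $x_t=\sum_{r<t}d_r$. A scenario $w=(w_0,\dots,w_n)$, $w_t\ge 0$, gives the amount of flow initially at each vertex. Flow entering $e_t$ is limited to $c_t$ per unit time; excess flow waits at the vertex. For $y\in[0,x_n]$, $\Theta_L(P,y:w)$ (resp. $\Theta_R(P,y:w)$) is the minimum time needed to move all flow located in $[0,y)$ (resp. $(y,x_n]$) to $y$, and $\Theta(P,y:w)=\max\{\Theta_L(P,y:w),\Theta_R(P,y:w)\}$. Equivalently, with $W_{a,b}=\sum_{t=a}^b w_t$ and $c(x,x')$ the minimum capacity of the edges between $x$ and $x'$, $$\Theta_L(P,y:w)=\max_{t:\,x_t<y,\;W_{0,t}>0}\Bigl(y-x_t+\tfrac{W_{0,t}}{c(x_t,y)}\Bigr),\qquad \Theta_R(P,y:w)=\max_{t:\,x_t>y,\;W_{t,n}>0}\Bigl(x_t-y+\tfrac{W_{t,n}}{c(y,x_t)}\Bigr),$$ where an empty maximum is $0$.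 Let weight ranges $0\le w_t^-\le w_t^+$ be given for $0\le t\le n$. For $i<j$ let $s_{i,j}(\alpha_1,\alpha_2)$ be the scenario with weight $\alpha_1$ at $v_i$, $\alpha_2$ at $v_j$, $w_t^+$ at $v_t$ for $i<t<j$, and $w_t^-$ at $v_t$ for $t<i$ or $t>j$. **Lemma.** Let $0\le i\le k<j\le n$, $0\le a_1\le a_2$ and $0\le b_1\le b_2$. Put $A=a_1+\sum_{t<i}w_t^-$ and $B=b_1+\sum_{t>j}w_t^-$. Assume that $A>0$ if $a_1<a_2$, and that $B>0$ if $b_1<b_2$. For $\alpha\in[a_1+b_1,a_2+b_2]$ define $$M^{(k)}_{i,j}(P:\alpha)=\min\bigl\{\Theta(P,y:s_{i,j}(\alpha_1,\alpha_2)) : \alpha_1\in[a_1,a_2],\ \alpha_2\in[b_1,b_2],\ \alpha_1+\alpha_2=\alpha,\ y\in[x_k,x_{k+1}]\bigr\}.$$ Then this minimum is attained, it is nonnegative, and it is positive if $A>0$ and $B>0$. The function $\alpha\mapsto M^{(k)}_{i,j}(P:\alpha)$ is, on $[a_1+b_1,a_2+b_2]$, a continuous piecewise-linear function with $O(n)$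 pieces, all of nonnegative slope (so it is nondecreasing). It can be constructed in $O(n)$ time: there is a single real-RAM program (unit-cost integer addition and subtraction, real arithmetic, comparisons, and indirect memory access) which, given $n,i,j,k,a_1,a_2,b_1,b_2$ and the arrays $(d_t),(c_t),(w_t^-),(w_t^+)$, outputs within $O(n)$ steps the sorted list of $O(n)$ critical points together with the slope and intercept of each linear piece. The constants in the $O(n)$ bounds are absolute. -/

import Mathlib

open Set

/-! ### Dynamic flows on a path -/

/-- A path with vertices `v₀, …, vₙ` and edges `e_t = (v_t, v_{t+1})`, `t < n`; `len t` is the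
time needed to traverse `e_t`, and `cap t` is the amount of flow that can enter `e_t` in unit time.
The values of `len` and `cap` at indices `≥ n` play no role. -/
structure PathNet where
  n : ℕ
  len : ℕ → ℝ
  cap : ℕ → ℝ
  len_pos : ∀ t < n, 0 < len t
  cap_pos : ∀ t < n, 0 < cap t

namespace PathNet

/-- The location `x_t` of the vertex `v_t` on the line; `x₀ = 0`. -/
noncomputable def pos (P : PathNet) (t : ℕ) : ℝ := ∑ r ∈ Finset.range t, P.len r

/-- `W_{a,b} = w_a + ⋯ + w_b`, the total flow starting at the vertices `v_a, …, v_b`. -/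
noncomputable def total (w : ℕ → ℝ) (a b : ℕ) : ℝ := ∑ t ∈ Finset.Icc a b, w t

/-- `F t τ` is the amount of flow that has entered `e_t` from `v_t`, moving right, up to time `τ`.
Flow starts at time `0`, enters `e_t` at rate at most `cap t`, and what has entered `e_t` by time
`τ` was initially at `v_t` or has arrived there over `e_{t-1}`, after the travel time `len (t-1)`. -/
structure IsRightwardFlow (P : PathNet) (w : ℕ → ℝ) (F : ℕ → ℝ → ℝ) : Prop where
  start : ∀ t < P.n, ∀ τ ≤ 0, F t τ = 0
  mono : ∀ t < P.n, Monotone (F t)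
  rate : ∀ t < P.n, ∀ τ τ' : ℝ, τ ≤ τ' → F t τ' - F t τ ≤ P.cap t * (τ' - τ)
  first : 0 < P.n → ∀ τ, F 0 τ ≤ w 0
  supply : ∀ t, t + 1 < P.n → ∀ τ, F (t + 1) τ ≤ w (t + 1) + F t (τ - P.len t)

/-- The same for flow moving left: `F t τ` is the amount of flow that has entered `e_t` from
`v_{t+1}` up to time `τ`. -/
structure IsLeftwardFlow (P : PathNet) (w : ℕ → ℝ) (F : ℕ → ℝ → ℝ) : Prop where
  start : ∀ t < P.n, ∀ τ ≤ 0, F t τ = 0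
  mono : ∀ t < P.n, Monotone (F t)
  rate : ∀ t < P.n, ∀ τ τ' : ℝ, τ ≤ τ' → F t τ' - F t τ ≤ P.cap t * (τ' - τ)
  first : ∀ t, t + 1 = P.n → ∀ τ, F t τ ≤ w (t + 1)
  supply : ∀ t, t + 1 < P.n → ∀ τ, F t τ ≤ w (t + 1) + F (t + 1) (τ - P.len (t + 1))

/-- `Θ_L(P, x : w)`, the time needed to evacuate all the flow in `[0, x)` to `x`: the least `T ≥ 0`
such that some rightward flow has brought the flow of all the vertices left of `x` to `x` by time
`T`.  Here `e_t` is the edge over which flow arrives at `x`. -/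
noncomputable def thetaL (P : PathNet) (w : ℕ → ℝ) (x : ℝ) : ℝ :=
  sInf {T : ℝ | 0 ≤ T ∧ ∃ F, P.IsRightwardFlow w F ∧
    ∀ t < P.n, P.pos t < x → x ≤ P.pos (t + 1) → F t (T - (x - P.pos t)) = total w 0 t}

/-- `Θ_R(P, x : w)`, the time needed to evacuate all the flow in `(x, xₙ]` to `x`. -/
noncomputable def thetaR (P : PathNet) (w : ℕ → ℝ) (x : ℝ) : ℝ :=
  sInf {T : ℝ | 0 ≤ T ∧ ∃ F, P.IsLeftwardFlow w F ∧
    ∀ t < P.n, P.pos t ≤ x → x < P.pos (t + 1) →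
      F t (T - (P.pos (t + 1) - x)) = total w (t + 1) P.n}

/-- `Θ(P, x : w)`, the time needed to evacuate all the flow to the sink `x`. -/
noncomputable def theta (P : PathNet) (w : ℕ → ℝ) (x : ℝ) : ℝ :=
  max (P.thetaL w x) (P.thetaR w x)

/-! The evacuation times are given by the usual closed formulas. -/

/-- `c(x, x') = min {c_t : i ≤ t < j}` with `i = max {i' : x_{i'} ≤ x}` and
`j = min {j' : x_{j'} ≥ x'}`. -/
noncomputable def minCap (P : PathNet) (x x' : ℝ) : ℝ :=
  sInf (P.cap '' Ico (sSup {i | i ≤ P.n ∧ P.pos i ≤ x}) (sInf {j | j ≤ P.n ∧ x' ≤ P.pos j}))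

/-- `g_i(x : w)`. -/
noncomputable def costL (P : PathNet) (w : ℕ → ℝ) (x : ℝ) (i : ℕ) : ℝ :=
  if 0 < total w 0 i then (x - P.pos i) + total w 0 i / P.minCap (P.pos i) x else 0

/-- `h_i(x : w)`. -/
noncomputable def costR (P : PathNet) (w : ℕ → ℝ) (x : ℝ) (i : ℕ) : ℝ :=
  if 0 < total w i P.n then (P.pos i - x) + total w i P.n / P.minCap x (P.pos i) else 0

theorem chain_flow (k : ℕ) (len cap w D W : ℕ → ℝ) (T : ℝ)
    (hD : ∀ t < k, D t = D (t + 1) + len t)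
    (hcap : ∀ t ≤ k, 0 < cap t) (hw : ∀ t ≤ k, 0 ≤ w t)
    (hW0 : W 0 = w 0) (hW : ∀ t < k, W (t + 1) = W t + w (t + 1)) :
    (∃ F : ℕ → ℝ → ℝ, (∀ t ≤ k, ∀ τ ≤ 0, F t τ = 0) ∧ (∀ t ≤ k, Monotone (F t)) ∧
      (∀ t ≤ k, ∀ τ τ' : ℝ, τ ≤ τ' → F t τ' - F t τ ≤ cap t * (τ' - τ)) ∧
      (∀ τ, F 0 τ ≤ w 0) ∧ (∀ t < k, ∀ τ, F (t + 1) τ ≤ w (t + 1) + F t (τ - len t)) ∧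
      F k (T - D k) = W k) ↔
    ∀ t u, t ≤ u → u ≤ k → 0 < W t → D t + W t / cap u ≤ T := by
  have hWn : ∀ t ≤ k, 0 ≤ W t := by
    intro t ht
    induction t with
    | zero => rw [hW0]; exact hw 0 ht
    | succ t ih => rw [hW t (by omega)]; exact add_nonneg (ih (by omega)) (hw _ ht)
  constructor
  · rintro ⟨F, h0, hm, hr, hf, hs, hT⟩ t u htu huk hpos
    have key : ∀ v, u ≤ v → v ≤ k → ∀ τ, F v τ ≤ W v - W u + F u (τ - (D u - D v)) := by
      intro v huv hvk
      induction v, huv using Nat.le_induction with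
      | base => intro τ; simp
      | succ v hv ih =>
        intro τ
        have h1 := hs v (by omega) τ
        have h2 := ih (by omega) (τ - len v)
        have h3 := hD v (by omega)
        have h4 := hW v (by omega)
        have e : τ - len v - (D u - D v) = τ - (D u - D (v + 1)) := by rw [h3]; ring
        rw [e] at h2
        linarith
    have key2 : ∀ v, t ≤ v → v ≤ k → ∀ τ, F v τ ≤ W v - W t + F t (τ - (D t - D v)) := by
      intro v huv hvk
      induction v, huv using Nat.le_induction with
      | base => intro τ; simp
      | succ v hv ih =>
        intro τ
        have h1 := hs v (by omega) τ
        have h2 := ih (by omega) (τ - len v)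
        have h3 := hD v (by omega)
        have h4 := hW v (by omega)
        have e : τ - len v - (D t - D v) = τ - (D t - D (v + 1)) := by rw [h3]; ring
        rw [e] at h2
        linarith
    have hA := key k huk le_rfl (T - D k)
    have e1 : T - D k - (D u - D k) = T - D u := by ring
    rw [e1, hT] at hA
    have hB := key2 u htu huk (D t - D u)
    rw [sub_self, h0 t (by omega) 0 le_rfl] at hB
    have hlt : D t - D u ≤ T - D u := by
      by_contra hcon
      have := hm u huk (le_of_not_ge hcon)
      linarith
    have hC := hr u huk _ _ hlt
    have hcu := hcap u huk
    have : W t / cap u ≤ T - D t := by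
      rw [div_le_iff₀ hcu]
      have e2 : cap u * (T - D u - (D t - D u)) = (T - D t) * cap u := by ring
      linarith
    linarith
  · intro hcond
    let ρ : ℕ → ℝ := fun t => W t / (T - D t)
    have hTD : ∀ t ≤ k, 0 < W t → 0 < T - D t := by
      intro t ht hp
      have h1 := hcond t t le_rfl ht hp
      have h2 := div_pos hp (hcap t ht)
      linarith
    have hρ0 : ∀ t ≤ k, 0 ≤ ρ t := by
      intro t ht
      rcases (hWn t ht).eq_or_lt with h | h
      · simp [ρ, ← h]
      · exact (div_pos h (hTD t ht h)).le
    have hρc : ∀ t u, t ≤ u → u ≤ k → ρ t ≤ cap u := by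
      intro t u htu hu
      rcases (hWn t (by omega)).eq_or_lt with h | h
      · simpa [ρ, ← h] using (hcap u hu).le
      · have h1 := hcond t u htu hu h
        have h2 := hTD t (by omega) h
        have hcu := hcap u hu
        change W t / (T - D t) ≤ cap u
        rw [div_le_iff₀ h2]
        have h3 : W t / cap u ≤ T - D t := by linarith
        rw [div_le_iff₀ hcu] at h3
        linarith
    let F : ℕ → ℝ → ℝ := fun u => Nat.rec (fun τ => min (w 0) (ρ 0 * max τ 0))
      (fun u f τ => min (w (u + 1) + f (τ - len u)) (ρ (u + 1) * max τ 0)) u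
    have F0 : ∀ τ, F 0 τ = min (w 0) (ρ 0 * max τ 0) := fun τ => rfl
    have FS : ∀ u τ, F (u + 1) τ = min (w (u + 1) + F u (τ - len u)) (ρ (u + 1) * max τ 0) :=
      fun u τ => rfl
    have Fn : ∀ u ≤ k, ∀ τ, 0 ≤ F u τ := by
      intro u hu
      induction u with
      | zero =>
        intro τ; rw [F0]
        exact le_min (hw 0 hu) (mul_nonneg (hρ0 0 hu) (le_max_right _ _))
      | succ u ih =>
        intro τ; rw [FS]
        exact le_min (add_nonneg (hw _ hu) (ih (by omega) _))
          (mul_nonneg (hρ0 _ hu) (le_max_right _ _))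
    have Fz : ∀ u ≤ k, ∀ τ ≤ 0, F u τ = 0 := by
      intro u hu τ hτ
      refine le_antisymm ?_ (Fn u hu τ)
      cases u with
      | zero => rw [F0, max_eq_right hτ, mul_zero]; exact min_le_right _ _
      | succ u => rw [FS, max_eq_right hτ, mul_zero]; exact min_le_right _ _
    have Fm : ∀ u ≤ k, Monotone (F u) := by
      intro u hu
      induction u with
      | zero =>
        intro a b hab; rw [F0, F0]
        exact min_le_min le_rfl (mul_le_mul_of_nonneg_left (max_le_max hab le_rfl) (hρ0 0 hu))
      | succ u ih =>
        intro a b hab; rw [FS, FS]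
        refine min_le_min ?_ (mul_le_mul_of_nonneg_left (max_le_max hab le_rfl) (hρ0 _ hu))
        have := ih (by omega) (sub_le_sub_right hab (len u))
        linarith
    have lip : ∀ r L a b : ℝ, 0 ≤ r → r ≤ L → a ≤ b →
        r * max b 0 ≤ r * max a 0 + L * (b - a) := by
      intro r L a b h0 h1 h2
      have h3 : max b 0 ≤ max a 0 + (b - a) :=
        max_le (by linarith [le_max_left a 0]) (by linarith [le_max_right a 0])
      have h4 := mul_le_mul_of_nonneg_left h3 h0
      have h5 := mul_le_mul_of_nonneg_right h1 (sub_nonneg.2 h2)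
      linarith
    have Fl : ∀ u ≤ k, ∀ L, 0 ≤ L → (∀ t ≤ u, ρ t ≤ L) → ∀ a b : ℝ, a ≤ b →
        F u b ≤ F u a + L * (b - a) := by
      intro u hu L hL
      induction u with
      | zero =>
        intro hρL a b hab
        have hn := mul_nonneg hL (sub_nonneg.2 hab)
        rw [F0, F0, min_add]
        exact min_le_min (by linarith) (lip _ _ _ _ (hρ0 0 hu) (hρL 0 le_rfl) hab)
      | succ u ih =>
        intro hρL a b hab
        have h1 := ih (by omega) (fun t ht => hρL t (by omega)) (a - len u) (b - len u)
          (by linarith)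
        rw [FS, FS, min_add]
        refine min_le_min ?_ (lip _ _ _ _ (hρ0 _ hu) (hρL _ le_rfl) hab)
        have e : L * (b - len u - (a - len u)) = L * (b - a) := by ring
        linarith
    have hfin : ∀ t ≤ k, ρ t * max (T - D t) 0 = W t := by
      intro t ht
      rcases (hWn t ht).eq_or_lt with h | h
      · simp [ρ, ← h]
      · have := hTD t ht h
        rw [max_eq_left this.le]
        exact div_mul_cancel₀ _ this.ne'
    refine ⟨F, Fz, Fm, ?_, fun τ => by rw [F0]; exact min_le_left _ _,
      fun t _ τ => by rw [FS]; exact min_le_left _ _, ?_⟩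
    · intro t ht a b hab
      have := Fl t ht (cap t) (hcap t ht).le (fun s hs => hρc s t hs ht) a b hab
      linarith
    · have : ∀ u ≤ k, F u (T - D u) = W u := by
        intro u hu
        induction u with
        | zero => rw [F0, hfin 0 hu, hW0, min_self]
        | succ u ih =>
          have e : T - D (u + 1) - len u = T - D u := by rw [hD u (by omega)]; ring
          rw [FS, hfin _ hu, e, ih (by omega), hW u (by omega), add_comm, min_self]
      exact this k le_rfl

theorem pos_succ (P : PathNet) (t : ℕ) : P.pos (t + 1) = P.pos t + P.len t :=
  Finset.sum_range_succ _ _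

theorem pos_le (P : PathNet) {a b : ℕ} (hab : a ≤ b) (hb : b ≤ P.n) : P.pos a ≤ P.pos b := by
  induction b, hab using Nat.le_induction with
  | base => exact le_rfl
  | succ b h ih =>
    rw [pos_succ]
    linarith [ih (by omega), P.len_pos b (by omega)]

theorem pos_lt (P : PathNet) {a b : ℕ} (hab : a < b) (hb : b ≤ P.n) : P.pos a < P.pos b := by
  have h1 := P.pos_le (show a + 1 ≤ b by omega) hb
  rw [pos_succ] at h1
  linarith [P.len_pos a (by omega)]

theorem total_nonneg (P : PathNet) {w : ℕ → ℝ} (hw : ∀ t ≤ P.n, 0 ≤ w t) {a b : ℕ}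
    (hb : b ≤ P.n) : 0 ≤ total w a b :=
  Finset.sum_nonneg fun t ht => hw t ((Finset.mem_Icc.1 ht).2.trans hb)

theorem minCap_eq (P : PathNet) {x x' : ℝ} {a b : ℕ} (hb : b ≤ P.n) (hab : a < b)
    (ha1 : P.pos a ≤ x) (ha2 : x < P.pos (a + 1)) (hb1 : x' ≤ P.pos b)
    (hb2 : ∀ j < b, P.pos j < x') : P.minCap x x' = sInf (P.cap '' Ico a b) := by
  have h1 : sSup {i | i ≤ P.n ∧ P.pos i ≤ x} = a := by
    refine IsGreatest.csSup_eq ⟨⟨by omega, ha1⟩, ?_⟩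
    rintro i ⟨hi, hix⟩
    by_contra hcon
    linarith [P.pos_le (show a + 1 ≤ i by omega) hi]
  have h2 : sInf {j | j ≤ P.n ∧ x' ≤ P.pos j} = b := by
    refine IsLeast.csInf_eq ⟨⟨hb, hb1⟩, ?_⟩
    rintro j ⟨_, hj⟩
    by_contra hcon
    linarith [hb2 j (by omega)]
  rw [minCap, h1, h2]

theorem isLeast_capInf (cap : ℕ → ℝ) {a b : ℕ} (hab : a < b) :
    IsLeast (cap '' Ico a b) (sInf (cap '' Ico a b)) :=
  ((finite_Ico a b).image cap).isCompact.isLeast_sInf ⟨_, a, ⟨le_rfl, hab⟩, rfl⟩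

theorem exists_edge (P : PathNet) {x : ℝ} (h0 : 0 < x) (h1 : x ≤ P.pos P.n) :
    ∃ k < P.n, P.pos k < x ∧ x ≤ P.pos (k + 1) := by
  have hex : ∃ k, x ≤ P.pos k := ⟨_, h1⟩
  classical
  have hk := Nat.find_spec hex
  have hn := Nat.find_min' hex h1
  rcases hz : Nat.find hex with _ | k
  · rw [hz] at hk; simp [pos] at hk; linarith
  · rw [hz] at hk hn
    exact ⟨k, by omega, not_le.1 (Nat.find_min hex (by omega)), hk⟩

theorem exists_edge' (P : PathNet) {x : ℝ} (h0 : 0 ≤ x) (h1 : x < P.pos P.n) :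
    ∃ k < P.n, P.pos k ≤ x ∧ x < P.pos (k + 1) := by
  have hex : ∃ k, x < P.pos k := ⟨_, h1⟩
  classical
  have hk := Nat.find_spec hex
  have hn := Nat.find_min' hex h1
  rcases hz : Nat.find hex with _ | k
  · rw [hz] at hk; simp [pos] at hk; linarith
  · rw [hz] at hk hn
    exact ⟨k, by omega, not_lt.1 (Nat.find_min hex (by omega)), hk⟩

/-- The closed formula for `Θ_L`; the supremum over the empty set is `0`. -/
theorem thetaL_eq (P : PathNet) (w : ℕ → ℝ) (hw : ∀ t ≤ P.n, 0 ≤ w t) (x : ℝ) (h0 : 0 ≤ x)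
    (h1 : x ≤ P.pos P.n) :
    P.thetaL w x = sSup (P.costL w x '' {i | i ≤ P.n ∧ P.pos i < x}) := by
  rcases h0.eq_or_lt with h0 | h0
  · subst h0
    have hp : ∀ i ≤ P.n, 0 ≤ P.pos i := fun i hi => by
      have := P.pos_le (Nat.zero_le i) hi
      simpa [pos] using this
    have e : {i | i ≤ P.n ∧ P.pos i < 0} = ∅ := by
      ext i; simp only [mem_ofPred_eq, mem_empty_iff_false, iff_false, not_and, not_lt]
      exact hp i
    rw [e, image_empty, Real.sSup_empty, thetaL]
    refine IsLeast.csInf_eq ⟨⟨le_rfl, fun _ _ => 0, ⟨?_, ?_, ?_, ?_, ?_⟩, ?_⟩, fun T hT => hT.1⟩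
    · intros; rfl
    · intro t _; exact monotone_const
    · intro t ht a b hab; rw [sub_self]
      exact mul_nonneg (P.cap_pos t ht).le (sub_nonneg.2 hab)
    · intro _ _; exact hw 0 (Nat.zero_le _)
    · intro t ht τ; simpa using hw _ ht.le
    · intro t ht h _; linarith [hp t ht.le]
  · obtain ⟨k, hk, hk1, hk2⟩ := P.exists_edge h0 h1
    have huniq : ∀ t < P.n, P.pos t < x → x ≤ P.pos (t + 1) → t = k := by
      intro t ht h2 h3
      rcases lt_trichotomy t k with h | h | h
      · linarith [P.pos_le (show t + 1 ≤ k by omega) hk.le]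
      · exact h
      · linarith [P.pos_le (show k + 1 ≤ t by omega) ht.le]
    have hset : {i | i ≤ P.n ∧ P.pos i < x} = Iic k := by
      ext i
      simp only [mem_ofPred_eq, mem_Iic]
      constructor
      · rintro ⟨hi, hix⟩
        by_contra hcon
        linarith [P.pos_le (show k + 1 ≤ i by omega) hi]
      · intro hi
        exact ⟨by omega, (P.pos_le hi hk.le).trans_lt hk1⟩
    have hch : ∀ T, (∃ F, P.IsRightwardFlow w F ∧ ∀ t < P.n, P.pos t < x → x ≤ P.pos (t + 1) →
        F t (T - (x - P.pos t)) = total w 0 t) ↔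
        ∀ t u, t ≤ u → u ≤ k → 0 < total w 0 t → (x - P.pos t) + total w 0 t / P.cap u ≤ T := by
      intro T
      rw [← chain_flow k P.len P.cap w (fun t => x - P.pos t) (total w 0) T
        (fun t _ => by rw [pos_succ]; ring) (fun t ht => P.cap_pos t (by omega))
        (fun t ht => hw t (by omega)) (by simp [total])
        (fun t _ => Finset.sum_Icc_succ_top (Nat.zero_le _) _)]
      constructor
      · rintro ⟨F, hF, hT⟩
        exact ⟨F, fun t ht => hF.start t (by omega), fun t ht => hF.mono t (by omega),
          fun t ht => hF.rate t (by omega), hF.first (by omega),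
          fun t ht => hF.supply t (by omega), hT k hk hk1 hk2⟩
      · rintro ⟨F, f0, fm, fr, ff, fs, hT⟩
        have fnn : ∀ t ≤ k, ∀ τ, 0 ≤ F t τ := fun t ht τ => by
          rw [← f0 t ht (min τ 0) (min_le_right _ _)]
          exact fm t ht (min_le_left _ _)
        refine ⟨fun t τ => if t ≤ k then F t τ else 0, ⟨?_, ?_, ?_, ?_, ?_⟩, ?_⟩
        · intro t _ τ hτ
          by_cases h : t ≤ k
          · simp only [if_pos h]; exact f0 t h τ hτ
          · simp only [if_neg h]
        · intro t _
          by_cases h : t ≤ k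
          · simp only [if_pos h]; exact fm t h
          · simp only [if_neg h]; exact monotone_const
        · intro t ht a b hab
          by_cases h : t ≤ k
          · simp only [if_pos h]; exact fr t h a b hab
          · simp only [if_neg h, sub_self]
            exact mul_nonneg (P.cap_pos t ht).le (sub_nonneg.2 hab)
        · intro _ τ
          simp only [Nat.zero_le, if_true]; exact ff τ
        · intro t ht τ
          by_cases h : t + 1 ≤ k
          · simp only [if_pos h, if_pos (show t ≤ k by omega)]; exact fs t (by omega) τ
          · simp only [if_neg h]
            by_cases h' : t ≤ k
            · simp only [if_pos h']; exact add_nonneg (hw _ ht.le) (fnn t h' _)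
            · simp only [if_neg h', add_zero]; exact hw _ ht.le
        · intro t ht h2 h3
          obtain rfl := huniq t ht h2 h3
          simpa using hT
    have hmc : ∀ t ≤ k, P.minCap (P.pos t) x = sInf (P.cap '' Ico t (k + 1)) := fun t ht =>
      P.minCap_eq hk (by omega) le_rfl (P.pos_lt (Nat.lt_succ_self t) (by omega)) hk2
        (fun j hj => (P.pos_le (show j ≤ k by omega) hk.le).trans_lt hk1)
    have hfin : (P.costL w x '' Iic k).Finite := (finite_Iic k).image _
    have hle : ∀ t ≤ k, P.costL w x t ≤ sSup (P.costL w x '' Iic k) := fun t ht =>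
      le_csSup hfin.bddAbove ⟨t, ht, rfl⟩
    have hnn : ∀ t ≤ k, 0 ≤ P.costL w x t := by
      intro t ht
      rw [costL]
      split_ifs with h
      · have h2 := (isLeast_capInf P.cap (show t < k + 1 by omega)).1
        obtain ⟨u, hu, he⟩ := h2
        rw [hmc t ht, ← he]
        have h3 := P.pos_le ht hk.le
        have h4 := div_pos h (P.cap_pos u (by have := hu.2; omega))
        linarith
      · exact le_rfl
    rw [hset, thetaL]
    refine IsLeast.csInf_eq ⟨⟨(hnn 0 (Nat.zero_le _)).trans (hle 0 (Nat.zero_le _)), ?_⟩, ?_⟩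
    · rw [hch]
      intro t u htu hu hp
      refine le_trans ?_ (hle t (by omega))
      rw [costL, if_pos hp, hmc t (by omega)]
      have hl := isLeast_capInf P.cap (show t < k + 1 by omega)
      have h2 := hl.2 ⟨u, ⟨htu, by omega⟩, rfl⟩
      obtain ⟨v, hv, he⟩ := hl.1
      have h3 : 0 < sInf (P.cap '' Ico t (k + 1)) := by
        rw [← he]; exact P.cap_pos v (by have := hv.2; omega)
      have h4 := div_le_div_of_nonneg_left hp.le h3 h2
      linarith
    · rintro T ⟨hT0, hT⟩
      rw [hch] at hT
      refine csSup_le ⟨_, 0, Nat.zero_le _, rfl⟩ ?_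
      rintro _ ⟨t, ht, rfl⟩
      rw [costL]
      split_ifs with h
      · obtain ⟨v, hv, he⟩ := (isLeast_capInf P.cap
          (show t < k + 1 by have : t ≤ k := ht; omega)).1
        rw [hmc t ht, ← he]
        exact hT t v hv.1 (by have := hv.2; omega) h
      · exact hT0

/-- The closed formula for `Θ_R`; the supremum over the empty set is `0`. -/
theorem thetaR_eq (P : PathNet) (w : ℕ → ℝ) (hw : ∀ t ≤ P.n, 0 ≤ w t) (x : ℝ) (h0 : 0 ≤ x)
    (h1 : x ≤ P.pos P.n) :
    P.thetaR w x = sSup (P.costR w x '' {i | i ≤ P.n ∧ x < P.pos i}) := by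
  rcases h1.eq_or_lt with h1 | h1
  · have hp : ∀ i ≤ P.n, P.pos i ≤ x := fun i hi => h1 ▸ P.pos_le hi le_rfl
    have e : {i | i ≤ P.n ∧ x < P.pos i} = ∅ := by
      ext i; simp only [mem_ofPred_eq, mem_empty_iff_false, iff_false, not_and, not_lt]
      exact hp i
    rw [e, image_empty, Real.sSup_empty, thetaR]
    refine IsLeast.csInf_eq ⟨⟨le_rfl, fun _ _ => 0, ⟨?_, ?_, ?_, ?_, ?_⟩, ?_⟩, fun T hT => hT.1⟩
    · intros; rfl
    · intro t _; exact monotone_const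
    · intro t ht a b hab; rw [sub_self]
      exact mul_nonneg (P.cap_pos t ht).le (sub_nonneg.2 hab)
    · intro t ht _; exact hw _ ht.le
    · intro t ht τ; simpa using hw _ ht.le
    · intro t ht _ h; linarith [hp (t + 1) ht]
  · obtain ⟨k, hk, hk1, hk2⟩ := P.exists_edge' h0 h1
    have huniq : ∀ t < P.n, P.pos t ≤ x → x < P.pos (t + 1) → t = k := by
      intro t ht h2 h3
      rcases lt_trichotomy t k with h | h | h
      · linarith [P.pos_le (show t + 1 ≤ k by omega) hk.le]
      · exact h
      · linarith [P.pos_le (show k + 1 ≤ t by omega) ht.le]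
    have hset : {i | i ≤ P.n ∧ x < P.pos i} = Icc (k + 1) P.n := by
      ext i
      simp only [mem_ofPred_eq, mem_Icc]
      constructor
      · rintro ⟨hi, hix⟩
        refine ⟨?_, hi⟩
        by_contra hcon
        linarith [P.pos_le (show i ≤ k by omega) hk.le]
      · rintro ⟨hi, hin⟩
        exact ⟨hin, hk2.trans_le (P.pos_le hi hin)⟩
    have hch : ∀ T, (∃ F, P.IsLeftwardFlow w F ∧ ∀ t < P.n, P.pos t ≤ x → x < P.pos (t + 1) →
        F t (T - (P.pos (t + 1) - x)) = total w (t + 1) P.n) ↔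
        ∀ t u, k ≤ u → u < t → t ≤ P.n → 0 < total w t P.n →
          (P.pos t - x) + total w t P.n / P.cap u ≤ T := by
      intro T
      have hC := chain_flow (P.n - 1 - k) (fun t => P.len (P.n - 1 - t))
        (fun t => P.cap (P.n - 1 - t)) (fun t => w (P.n - t))
        (fun t => P.pos (P.n - t) - x) (fun t => total w (P.n - t) P.n) T
        (fun t ht => by
          have e : P.n - t = (P.n - (t + 1)) + 1 := by omega
          have e' : P.n - 1 - t = P.n - (t + 1) := by omega
          simp only [e']
          rw [e, pos_succ]; ring)
        (fun t ht => P.cap_pos _ (by omega))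
        (fun t ht => hw _ (by omega)) (by simp [total])
        (fun t ht => by
          have e : P.n - t = (P.n - (t + 1)) + 1 := by omega
          rw [e, total, total, ← Finset.insert_Icc_add_one_left_eq_Icc (by omega),
            Finset.sum_insert (by simp)]
          exact add_comm _ _)
      have hR : (∀ t u, t ≤ u → u ≤ P.n - 1 - k → 0 < total w (P.n - t) P.n →
          P.pos (P.n - t) - x + total w (P.n - t) P.n / P.cap (P.n - 1 - u) ≤ T) ↔
          ∀ t u, k ≤ u → u < t → t ≤ P.n → 0 < total w t P.n →
          (P.pos t - x) + total w t P.n / P.cap u ≤ T := by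
        constructor
        · intro h t u hku hut htn hp
          have := h (P.n - t) (P.n - 1 - u) (by omega) (by omega)
          rw [show P.n - (P.n - t) = t by omega, show P.n - 1 - (P.n - 1 - u) = u by omega] at this
          exact this hp
        · intro h t u htu hu hp
          exact h (P.n - t) (P.n - 1 - u) (by omega) (by omega) (by omega) hp
      rw [← hR, ← hC]
      constructor
      · rintro ⟨F, hF, hT⟩
        refine ⟨fun t => F (P.n - 1 - t), fun t ht => hF.start _ (by omega),
          fun t ht => hF.mono _ (by omega), fun t ht => hF.rate _ (by omega), ?_, ?_, ?_⟩
        · intro τ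
          have := hF.first (P.n - 1) (by omega) τ
          rw [show P.n - 1 + 1 = P.n by omega] at this
          exact this
        · intro t ht τ
          have := hF.supply (P.n - 1 - (t + 1)) (by omega) τ
          rw [show P.n - 1 - (t + 1) + 1 = P.n - 1 - t by omega] at this
          rw [show P.n - (t + 1) = P.n - 1 - t by omega]
          exact this
        · have := hT k hk hk1 hk2
          simp only
          rw [show P.n - 1 - (P.n - 1 - k) = k by omega,
            show P.n - (P.n - 1 - k) = k + 1 by omega]
          exact this
      · rintro ⟨F, f0, fm, fr, ff, fs, hT⟩
        have fnn : ∀ t ≤ P.n - 1 - k, ∀ τ, 0 ≤ F t τ := fun t ht τ => by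
          rw [← f0 t ht (min τ 0) (min_le_right _ _)]
          exact fm t ht (min_le_left _ _)
        refine ⟨fun t τ => if k ≤ t then F (P.n - 1 - t) τ else 0, ⟨?_, ?_, ?_, ?_, ?_⟩, ?_⟩
        · intro t _ τ hτ
          by_cases h : k ≤ t
          · simp only [if_pos h]; exact f0 _ (by omega) τ hτ
          · simp only [if_neg h]
        · intro t _
          by_cases h : k ≤ t
          · simp only [if_pos h]; exact fm _ (by omega)
          · simp only [if_neg h]; exact monotone_const
        · intro t ht a b hab
          by_cases h : k ≤ t
          · simp only [if_pos h]
            have := fr (P.n - 1 - t) (by omega) a b hab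
            rwa [show P.n - 1 - (P.n - 1 - t) = t by omega] at this
          · simp only [if_neg h, sub_self]
            exact mul_nonneg (P.cap_pos t ht).le (sub_nonneg.2 hab)
        · intro t ht τ
          have e : P.n - 1 - t = 0 := by omega
          simp only [if_pos (show k ≤ t by omega), e]
          have := ff τ
          rwa [Nat.sub_zero, ← ht] at this
        · intro t ht τ
          by_cases h : k ≤ t
          · simp only [if_pos h, if_pos (show k ≤ t + 1 by omega)]
            have := fs (P.n - 1 - (t + 1)) (by omega) τ
            rw [show P.n - 1 - (t + 1) + 1 = P.n - 1 - t by omega,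
              show P.n - (P.n - 1 - t) = t + 1 by omega,
              show P.n - 1 - (P.n - 1 - (t + 1)) = t + 1 by omega] at this
            exact this
          · simp only [if_neg h]
            by_cases h' : k ≤ t + 1
            · simp only [if_pos h']; exact add_nonneg (hw _ ht.le) (fnn _ (by omega) _)
            · simp only [if_neg h', add_zero]; exact hw _ ht.le
        · intro t ht h2 h3
          obtain rfl := huniq t ht h2 h3
          simp only [le_refl, if_true]
          rw [show P.n - (P.n - 1 - t) = t + 1 by omega] at hT
          exact hT
    have hmc : ∀ t, k < t → t ≤ P.n → P.minCap x (P.pos t) = sInf (P.cap '' Ico k t) :=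
      fun t ht htn => P.minCap_eq htn ht hk1 hk2 le_rfl (fun j hj => P.pos_lt hj htn)
    have hfin : (P.costR w x '' Icc (k + 1) P.n).Finite := (finite_Icc _ _).image _
    have hle : ∀ t, k < t → t ≤ P.n →
        P.costR w x t ≤ sSup (P.costR w x '' Icc (k + 1) P.n) := fun t ht htn =>
      le_csSup hfin.bddAbove ⟨t, ⟨ht, htn⟩, rfl⟩
    have hnn : 0 ≤ P.costR w x P.n := by
      rw [costR]
      split_ifs with h
      · obtain ⟨u, hu, he⟩ := (isLeast_capInf P.cap hk).1
        rw [hmc _ hk le_rfl, ← he]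
        have h4 := div_pos h (P.cap_pos u hu.2)
        linarith
      · exact le_rfl
    rw [hset, thetaR]
    refine IsLeast.csInf_eq ⟨⟨hnn.trans (hle _ hk le_rfl), ?_⟩, ?_⟩
    · rw [hch]
      intro t u hku hut htn hp
      refine le_trans ?_ (hle t (by omega) htn)
      rw [costR, if_pos hp, hmc t (by omega) htn]
      have hl := isLeast_capInf P.cap (show k < t by omega)
      have h2 := hl.2 ⟨u, ⟨hku, hut⟩, rfl⟩
      obtain ⟨v, hv, he⟩ := hl.1
      have h3 : 0 < sInf (P.cap '' Ico k t) := by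
        rw [← he]; exact P.cap_pos v (by have := hv.2; omega)
      have h4 := div_le_div_of_nonneg_left hp.le h3 h2
      linarith
    · rintro T ⟨hT0, hT⟩
      rw [hch] at hT
      refine csSup_le ⟨_, P.n, ⟨hk, le_rfl⟩, rfl⟩ ?_
      rintro _ ⟨t, ⟨ht, htn⟩, rfl⟩
      rw [costR]
      split_ifs with h
      · obtain ⟨v, hv, he⟩ := (isLeast_capInf P.cap (show k < t by omega)).1
        rw [hmc t ht htn, ← he]
        exact hT t v hv.1 hv.2 htn h
      · exact hT0

end PathNet

/-! ### Scenarios with two varying weights -/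

/-- The ranges `[lo t, hi t]` of the weights of the vertices `v_0, …, v_n`. -/
structure WeightRanges (n : ℕ) where
  lo : ℕ → ℝ
  hi : ℕ → ℝ
  lo_nonneg : ∀ t ≤ n, 0 ≤ lo t
  lo_le_hi : ∀ t ≤ n, lo t ≤ hi t

/-- The scenario `s_{i,j}(α, β)`. -/
noncomputable def WeightRanges.twoVarying {n : ℕ} (R : WeightRanges n) (i j : ℕ) (α β : ℝ) :
    ℕ → ℝ := fun t =>
  if t = i then α else if t = j then β else if i < t ∧ t < j then R.hi t else R.lo t

/-- A box `B(a₁, a₂, b₁, b₂) = [a₁, a₂] × [b₁, b₂]` of pairs of weights. -/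
structure WeightBox where
  a₁ : ℝ
  a₂ : ℝ
  b₁ : ℝ
  b₂ : ℝ
  a_nonneg : 0 ≤ a₁
  a_le : a₁ ≤ a₂
  b_nonneg : 0 ≤ b₁
  b_le : b₁ ≤ b₂

/-- `B(a₁, a₂, b₁, b₂ : α)`. -/
def WeightBox.slice (B : WeightBox) (α : ℝ) : Set (ℝ × ℝ) :=
  {p | p.1 ∈ Icc B.a₁ B.a₂ ∧ p.2 ∈ Icc B.b₁ B.b₂ ∧ p.1 + p.2 = α}

/-- The evacuation times `Θ(P, y : s_{i,j}(α₁, α₂))` over all `(α₁, α₂) ∈ B(α)` and all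
`y ∈ [x_k, x_{k+1}]`. -/
def evacTimes (P : PathNet) (R : WeightRanges P.n) (i j k : ℕ) (B : WeightBox) (α : ℝ) : Set ℝ :=
  {θ | ∃ p ∈ B.slice α, ∃ y ∈ Icc (P.pos k) (P.pos (k + 1)),
    P.theta (R.twoVarying i j p.1 p.2) y = θ}

/-- `M^{(k)}_{i,j}(P : α)`. -/
noncomputable def minEvac (P : PathNet) (R : WeightRanges P.n) (i j k : ℕ) (B : WeightBox)
    (α : ℝ) : ℝ :=
  sInf (evacTimes P R i j k B α)

/-! ### Piecewise linear functions -/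

/-- On `[A, B]` the function `f` consists of the `m` linear pieces
`f α = slope t * α + icpt t`, `α ∈ [q t, q (t+1)]`, `t < m`, all with nonnegative slope, where
`A = q 0 ≤ q 1 ≤ ⋯ ≤ q m = B`. -/
structure IsGoodRepr (f : ℝ → ℝ) (A B : ℝ) (m : ℕ) (q slope icpt : ℕ → ℝ) : Prop where
  left : q 0 = A
  right : q m = B
  pos : 0 < m
  sorted : ∀ t < m, q t ≤ q (t + 1)
  linear : ∀ t < m, ∀ α ∈ Icc (q t) (q (t + 1)), f α = slope t * α + icpt t
  slope_nonneg : ∀ t < m, 0 ≤ slope t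

/-- `f` is, on `[A, B]`, a continuous piecewise linear function of size at most `N`, all of whose
slopes are nonnegative. -/
def IsGoodOn (f : ℝ → ℝ) (A B : ℝ) (N : ℕ) : Prop :=
  ContinuousOn f (Icc A B) ∧ ∃ m ≤ N, ∃ q slope icpt, IsGoodRepr f A B m q slope icpt

/-! ### A real random access machine

Integer and real registers, integer and real arrays with indirect addressing, and structured
programs.  Every arithmetic operation, comparison, memory access and control step costs one. -/

namespace RealRAM

structure State where
  nat : ℕ → ℕ
  real : ℕ → ℝ
  natArr : ℕ → ℕ → ℕ
  realArr : ℕ → ℕ → ℝ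

inductive NExp where
  | lit (c : ℕ)
  | reg (r : ℕ)
  | read (a : ℕ) (e : NExp)
  | add (e₁ e₂ : NExp)
  | sub (e₁ e₂ : NExp)

/-- The real constants of a program are rational. -/
inductive RExp where
  | lit (c : ℚ)
  | reg (r : ℕ)
  | read (a : ℕ) (e : NExp)
  | add (e₁ e₂ : RExp)
  | sub (e₁ e₂ : RExp)
  | mul (e₁ e₂ : RExp)
  | div (e₁ e₂ : RExp)

inductive Test where
  | natLt (e₁ e₂ : NExp)
  | natEq (e₁ e₂ : NExp)
  | realLt (e₁ e₂ : RExp)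
  | realEq (e₁ e₂ : RExp)
  | not (b : Test)
  | and (b₁ b₂ : Test)

inductive Prog where
  | skip
  | setNat (r : ℕ) (e : NExp)
  | setReal (r : ℕ) (e : RExp)
  | writeNat (a : ℕ) (idx e : NExp)
  | writeReal (a : ℕ) (idx : NExp) (e : RExp)
  | seq (p₁ p₂ : Prog)
  | branch (b : Test) (p₁ p₂ : Prog)
  | loop (b : Test) (p : Prog)

def NExp.eval (σ : State) : NExp → ℕ
  | lit c => c
  | reg r => σ.nat r
  | read a e => σ.natArr a (e.eval σ)
  | add e₁ e₂ => e₁.eval σ + e₂.eval σ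
  | sub e₁ e₂ => e₁.eval σ - e₂.eval σ

noncomputable def RExp.eval (σ : State) : RExp → ℝ
  | lit c => (c : ℝ)
  | reg r => σ.real r
  | read a e => σ.realArr a (e.eval σ)
  | add e₁ e₂ => e₁.eval σ + e₂.eval σ
  | sub e₁ e₂ => e₁.eval σ - e₂.eval σ
  | mul e₁ e₂ => e₁.eval σ * e₂.eval σ
  | div e₁ e₂ => e₁.eval σ / e₂.eval σ

def Test.Holds (σ : State) : Test → Prop
  | natLt e₁ e₂ => e₁.eval σ < e₂.eval σ
  | natEq e₁ e₂ => e₁.eval σ = e₂.eval σ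
  | realLt e₁ e₂ => e₁.eval σ < e₂.eval σ
  | realEq e₁ e₂ => e₁.eval σ = e₂.eval σ
  | not b => ¬ b.Holds σ
  | and b₁ b₂ => b₁.Holds σ ∧ b₂.Holds σ

def NExp.cost : NExp → ℕ
  | lit _ => 1
  | reg _ => 1
  | read _ e => e.cost + 1
  | add e₁ e₂ => e₁.cost + e₂.cost + 1
  | sub e₁ e₂ => e₁.cost + e₂.cost + 1

def RExp.cost : RExp → ℕ
  | lit _ => 1
  | reg _ => 1
  | read _ e => e.cost + 1
  | add e₁ e₂ => e₁.cost + e₂.cost + 1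
  | sub e₁ e₂ => e₁.cost + e₂.cost + 1
  | mul e₁ e₂ => e₁.cost + e₂.cost + 1
  | div e₁ e₂ => e₁.cost + e₂.cost + 1

def Test.cost : Test → ℕ
  | natLt e₁ e₂ => e₁.cost + e₂.cost + 1
  | natEq e₁ e₂ => e₁.cost + e₂.cost + 1
  | realLt e₁ e₂ => e₁.cost + e₂.cost + 1
  | realEq e₁ e₂ => e₁.cost + e₂.cost + 1
  | not b => b.cost + 1
  | and b₁ b₂ => b₁.cost + b₂.cost + 1

/-- Replace the entry `t` of the array `a` by `v`. -/
def store {α : Type} (arr : ℕ → ℕ → α) (a t : ℕ) (v : α) : ℕ → ℕ → α :=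
  Function.update arr a (Function.update (arr a) t v)

/-- `Run p σ T σ'`: the program `p`, started in the state `σ`, halts after `T` steps in the state
`σ'`. -/
inductive Run : Prog → State → ℕ → State → Prop
  | skip (σ : State) : Run .skip σ 1 σ
  | setNat (r : ℕ) (e : NExp) (σ : State) :
      Run (.setNat r e) σ (e.cost + 1) { σ with nat := Function.update σ.nat r (e.eval σ) }
  | setReal (r : ℕ) (e : RExp) (σ : State) :
      Run (.setReal r e) σ (e.cost + 1) { σ with real := Function.update σ.real r (e.eval σ) }
  | writeNat (a : ℕ) (idx e : NExp) (σ : State) :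
      Run (.writeNat a idx e) σ (idx.cost + e.cost + 1)
        { σ with natArr := store σ.natArr a (idx.eval σ) (e.eval σ) }
  | writeReal (a : ℕ) (idx : NExp) (e : RExp) (σ : State) :
      Run (.writeReal a idx e) σ (idx.cost + e.cost + 1)
        { σ with realArr := store σ.realArr a (idx.eval σ) (e.eval σ) }
  | seq {p₁ p₂ : Prog} {σ₁ σ₂ σ₃ : State} {T₁ T₂ : ℕ} (h₁ : Run p₁ σ₁ T₁ σ₂)
      (h₂ : Run p₂ σ₂ T₂ σ₃) : Run (.seq p₁ p₂) σ₁ (T₁ + T₂) σ₃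
  | branchTrue {b : Test} {p₁ : Prog} (p₂ : Prog) {σ σ' : State} {T : ℕ} (hb : b.Holds σ)
      (h : Run p₁ σ T σ') : Run (.branch b p₁ p₂) σ (b.cost + T + 1) σ'
  | branchFalse {b : Test} (p₁ : Prog) {p₂ : Prog} {σ σ' : State} {T : ℕ} (hb : ¬ b.Holds σ)
      (h : Run p₂ σ T σ') : Run (.branch b p₁ p₂) σ (b.cost + T + 1) σ'
  | loopDone {b : Test} (p : Prog) {σ : State} (hb : ¬ b.Holds σ) :
      Run (.loop b p) σ (b.cost + 1) σ
  | loopStep {b : Test} {p : Prog} {σ₁ σ₂ σ₃ : State} {T₁ T₂ : ℕ} (hb : b.Holds σ₁)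
      (h₁ : Run p σ₁ T₁ σ₂) (h₂ : Run (.loop b p) σ₂ T₂ σ₃) :
      Run (.loop b p) σ₁ (b.cost + 1 + T₁ + T₂) σ₃

/-- The first `m` values of `f`, stored in an array. -/
noncomputable def table (m : ℕ) (f : ℕ → ℝ) : ℕ → ℝ := fun t => if t < m then f t else 0

/-- The input: the integer registers `0, …, 3` hold `n, i, j, k`, the real registers `0, …, 3`
hold `a₁, a₂, b₁, b₂`, and the real arrays `0, …, 3` hold the lengths, the capacities and the lower
and upper ends of the weight ranges.  Everything else is zero. -/
noncomputable def input (P : PathNet) (R : WeightRanges P.n) (i j k : ℕ) (B : WeightBox) : State where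
  nat := fun
    | 0 => P.n
    | 1 => i
    | 2 => j
    | 3 => k
    | _ => 0
  real := fun
    | 0 => B.a₁
    | 1 => B.a₂
    | 2 => B.b₁
    | 3 => B.b₂
    | _ => 0
  natArr := fun _ _ => 0
  realArr := fun
    | 0 => table P.n P.len
    | 1 => table P.n P.cap
    | 2 => table (P.n + 1) R.lo
    | 3 => table (P.n + 1) R.hi
    | _ => fun _ => 0

/-- The state holds a piecewise linear description of `f` on `[A, B]`: the number of pieces in the
integer register `4`, and, in sorted order, the critical points, the slopes and the intercepts in
the real arrays `4`, `5` and `6`. -/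
def State.Holds (σ : State) (f : ℝ → ℝ) (A B : ℝ) : Prop :=
  IsGoodRepr f A B (σ.nat 4) (σ.realArr 4) (σ.realArr 5) (σ.realArr 6)

end RealRAM

/-! One variable on each side. For a fixed sink, the closed formulas make the evacuation time from
the left a maximum of `0` and of one affine function of `α₁` per vertex before the sink: constant
for the vertices before `v_i`, and of slope `1 / c(x_t, y)` from `v_i` on. Such a formula jumps only
where a partial weight becomes positive, and the hypothesis on `A` excludes this while `α₁` varies
(`left_admissible`). So the time is a convex, nondecreasing, piecewise linear function of `α₁`
(`thetaL_eq_fn`), and the time from the right is one of `α₂` (`thetaR_eq_fn`).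

Eliminating the sink. Inside the edge `e_k`, of length `d`, a sink at distance `z` from `v_k` has
the times `f + z` and `g + (d - z)`, and the best `z` gives `max (f, g, (f + g + d) / 2)`, which is
`balance`. If the sink is at `v_k` or at `v_{k+1}`, one side no longer has to use `e_k`, so its time
may drop; these two positions are separate problems, with `d = 0`. By `isLeast_evacTimes` the
required minimum is the least of three values `minBalance`, each a minimum of `balance` over `x + y
= α`. If one side carries no weight, moving the sink does not change the time of that side; then an
end of the edge is at least as good as its interior.

The greedy path. For convex `f` and `g` the function `balance` is jointly convex, and its minimum
over `x + y = α` is attained along a path that is monotone in both coordinates and leads from `(a₁,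
b₁)` to `(a₂, b₂)`. If one time exceeds the other by more than `d`, the weight of the faster side
grows free of charge. Inside the band `|f - g| ≤ d` the weight with the smaller slope grows, at half
that slope. When its side gets ahead by exactly `d`, both weights grow so that both times rise
equally, at the rate `σ τ / (σ + τ)`. An exhausted side leaves the move to the other one. A step is
certified by a subgradient `κ (1, 1)` of `balance` that is exact at the end of the step
(`minBalance_eq_of_support`, `PathInv.step_x`, `PathInv.step_both`). All the rates `κ` are
nonnegative, so the minimum is nondecreasing.

Linear time. The bottleneck towards the sink is larger for nearer vertices, so the lines come sorted
by slope, and a stack builds the envelope (`envProg_spec`). A step of the path finishes a piece or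
lowers a phase with three values (`walkPhase_rise`, `walkProg_spec`). A merge with at most one
crossing between consecutive critical points forms the minimum of two functions (`minProg_spec`).
Every loop is bounded by a potential that is linear in `n`. The description which the program is
proved to leave in memory is also what shows that the function is continuous and piecewise linear
with nonnegative slopes; no separate argument is given for that. -/

set_option linter.unusedSimpArgs false

namespace RealRAM

/-! ### Program logic -/

/-- An upper bound for the running time of a loop-free program. -/
def Prog.time : Prog → ℕ
  | .skip => 1
  | .setNat _ e => e.cost + 1
  | .setReal _ e => e.cost + 1
  | .writeNat _ idx e => idx.cost + e.cost + 1
  | .writeReal _ idx e => idx.cost + e.cost + 1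
  | .seq p₁ p₂ => p₁.time + p₂.time
  | .branch b p₁ p₂ => b.cost + max p₁.time p₂.time + 1
  | .loop _ _ => 0

def Prog.loopFree : Prog → Bool
  | .seq p₁ p₂ => p₁.loopFree && p₂.loopFree
  | .branch _ p₁ p₂ => p₁.loopFree && p₂.loopFree
  | .loop _ _ => false
  | _ => true

open Classical in
/-- The final state of a loop-free program. -/
noncomputable def Prog.exec : Prog → State → State
  | .skip, σ => σ
  | .setNat r e, σ => { σ with nat := Function.update σ.nat r (e.eval σ) }
  | .setReal r e, σ => { σ with real := Function.update σ.real r (e.eval σ) }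
  | .writeNat a idx e, σ => { σ with natArr := store σ.natArr a (idx.eval σ) (e.eval σ) }
  | .writeReal a idx e, σ => { σ with realArr := store σ.realArr a (idx.eval σ) (e.eval σ) }
  | .seq p₁ p₂, σ => p₂.exec (p₁.exec σ)
  | .branch b p₁ p₂, σ => if b.Holds σ then p₁.exec σ else p₂.exec σ
  | .loop _ _, σ => σ

theorem run_exec (p : Prog) (hp : p.loopFree = true) (σ : State) :
    ∃ T ≤ p.time, Run p σ T (p.exec σ) := by
  induction p generalizing σ with
  | skip => exact ⟨_, le_rfl, .skip σ⟩
  | setNat r e => exact ⟨_, le_rfl, .setNat r e σ⟩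
  | setReal r e => exact ⟨_, le_rfl, .setReal r e σ⟩
  | writeNat a i e => exact ⟨_, le_rfl, .writeNat a i e σ⟩
  | writeReal a i e => exact ⟨_, le_rfl, .writeReal a i e σ⟩
  | seq p q ihp ihq =>
    simp only [Prog.loopFree, Bool.and_eq_true] at hp
    obtain ⟨T₁, h₁, r₁⟩ := ihp hp.1 σ
    obtain ⟨T₂, h₂, r₂⟩ := ihq hp.2 (p.exec σ)
    exact ⟨_, add_le_add h₁ h₂, .seq r₁ r₂⟩
  | branch b p q ihp ihq =>
    simp only [Prog.loopFree, Bool.and_eq_true] at hp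
    by_cases hb : b.Holds σ
    · obtain ⟨T₁, h₁, r₁⟩ := ihp hp.1 σ
      refine ⟨b.cost + T₁ + 1, ?_, ?_⟩
      · have := le_max_left p.time q.time
        simp only [Prog.time]; omega
      · simp only [Prog.exec, if_pos hb]
        exact .branchTrue q hb r₁
    · obtain ⟨T₁, h₁, r₁⟩ := ihq hp.2 σ
      refine ⟨b.cost + T₁ + 1, ?_, ?_⟩
      · have := le_max_right p.time q.time
        simp only [Prog.time]; omega
      · simp only [Prog.exec, if_neg hb]
        exact .branchFalse p hb r₁
  | loop b p => simp [Prog.loopFree] at hp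

/-- These syntactic over-approximations are Boolean, so `rfl` decides for a given program that a
register or array survives. Integer arrays are not tracked, since no program below uses them. -/
def Prog.setsNat : Prog → ℕ → Bool
  | .setNat r _, r' => r == r'
  | .seq p₁ p₂, r => p₁.setsNat r || p₂.setsNat r
  | .branch _ p₁ p₂, r => p₁.setsNat r || p₂.setsNat r
  | .loop _ p, r => p.setsNat r
  | _, _ => false

def Prog.setsReal : Prog → ℕ → Bool
  | .setReal r _, r' => r == r'
  | .seq p₁ p₂, r => p₁.setsReal r || p₂.setsReal r
  | .branch _ p₁ p₂, r => p₁.setsReal r || p₂.setsReal r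
  | .loop _ p, r => p.setsReal r
  | _, _ => false

def Prog.writesTo : Prog → ℕ → Bool
  | .writeReal a _ _, a' => a == a'
  | .seq p₁ p₂, r => p₁.writesTo r || p₂.writesTo r
  | .branch _ p₁ p₂, r => p₁.writesTo r || p₂.writesTo r
  | .loop _ p, r => p.writesTo r
  | _, _ => false

/-- `σ'` differs from `σ` only in the registers and real arrays that `p` assigns to. -/
structure Frame (p : Prog) (σ σ' : State) : Prop where
  nat : ∀ r, p.setsNat r = false → σ'.nat r = σ.nat r
  real : ∀ r, p.setsReal r = false → σ'.real r = σ.real r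
  arr : ∀ a, p.writesTo a = false → σ'.realArr a = σ.realArr a

theorem Frame.refl (p : Prog) (σ : State) : Frame p σ σ :=
  ⟨fun _ _ => rfl, fun _ _ => rfl, fun _ _ => rfl⟩

theorem Frame.trans {p : Prog} {σ₁ σ₂ σ₃ : State} (h₁ : Frame p σ₁ σ₂) (h₂ : Frame p σ₂ σ₃) :
    Frame p σ₁ σ₃ :=
  ⟨fun r h => (h₂.nat r h).trans (h₁.nat r h), fun r h => (h₂.real r h).trans (h₁.real r h),
    fun r h => (h₂.arr r h).trans (h₁.arr r h)⟩

theorem Frame.mono {p q : Prog} {σ₁ σ₂ : State} (h : Frame p σ₁ σ₂)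
    (hn : ∀ r, q.setsNat r = false → p.setsNat r = false)
    (hr : ∀ r, q.setsReal r = false → p.setsReal r = false)
    (ha : ∀ r, q.writesTo r = false → p.writesTo r = false) : Frame q σ₁ σ₂ :=
  ⟨fun r e => h.nat r (hn r e), fun r e => h.real r (hr r e), fun r e => h.arr r (ha r e)⟩

theorem Run.frame {p : Prog} {σ σ' : State} {T : ℕ} (h : Run p σ T σ') : Frame p σ σ' := by
  induction h with
  | skip σ => exact .refl _ _
  | setNat r e σ =>
    refine ⟨fun r' hr => ?_, fun _ _ => rfl, fun _ _ => rfl⟩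
    have : r' ≠ r := by rintro rfl; simp [Prog.setsNat] at hr
    exact Function.update_of_ne this _ _
  | setReal r e σ =>
    refine ⟨fun _ _ => rfl, fun r' hr => ?_, fun _ _ => rfl⟩
    have : r' ≠ r := by rintro rfl; simp [Prog.setsReal] at hr
    exact Function.update_of_ne this _ _
  | writeNat a i e σ => exact ⟨fun _ _ => rfl, fun _ _ => rfl, fun _ _ => rfl⟩
  | writeReal a i e σ =>
    refine ⟨fun _ _ => rfl, fun _ _ => rfl, fun r' hr => ?_⟩
    have : r' ≠ a := by rintro rfl; simp [Prog.writesTo] at hr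
    exact Function.update_of_ne this _ _
  | seq _ _ ih₁ ih₂ =>
    refine (ih₁.mono ?_ ?_ ?_).trans (ih₂.mono ?_ ?_ ?_) <;> intro r e <;>
      simp only [Prog.setsNat, Prog.setsReal, Prog.writesTo, Bool.or_eq_false_iff] at e <;>
      first | exact e.1 | exact e.2
  | branchTrue _ _ _ ih =>
    refine ih.mono ?_ ?_ ?_ <;> intro r e <;>
      simp only [Prog.setsNat, Prog.setsReal, Prog.writesTo, Bool.or_eq_false_iff] at e <;>
      exact e.1
  | branchFalse _ _ _ ih =>
    refine ih.mono ?_ ?_ ?_ <;> intro r e <;>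
      simp only [Prog.setsNat, Prog.setsReal, Prog.writesTo, Bool.or_eq_false_iff] at e <;>
      exact e.2
  | loopDone => exact .refl _ _
  | loopStep _ _ _ ih₁ ih₂ =>
    refine Frame.trans ?_ ih₂
    exact ih₁.mono (fun _ e => e) (fun _ e => e) fun _ e => e

/-- Started in `σ`, the program `p` halts within `T` steps in a state that satisfies `Q`. -/
def HaltsWithin (p : Prog) (T : ℕ) (σ : State) (Q : State → Prop) : Prop :=
  ∃ T' ≤ T, ∃ σ', Run p σ T' σ' ∧ Q σ'

/-- What a composite program preserves follows from its syntax, so the specifications of its parts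
need not pass such information along. -/
theorem HaltsWithin.frame {p : Prog} {T : ℕ} {σ : State} {Q : State → Prop}
    (h : HaltsWithin p T σ Q) : HaltsWithin p T σ fun σ' => Frame p σ σ' ∧ Q σ' := by
  obtain ⟨T', hT, σ', hr, hq⟩ := h
  exact ⟨T', hT, σ', hr, hr.frame, hq⟩

theorem HaltsWithin.mono {p : Prog} {T₁ T₂ : ℕ} {σ : State} {Q₁ Q₂ : State → Prop}
    (h : HaltsWithin p T₁ σ Q₁) (hT : T₁ ≤ T₂) (hQ : ∀ σ', Q₁ σ' → Q₂ σ') :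
    HaltsWithin p T₂ σ Q₂ := by
  obtain ⟨T', hT', σ', hr, hq⟩ := h
  exact ⟨T', hT'.trans hT, σ', hr, hQ _ hq⟩

theorem HaltsWithin.seq {p q : Prog} {T₁ T₂ : ℕ} {σ : State} {Q₁ Q₂ : State → Prop}
    (h₁ : HaltsWithin p T₁ σ Q₁) (h₂ : ∀ σ', Frame p σ σ' → Q₁ σ' → HaltsWithin q T₂ σ' Q₂) :
    HaltsWithin (.seq p q) (T₁ + T₂) σ Q₂ := by
  obtain ⟨T', hT', σ', hr, hq⟩ := h₁
  obtain ⟨T'', hT'', σ'', hr', hq'⟩ := h₂ σ' hr.frame hq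
  exact ⟨_, add_le_add hT' hT'', σ'', .seq hr hr', hq'⟩

theorem haltsWithin_exec {p : Prog} (hp : p.loopFree = true) {σ : State} {Q : State → Prop}
    (h : Q (p.exec σ)) : HaltsWithin p p.time σ Q := by
  obtain ⟨T, hT, hr⟩ := run_exec p hp σ
  exact ⟨T, hT, _, hr, h⟩

/-- The rule for loops with a loop-free body: `I` is the invariant, with a bound on the number of
iterations that are still to come. -/
theorem haltsWithin_loop {b : Test} {p : Prog} (hp : p.loopFree = true) {σ₀ : State}
    (I : State → ℕ → Prop)
    (step : ∀ σ μ, Frame p σ₀ σ → I σ μ → b.Holds σ → ∃ μ' < μ, I (p.exec σ) μ')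
    (μ₀ : ℕ) (h₀ : I σ₀ μ₀) :
    HaltsWithin (.loop b p) ((b.cost + 1 + p.time) * (μ₀ + 1)) σ₀
      fun σ => Frame p σ₀ σ ∧ (∃ μ, I σ μ) ∧ ¬ b.Holds σ := by
  -- Induction on a bound `N` for `μ`, because one iteration may lower `μ` by more than one.
  have key : ∀ (N μ : ℕ) (σ : State), μ ≤ N → Frame p σ₀ σ → I σ μ →
      HaltsWithin (.loop b p) ((b.cost + 1 + p.time) * (μ + 1)) σ
        fun σ => (∃ μ, I σ μ) ∧ ¬ b.Holds σ := by
    intro N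
    induction N with
    | zero =>
      intro μ σ hμ hf hI
      by_cases hb : b.Holds σ
      · obtain ⟨μ', h, _⟩ := step σ μ hf hI hb
        omega
      · refine ⟨b.cost + 1, ?_, σ, .loopDone p hb, ⟨μ, hI⟩, hb⟩
        nlinarith [Nat.zero_le μ, Nat.zero_le p.time, Nat.zero_le b.cost]
    | succ N ih =>
      intro μ σ hμ hf hI
      by_cases hb : b.Holds σ
      · obtain ⟨μ', h, hI'⟩ := step σ μ hf hI hb
        obtain ⟨T, hT, hr⟩ := run_exec p hp σ
        obtain ⟨T', hT', σ', hr', hQ⟩ := ih μ' (p.exec σ) (by omega) (hf.trans hr.frame) hI'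
        refine ⟨_, ?_, σ', .loopStep hb hr hr', hQ⟩
        have : (b.cost + 1 + p.time) * (μ' + 1 + 1) ≤ (b.cost + 1 + p.time) * (μ + 1) :=
          Nat.mul_le_mul_left _ (by omega)
        rw [mul_add_one (_ : ℕ) (μ' + 1)] at this
        omega
      · refine ⟨b.cost + 1, ?_, σ, .loopDone p hb, ⟨μ, hI⟩, hb⟩
        nlinarith [Nat.zero_le μ, Nat.zero_le p.time, Nat.zero_le b.cost]
  -- A loop assigns exactly what its body assigns, so the frame of the loop is, field by field, the
  -- frame of `p`.
  exact (key μ₀ μ₀ σ₀ le_rfl (.refl _ _) h₀).frame.mono le_rfl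
    fun σ h => ⟨⟨h.1.nat, h.1.real, h.1.arr⟩, h.2⟩

theorem exec_branch_pos {b : Test} {σ : State} (h : b.Holds σ) (p q : Prog) :
    (Prog.branch b p q).exec σ = p.exec σ := by rw [Prog.exec, if_pos h]

theorem exec_branch_neg {b : Test} {σ : State} (h : ¬ b.Holds σ) (p q : Prog) :
    (Prog.branch b p q).exec σ = q.exec σ := by rw [Prog.exec, if_neg h]

theorem store_apply {α : Type} (arr : ℕ → ℕ → α) (a t : ℕ) (v : α) (a' t' : ℕ) :
    store arr a t v a' t' = if a' = a ∧ t' = t then v else arr a' t' := by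
  by_cases h : a' = a
  · subst h
    by_cases h' : t' = t
    · subst h'; simp [store]
    · simp [store, h']
  · simp [store, h]

end RealRAM

/-! ### Piecewise linear functions -/

/-- `f` consists on `[A, B]` of the `m` linear pieces `s t * x + c t`, `x ∈ [q t, q (t + 1)]`. -/
structure PiecewiseLin (f : ℝ → ℝ) (A B : ℝ) (m : ℕ) (q s c : ℕ → ℝ) : Prop where
  left : q 0 = A
  right : q m = B
  sorted : ∀ t < m, q t ≤ q (t + 1)
  linear : ∀ t < m, ∀ x ∈ Icc (q t) (q (t + 1)), f x = s t * x + c t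
  slope_nonneg : ∀ t < m, 0 ≤ s t

namespace PiecewiseLin

variable {f g : ℝ → ℝ} {A B : ℝ} {m : ℕ} {q s c q' s' c' : ℕ → ℝ}

theorem nil (f : ℝ → ℝ) (hq : q 0 = A) : PiecewiseLin f A A 0 q s c :=
  ⟨hq, hq, by simp, by simp, by simp⟩

/-- The tool for arrays that change elsewhere, and for replacing the function. All critical points
lie in `[A, B]`, so the two functions have to agree only there. -/
theorem congr (h : PiecewiseLin f A B m q s c) (hq : ∀ t ≤ m, q' t = q t)
    (hs : ∀ t < m, s' t = s t) (hc : ∀ t < m, c' t = c t)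
    (hfg : ∀ x ∈ Icc A B, g x = f x) : PiecewiseLin g A B m q' s' c' := by
  have mono : ∀ t ≤ m, A ≤ q t := by
    intro t ht
    induction t with
    | zero => rw [h.left]
    | succ t ih => exact (ih (by omega)).trans (h.sorted t (by omega))
  have mono' : ∀ r ≤ m, q (m - r) ≤ B := by
    intro r hr
    induction r with
    | zero => exact h.right.le
    | succ r ih =>
      have h1 := h.sorted (m - (r + 1)) (by omega)
      rw [show m - (r + 1) + 1 = m - r by omega] at h1
      exact h1.trans (ih (by omega))
  refine ⟨by rw [hq 0 (by omega), h.left], by rw [hq m le_rfl, h.right], ?_, ?_, ?_⟩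
  · intro t ht
    rw [hq t ht.le, hq _ ht]
    exact h.sorted t ht
  · intro t ht x hx
    rw [hq t ht.le, hq _ ht] at hx
    have h1 := mono' (m - (t + 1)) (by omega)
    rw [show m - (m - (t + 1)) = t + 1 by omega] at h1
    rw [hs t ht, hc t ht, hfg x ⟨(mono t ht.le).trans hx.1, hx.2.trans h1⟩]
    exact h.linear t ht x hx
  · intro t ht
    rw [hs t ht]
    exact h.slope_nonneg t ht

theorem append (h : PiecewiseLin f A B m q s c) {B' : ℝ} (hB : B ≤ B') (hq : q (m + 1) = B')
    (hs : 0 ≤ s m) (hf : ∀ x ∈ Icc B B', f x = s m * x + c m) :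
    PiecewiseLin f A B' (m + 1) q s c := by
  refine ⟨h.left, hq, ?_, ?_, ?_⟩
  · intro t ht
    rcases Nat.lt_succ_iff_lt_or_eq.1 ht with ht | rfl
    · exact h.sorted t ht
    · rw [hq, h.right]; exact hB
  · intro t ht
    rcases Nat.lt_succ_iff_lt_or_eq.1 ht with ht | rfl
    · exact h.linear t ht
    · rw [hq, h.right]; exact hf
  · intro t ht
    rcases Nat.lt_succ_iff_lt_or_eq.1 ht with ht | rfl
    · exact h.slope_nonneg t ht
    · exact hs

theorem init (h : PiecewiseLin f A B (m + 1) q s c) : PiecewiseLin f A (q m) m q s c :=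
  ⟨h.left, rfl, fun t ht => h.sorted t (by omega), fun t ht => h.linear t (by omega),
    fun t ht => h.slope_nonneg t (by omega)⟩

theorem left_le (h : PiecewiseLin f A B m q s c) {t : ℕ} (ht : t ≤ m) : A ≤ q t := by
  induction t with
  | zero => rw [h.left]
  | succ t ih => exact (ih (by omega)).trans (h.sorted t (by omega))

theorem le_right (h : PiecewiseLin f A B m q s c) {t : ℕ} (ht : t ≤ m) : q t ≤ B := by
  have mono' : ∀ r ≤ m, q (m - r) ≤ B := by
    intro r hr
    induction r with
    | zero => exact h.right.le
    | succ r ih =>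
      have h1 := h.sorted (m - (r + 1)) (by omega)
      rw [show m - (r + 1) + 1 = m - r by omega] at h1
      exact h1.trans (ih (by omega))
  have h1 := mono' (m - t) (by omega)
  rwa [show m - (m - t) = t by omega] at h1

theorem monotoneOn (h : PiecewiseLin f A B m q s c) : MonotoneOn f (Icc A B) := by
  induction m generalizing B with
  | zero =>
    have := h.left; have := h.right
    intro x hx y hy _
    obtain rfl : x = y := by linarith [hx.1, hx.2, hy.1, hy.2]
    exact le_rfl
  | succ m ih =>
    have ih := ih h.init
    have h2 := h.linear m (by omega)
    have hs := h.slope_nonneg m (by omega)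
    have hl := h.left_le (t := m) (by omega)
    have hr := h.le_right (t := m) (by omega)
    rw [h.right] at h2
    intro x hx y hy hxy
    have aux : ∀ z ∈ Icc (q m) B, f (q m) ≤ f z := fun z hz => by
      rw [h2 z hz, h2 _ ⟨le_rfl, hr⟩]
      nlinarith [hz.1]
    rcases le_total y (q m) with hy' | hy'
    · exact ih ⟨hx.1, hxy.trans hy'⟩ ⟨hy.1, hy'⟩ hxy
    · rcases le_total x (q m) with hx' | hx'
      · exact (ih ⟨hx.1, hx'⟩ ⟨hl, le_rfl⟩ hx').trans (aux y ⟨hy', hy.2⟩)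
      · rw [h2 x ⟨hx', hx.2⟩, h2 y ⟨hy', hy.2⟩]
        nlinarith

/-- No matching condition is needed: adjacent closed pieces both describe `f` at their common point.
-/
theorem continuousOn (h : PiecewiseLin f A B m q s c) : ContinuousOn f (Icc A B) := by
  induction m generalizing B with
  | zero =>
    have h1 := h.left; have h2 := h.right
    rw [show B = A by rw [← h1, ← h2], Icc_self]
    exact continuousOn_singleton _ _
  | succ m ih =>
    have ih := ih h.init
    have h2 : ContinuousOn f (Icc (q m) B) := by
      have h2 := h.linear m (by omega)
      rw [h.right] at h2
      exact ContinuousOn.congr (by fun_prop) h2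
    rw [← Icc_union_Icc_eq_Icc (h.left_le (t := m) (by omega)) (h.le_right (t := m) (by omega))]
    exact ih.union_of_isClosed h2 isClosed_Icc isClosed_Icc

theorem isGoodRepr (h : PiecewiseLin f A B m q s c) (hm : 0 < m) : IsGoodRepr f A B m q s c :=
  ⟨h.left, h.right, hm, h.sorted, h.linear, h.slope_nonneg⟩

end PiecewiseLin

/-- A piecewise linear function that is the maximum of its pieces, ordered by slope. -/
structure ConvexLin (f : ℝ → ℝ) (A B : ℝ) (m : ℕ) (q s c : ℕ → ℝ) : Prop
    extends PiecewiseLin f A B m q s c where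
  slope_mono : ∀ t, t + 1 < m → s t ≤ s (t + 1)
  line_le : ∀ t < m, ∀ x ∈ Icc A B, s t * x + c t ≤ f x

/-! ### Upper envelopes -/

/-- The maximum of `0` and the first `N` of the functions `ℓ`. -/
noncomputable def upperEnv (ℓ : ℕ → ℝ → ℝ) : ℕ → ℝ → ℝ
  | 0, _ => 0
  | N + 1, x => max (upperEnv ℓ N x) (ℓ N x)

theorem upperEnv_nonneg (ℓ : ℕ → ℝ → ℝ) (N : ℕ) (x : ℝ) : 0 ≤ upperEnv ℓ N x := by
  induction N with
  | zero => exact le_rfl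
  | succ N ih => exact ih.trans (le_max_left _ _)

theorem le_upperEnv (ℓ : ℕ → ℝ → ℝ) {N t : ℕ} (ht : t < N) (x : ℝ) :
    ℓ t x ≤ upperEnv ℓ N x := by
  induction N with
  | zero => omega
  | succ N ih =>
    rcases Nat.lt_succ_iff_lt_or_eq.1 ht with ht | rfl
    · exact (ih ht).trans (le_max_left _ _)
    · exact le_max_right _ _

theorem upperEnv_le {ℓ : ℕ → ℝ → ℝ} {N : ℕ} {x z : ℝ} (h0 : 0 ≤ z) (h : ∀ t < N, ℓ t x ≤ z) :
    upperEnv ℓ N x ≤ z := by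
  induction N with
  | zero => exact h0
  | succ N ih => exact max_le (ih fun t ht => h t (by omega)) (h N (by omega))

/-- A maximum of lines grows no faster than its steepest line. Hence a line that is steeper than all
of them and is not above the envelope at some point is not above it further left either. -/
theorem upperEnv_lipschitz {S C : ℕ → ℝ} {N : ℕ} {σ x y : ℝ} (hσ : 0 ≤ σ)
    (h : ∀ t < N, S t ≤ σ) (hxy : x ≤ y) :
    upperEnv (fun t x => S t * x + C t) N y ≤
      upperEnv (fun t x => S t * x + C t) N x + σ * (y - x) := by
  have := mul_nonneg hσ (sub_nonneg.2 hxy)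
  refine upperEnv_le (by linarith [upperEnv_nonneg (fun t x => S t * x + C t) N x]) ?_
  intro t ht
  have h1 := le_upperEnv (fun t x => S t * x + C t) ht x
  have h2 := mul_le_mul_of_nonneg_right (h t ht) (sub_nonneg.2 hxy)
  linarith

theorem continuous_upperEnv {ℓ : ℕ → ℝ → ℝ} {N : ℕ} (h : ∀ t < N, Continuous (ℓ t)) :
    Continuous (upperEnv ℓ N) := by
  induction N with
  | zero => exact continuous_const
  | succ N ih => exact (ih fun t ht => h t (by omega)).max (h N (by omega))

/-! ### Balancing two functions -/

/-- `balance f g d x y` is the smallest `T` for which some `z ∈ [0, d]` satisfies `f x + z ≤ T` and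
`g y + (d - z) ≤ T`. -/
noncomputable def balance (f g : ℝ → ℝ) (d x y : ℝ) : ℝ :=
  max (max (f x) (g y)) ((f x + g y + d) / 2)

/-- The values `balance f g d x y`, where `x + y = α`. -/
def balanceSet (f g : ℝ → ℝ) (d a₁ a₂ b₁ b₂ α : ℝ) : Set ℝ :=
  {z | ∃ x ∈ Icc a₁ a₂, ∃ y ∈ Icc b₁ b₂, x + y = α ∧ balance f g d x y = z}

noncomputable def minBalance (f g : ℝ → ℝ) (d a₁ a₂ b₁ b₂ α : ℝ) : ℝ :=
  sInf (balanceSet f g d a₁ a₂ b₁ b₂ α)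

/-- The two sides play the same role; every statement about a move of `y` comes from one about a
move of `x`. -/
theorem balance_swap (f g : ℝ → ℝ) (d x y : ℝ) : balance g f d y x = balance f g d x y := by
  rw [balance, balance, max_comm (g y), add_comm (g y)]

theorem balanceSet_swap (f g : ℝ → ℝ) (d a₁ a₂ b₁ b₂ α : ℝ) :
    balanceSet g f d b₁ b₂ a₁ a₂ α = balanceSet f g d a₁ a₂ b₁ b₂ α := by
  ext z
  constructor
  · rintro ⟨x, hx, y, hy, h1, h2⟩
    exact ⟨y, hy, x, hx, by linarith, by rw [← h2, balance_swap]⟩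
  · rintro ⟨x, hx, y, hy, h1, h2⟩
    exact ⟨y, hy, x, hx, by linarith, by rw [← h2, balance_swap]⟩

theorem minBalance_swap (f g : ℝ → ℝ) (d a₁ a₂ b₁ b₂ α : ℝ) :
    minBalance g f d b₁ b₂ a₁ a₂ α = minBalance f g d a₁ a₂ b₁ b₂ α := by
  rw [minBalance, balanceSet_swap]; rfl

/-- With the sum prescribed, `x` ranges over a compact interval, which is nonempty since `α` lies
between the extreme sums. -/
theorem isLeast_minBalance {f g : ℝ → ℝ} (hf : Continuous f) (hg : Continuous g)
    {d a₁ a₂ b₁ b₂ α : ℝ} (ha : a₁ ≤ a₂) (hb : b₁ ≤ b₂) (hα : α ∈ Icc (a₁ + b₁) (a₂ + b₂)) :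
    IsLeast (balanceSet f g d a₁ a₂ b₁ b₂ α) (minBalance f g d a₁ a₂ b₁ b₂ α) := by
  have e : balanceSet f g d a₁ a₂ b₁ b₂ α =
      (fun x => balance f g d x (α - x)) '' (Icc a₁ a₂ ∩ Icc (α - b₂) (α - b₁)) := by
    ext z
    constructor
    · rintro ⟨x, hx, y, hy, h1, h2⟩
      have : y = α - x := by linarith
      subst this
      exact ⟨x, ⟨hx, by linarith [hy.2], by linarith [hy.1]⟩, h2⟩
    · rintro ⟨x, ⟨hx, h1, h2⟩, h3⟩
      exact ⟨x, hx, α - x, ⟨by linarith, by linarith⟩, by ring, h3⟩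
  rw [minBalance, e]
  refine IsCompact.isLeast_sInf ?_ ?_
  · refine (isCompact_Icc.inter_right isClosed_Icc).image ?_
    unfold balance
    fun_prop
  · refine Nonempty.image _ ⟨max a₁ (α - b₂), ⟨le_max_left _ _, max_le ha ?_⟩, le_max_right _ _,
      max_le ?_ ?_⟩
    · linarith [hα.2]
    · linarith [hα.1]
    · linarith

/-- A common subgradient at `(x, y)` which is attained at `(x', y')` determines the minimum between
the two points. -/
theorem minBalance_eq_of_support {f g : ℝ → ℝ} {d a₁ a₂ b₁ b₂ x y x' y' σ τ κ : ℝ}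
    (hx : x ∈ Icc a₁ a₂) (hy : y ∈ Icc b₁ b₂) (hx' : x' ∈ Icc a₁ a₂) (hy' : y' ∈ Icc b₁ b₂)
    (hxx : x ≤ x') (hyy : y ≤ y')
    (hf : ∀ z ∈ Icc x x', f z = f x + σ * (z - x)) (hg : ∀ z ∈ Icc y y', g z = g y + τ * (z - y))
    (hsup : ∀ u ∈ Icc a₁ a₂, ∀ v ∈ Icc b₁ b₂,
      balance f g d x y + κ * (u - x + (v - y)) ≤ balance f g d u v)
    (hend : balance f g d x' y' ≤ balance f g d x y + κ * (x' - x + (y' - y)))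
    {α : ℝ} (hα : α ∈ Icc (x + y) (x' + y')) :
    minBalance f g d a₁ a₂ b₁ b₂ α = balance f g d x y + κ * (α - (x + y)) := by
  refine IsLeast.csInf_eq ⟨?_, ?_⟩
  -- `θ` is the relative position of `α` on the segment from `(x, y)` to `(x', y')`; if the segment
  -- is a point, `θ = 0` serves.
  · obtain ⟨θ, hθ0, hθ1, hθ⟩ : ∃ θ : ℝ, 0 ≤ θ ∧ θ ≤ 1 ∧
        α = x + y + θ * (x' - x + (y' - y)) := by
      rcases eq_or_lt_of_le (add_le_add hxx hyy) with h | h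
      · exact ⟨0, le_rfl, zero_le_one, by linarith [hα.1, hα.2]⟩
      · refine ⟨(α - (x + y)) / (x' + y' - (x + y)), div_nonneg (by linarith [hα.1]) (by linarith),
          (div_le_one (by linarith)).2 (by linarith [hα.2]), ?_⟩
        have : x' + y' - (x + y) ≠ 0 := by linarith
        rw [show x' - x + (y' - y) = x' + y' - (x + y) by ring, div_mul_cancel₀ _ this]; ring
    have e1 : 0 ≤ θ * (x' - x) := mul_nonneg hθ0 (by linarith)
    have e2 : θ * (x' - x) ≤ x' - x := by nlinarith
    have e3 : 0 ≤ θ * (y' - y) := mul_nonneg hθ0 (by linarith)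
    have e4 : θ * (y' - y) ≤ y' - y := by nlinarith
    have m1 : x + θ * (x' - x) ∈ Icc a₁ a₂ :=
      ⟨by linarith [hx.1], by linarith [hx'.2]⟩
    have m2 : y + θ * (y' - y) ∈ Icc b₁ b₂ :=
      ⟨by linarith [hy.1], by linarith [hy'.2]⟩
    have hs := hsup _ m1 _ m2
    refine ⟨_, m1, _, m2, by rw [hθ]; ring, le_antisymm ?_ ?_⟩
    · have f1 := hf (x + θ * (x' - x)) ⟨by linarith, by linarith⟩
      have f2 := hf x' ⟨hxx, le_rfl⟩
      have g1 := hg (y + θ * (y' - y)) ⟨by linarith, by linarith⟩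
      have g2 := hg y' ⟨hyy, le_rfl⟩
      have b1 := le_max_left (max (f x) (g y)) ((f x + g y + d) / 2)
      have b2 := le_max_right (max (f x) (g y)) ((f x + g y + d) / 2)
      have b3 := max_le_iff.1 b1
      have c1 := (max_le_iff.1 hend).1
      have c2 := (max_le_iff.1 hend).2
      have c3 := max_le_iff.1 c1
      change f x ≤ balance f g d x y ∧ g y ≤ balance f g d x y at b3
      change _ ≤ balance f g d x y at b2
      rw [f2] at c2 c3
      rw [g2] at c2 c3
      rw [hθ]
      unfold balance at b2 b3 c2 c3 ⊢
      rw [f1, g1]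
      generalize max (max (f x) (g y)) ((f x + g y + d) / 2) = Φ at *
      have k := sub_nonneg.2 hθ1
      -- Each of the three terms is affine along the segment, so its bound at `θ` mixes the bounds
      -- at the two ends with the weights `1 - θ` and `θ`.
      refine max_le (max_le ?_ ?_) ?_
      · nlinarith [mul_le_mul_of_nonneg_left c3.1 hθ0, mul_le_mul_of_nonneg_left b3.1 k]
      · nlinarith [mul_le_mul_of_nonneg_left c3.2 hθ0, mul_le_mul_of_nonneg_left b3.2 k]
      · nlinarith [mul_le_mul_of_nonneg_left c2 hθ0, mul_le_mul_of_nonneg_left b2 k]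
    · rw [hθ]
      calc _ = balance f g d x y + κ * (x + θ * (x' - x) - x + (y + θ * (y' - y) - y)) := by ring
        _ ≤ _ := hs
  · rintro z ⟨u, hu, v, hv, h1, rfl⟩
    have := hsup u hu v hv
    rw [← h1, show u + v - (x + y) = u - x + (v - y) by ring]
    exact this

/-- The slope of a piece is a subgradient at each of its points. This form of convexity serves to
certify the steps of the greedy path. -/
theorem ConvexLin.line_le' {f : ℝ → ℝ} {A B : ℝ} {m : ℕ} {q s c : ℕ → ℝ}
    (h : ConvexLin f A B m q s c) {r : ℕ} (hr : r < m) {x u : ℝ}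
    (hx : x ∈ Icc (q r) (q (r + 1))) (hu : u ∈ Icc A B) : f x + s r * (u - x) ≤ f u := by
  have h1 := h.line_le r hr u hu
  have h2 := h.linear r hr x hx
  linarith

/-- The invariant of the greedy path `(x, y)`: `x` lies in the piece `r` of `f` and `y` in the
piece `s` of `g`, and the pieces behind `x` and `y` are not too steep. -/
structure PathInv (f g : ℝ → ℝ) (d a₁ a₂ b₁ b₂ : ℝ) (m : ℕ) (p S : ℕ → ℝ) (m' : ℕ)
    (p' S' : ℕ → ℝ) (x y : ℝ) (r s : ℕ) : Prop where
  r_le : r ≤ m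
  s_le : s ≤ m'
  x_mem : r < m → x ∈ Icc (p r) (p (r + 1))
  y_mem : s < m' → y ∈ Icc (p' s) (p' (s + 1))
  x_end : r = m → x = a₂
  y_end : s = m' → y = b₂
  back_x : s < m' → g y - f x < d → ∀ u ∈ Icc a₁ x,
    f x - f u ≤ (if d < f x - g y then 0 else S' s) * (x - u)
  back_y : r < m → f x - g y < d → ∀ v ∈ Icc b₁ y,
    g y - g v ≤ (if d < g y - f x then 0 else S r) * (y - v)

/-- Between `(x, y)` and `(x', y')` the greedy path is optimal, and the minimum has slope `κ`. -/
structure OptimalStep (f g : ℝ → ℝ) (d a₁ a₂ b₁ b₂ x y x' y' κ : ℝ) : Prop where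
  x_le : x ≤ x'
  y_le : y ≤ y'
  slope_nonneg : 0 ≤ κ
  balance_eq : balance f g d x' y' = balance f g d x y + κ * (x' - x + (y' - y))
  min_eq : ∀ α ∈ Icc (x + y) (x' + y'),
    minBalance f g d a₁ a₂ b₁ b₂ α = balance f g d x y + κ * (α - (x + y))

theorem OptimalStep.swap {f g : ℝ → ℝ} {d a₁ a₂ b₁ b₂ x y x' y' κ : ℝ}
    (h : OptimalStep f g d a₁ a₂ b₁ b₂ x y x' y' κ) :
    OptimalStep g f d b₁ b₂ a₁ a₂ y x y' x' κ := by
  refine ⟨h.y_le, h.x_le, h.slope_nonneg, ?_, ?_⟩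
  · rw [balance_swap f g d x' y', balance_swap f g d x y, h.balance_eq]; ring
  · intro α hα
    rw [minBalance_swap f g, balance_swap f g d x y, h.min_eq α ⟨by linarith [hα.1], by linarith [hα.2]⟩]; ring

/-! ### Optimality of the steps of the greedy path. -/

section Path

variable {f g : ℝ → ℝ} {d a₁ a₂ b₁ b₂ : ℝ} {m m' : ℕ} {p S C p' S' C' : ℕ → ℝ} {x y : ℝ}
  {r s : ℕ}

theorem PathInv.swap (h : PathInv f g d a₁ a₂ b₁ b₂ m p S m' p' S' x y r s) :
    PathInv g f d b₁ b₂ a₁ a₂ m' p' S' m p S y x s r :=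
  ⟨h.s_le, h.r_le, h.y_mem, h.x_mem, h.y_end, h.x_end, h.back_y, h.back_x⟩

theorem pathInv_start (hF : PiecewiseLin f a₁ a₂ m p S C) (hG : PiecewiseLin g b₁ b₂ m' p' S' C')
    (hm : 0 < m) (hm' : 0 < m') :
    PathInv f g d a₁ a₂ b₁ b₂ m p S m' p' S' a₁ b₁ 0 0 := by
  refine ⟨by omega, by omega, fun _ => ⟨hF.left.le, ?_⟩, fun _ => ⟨hG.left.le, ?_⟩,
    fun h => by omega, fun h => by omega, ?_, ?_⟩
  · rw [← hF.left]; exact hF.sorted 0 hm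
  · rw [← hG.left]; exact hG.sorted 0 hm'
  · intro _ _ u hu
    obtain rfl : u = a₁ := le_antisymm hu.2 hu.1
    simp
  · intro _ _ u hu
    obtain rfl : u = b₁ := le_antisymm hu.2 hu.1
    simp

theorem PathInv.x_mem_Icc (h : PathInv f g d a₁ a₂ b₁ b₂ m p S m' p' S' x y r s)
    (hF : PiecewiseLin f a₁ a₂ m p S C) (ha : a₁ ≤ a₂) : x ∈ Icc a₁ a₂ := by
  rcases h.r_le.lt_or_eq with hr | hr
  · have := h.x_mem hr
    exact ⟨(hF.left_le hr.le).trans this.1, this.2.trans (hF.le_right hr)⟩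
  · rw [h.x_end hr]; exact ⟨ha, le_rfl⟩

/-- Passing to the next piece raises the slope of `f`, which only weakens the bound in `back_y`; the
bound in `back_x` does not involve the slope of `f`. -/
theorem PathInv.advance (h : PathInv f g d a₁ a₂ b₁ b₂ m p S m' p' S' x y r s)
    (hF : ConvexLin f a₁ a₂ m p S C) (hr : r < m) (hx : x = p (r + 1)) :
    PathInv f g d a₁ a₂ b₁ b₂ m p S m' p' S' x y (r + 1) s := by
  refine ⟨hr, h.s_le, fun hr' => ⟨hx.ge, ?_⟩, h.y_mem, fun hr' => ?_, h.y_end, h.back_x, ?_⟩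
  · rw [hx]; exact hF.sorted _ hr'
  · rw [hx, hr', hF.right]
  · intro hr' hd v hv
    refine (h.back_y hr hd v hv).trans (mul_le_mul_of_nonneg_right ?_ (by linarith [hv.2]))
    split_ifs
    · exact le_rfl
    · exact hF.slope_mono r hr'

/-- The rate at which the minimum grows while `x` moves along a piece of slope `σ`. -/
noncomputable def pathSlope (d u v σ : ℝ) : ℝ :=
  if d < v - u then 0 else if u - v < d then σ / 2 else σ

/-- How far `u` may rise until the rate changes, while `x` moves along a piece where the total
rise is `ρ`. -/
noncomputable def riseLimit (d u v ρ : ℝ) : ℝ :=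
  if d < v - u then v - d - u else if u - v < d then v + d - u else ρ

/-- `hmode` lists the situations in which moving `x` alone is optimal: `y` is exhausted; or `g` is
ahead by more than `d`, so that raising `x` is free; or `f` is ahead by at most `d` and the piece of
`x` is no steeper than that of `y`. On the border `f x - g y = d` the last case requires a flat
piece, for otherwise both points have to move. `hlim` stops the move where the dominant term of
`balance`, and with it the rate, would change. -/
theorem PathInv.step_x (h : PathInv f g d a₁ a₂ b₁ b₂ m p S m' p' S' x y r s)
    (hF : ConvexLin f a₁ a₂ m p S C) (hG : ConvexLin g b₁ b₂ m' p' S' C') (ha : a₁ ≤ a₂)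
    (hb : b₁ ≤ b₂) (hd : 0 ≤ d) (hr : r < m)
    (hmode : s = m' ∨ d < g y - f x ∨
      (f x - g y ≤ d ∧ S r ≤ S' s ∧ (f x - g y < d ∨ S r = 0)))
    {x' ρ : ℝ} (hx' : x' ∈ Icc x (p (r + 1))) (hlim : S r * (x' - x) ≤ riseLimit d (f x) (g y) ρ) :
    f x' = f x + S r * (x' - x) ∧
    OptimalStep f g d a₁ a₂ b₁ b₂ x y x' y (pathSlope d (f x) (g y) (S r)) ∧
    PathInv f g d a₁ a₂ b₁ b₂ m p S m' p' S' x' y r s := by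
  have hxI := h.x_mem_Icc hF.toPiecewiseLin ha
  have hyI := h.swap.x_mem_Icc hG.toPiecewiseLin hb
  have hxp := h.x_mem hr
  have hx'I : x' ∈ Icc a₁ a₂ := ⟨hxI.1.trans hx'.1, hx'.2.trans (hF.le_right hr)⟩
  have hσ := hF.slope_nonneg r hr
  have hlin : ∀ z ∈ Icc x (p (r + 1)), f z = f x + S r * (z - x) := by
    intro z hz
    rw [hF.linear r hr z ⟨hxp.1.trans hz.1, hz.2⟩, hF.linear r hr x hxp]; ring
  have hfx' := hlin x' hx'
  have hρ : 0 ≤ S r * (x' - x) := mul_nonneg hσ (by linarith [hx'.1])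
  have hsub : ∀ u ∈ Icc a₁ a₂, f x + S r * (u - x) ≤ f u := fun u hu => hF.line_le' hr hxp hu
  have hup : ∀ v ∈ Icc b₁ b₂, y ≤ v → g y ≤ g v := fun v hv hyv =>
    hG.monotoneOn hyI hv hyv
  have hτ : s < m' → 0 ≤ S' s := hG.slope_nonneg s
  have hgs : s < m' → ∀ v ∈ Icc b₁ b₂, g y + S' s * (v - y) ≤ g v :=
    fun hs v hv => hG.line_le' hs (h.y_mem hs) hv
  have hse : s < m' ∨ y = b₂ := h.s_le.lt_or_eq.imp_right h.y_end
  have hback := h.back_y hr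
  have hstep : OptimalStep f g d a₁ a₂ b₁ b₂ x y x' y (pathSlope d (f x) (g y) (S r)) := by
    have hκ : 0 ≤ pathSlope d (f x) (g y) (S r) := by
      unfold pathSlope; split_ifs <;> linarith
    -- The subgradient inequality, one regime at a time. If `g` is far ahead, `κ = 0` and `g` is
    -- constant behind `y`. Inside the band the average term is used. If `f` is ahead by `d` or
    -- more, either `κ = 0` or `y` can only decrease.
    have hsup : ∀ u ∈ Icc a₁ a₂, ∀ v ∈ Icc b₁ b₂,
        balance f g d x y + pathSlope d (f x) (g y) (S r) * (u - x + (v - y)) ≤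
          balance f g d u v := by
      intro u hu v hv
      have k1 := hsub u hu
      have k2 : max (max (f u) (g v)) ((f u + g v + d) / 2) = balance f g d u v := rfl
      have k3 := le_max_left (max (f u) (g v)) ((f u + g v + d) / 2)
      have k4 := le_max_right (max (f u) (g v)) ((f u + g v + d) / 2)
      have k5 := max_le_iff.1 k3
      rw [k2] at k4 k5
      rw [balance, pathSlope]
      by_cases z1 : d < g y - f x
      · rw [if_pos z1, max_eq_left, max_eq_right]
        · have := hback (by linarith) v
          rw [if_pos z1] at this
          rcases le_total y v with hv' | hv'
          · linarith [hup v hv hv']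
          · linarith [this ⟨hv.1, hv'⟩]
        · linarith
        · exact (show _ ≤ g y by linarith).trans (le_max_right _ _)
      · by_cases z2 : f x - g y < d
        · rw [if_neg z1, if_pos z2, max_eq_right]
          -- Behind `y` the pieces of `g` are at most as steep as `S r`, by `back_y`; ahead of `y`
          -- they are at least as steep, or nothing is left there.
          · have hg : g y + S r * (v - y) ≤ g v := by
              rcases le_total v y with hv' | hv'
              · have := hback z2 v ⟨hv.1, hv'⟩
                rw [if_neg z1] at this
                linarith
              · rcases hse with hs | hs
                · have : S r ≤ S' s := by
                    rcases hmode with h1 | h1 | h1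
                    · omega
                    · exact absurd h1 z1
                    · exact h1.2.1
                  have := mul_le_mul_of_nonneg_right this (sub_nonneg.2 hv')
                  linarith [hgs hs v hv]
                · obtain rfl : v = y := le_antisymm (by rw [hs]; exact hv.2) hv'
                  simp
            linarith
          · exact max_le (by linarith) (by linarith)
        · rw [if_neg z1, if_neg z2, max_eq_left, max_eq_left]
          · rcases hse with hs | hs
            · have : S r = 0 := by
                rcases hmode with h1 | h1 | h1
                · omega
                · exact absurd h1 z1
                · exact h1.2.2.resolve_left z2
              rw [this] at k1 ⊢
              linarith
            · have := mul_nonneg hσ (show 0 ≤ y - v by rw [hs]; linarith [hv.2])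
              linarith
          · linarith
          · exact (show _ ≤ f x by linarith).trans (le_max_left _ _)
    have hend : balance f g d x' y ≤
        balance f g d x y + pathSlope d (f x) (g y) (S r) * (x' - x + (y - y)) := by
      have k2 : max (max (f x) (g y)) ((f x + g y + d) / 2) = balance f g d x y := rfl
      have k3 := le_max_left (max (f x) (g y)) ((f x + g y + d) / 2)
      have k4 := le_max_right (max (f x) (g y)) ((f x + g y + d) / 2)
      have k5 := max_le_iff.1 k3
      rw [k2] at k4 k5
      rw [balance, hfx']
      unfold pathSlope riseLimit at *
      generalize balance f g d x y = Φ at *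
      split_ifs at hlim ⊢ <;> refine max_le (max_le ?_ ?_) ?_ <;> linarith
    refine ⟨hx'.1, le_rfl, hκ, le_antisymm hend (hsup x' hx'I y hyI), fun α hα => ?_⟩
    -- `y` does not move, so the slope of `g` on its degenerate interval is immaterial.
    refine minBalance_eq_of_support (τ := 0) hxI hyI hx'I hyI hx'.1 le_rfl
      (fun z hz => hlin z ⟨hz.1, hz.2.trans hx'.2⟩) (fun z hz => ?_) hsup hend hα
    rw [le_antisymm hz.2 hz.1]; ring
  refine ⟨hfx', hstep, h.r_le, h.s_le, fun _ => ⟨hxp.1.trans hx'.1, hx'.2⟩, h.y_mem,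
    fun hr' => by omega, h.y_end, ?_, ?_⟩
  · intro hs hz u hu
    have k1 := hF.line_le' hr (x := x') (u := u) ⟨hxp.1.trans hx'.1, hx'.2⟩
      ⟨hu.1, hu.2.trans hx'I.2⟩
    -- The piece just traversed now lies behind `x`. If `g` was ahead by more than `d`, it still is
    -- by at least `d`, and `hz` fails. Otherwise `f x' - g y ≤ d`, and the piece is no steeper than
    -- `S' s`.
    have k2 : S r ≤ if d < f x' - g y then 0 else S' s := by
      rw [hfx'] at hz ⊢
      unfold riseLimit at hlim
      rcases hmode with h1 | h1 | h1
      · omega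
      · rw [if_pos h1] at hlim
        linarith
      · have z1 : ¬ d < g y - f x ∨ d < g y - f x := (em _).symm
        rcases z1 with z1 | z1
        · rcases h1.2.2 with z2 | z2
          · rw [if_neg z1, if_pos z2] at hlim
            rw [if_neg (by linarith)]
            exact h1.2.1
          · rw [z2, if_neg (by linarith)]
            exact hτ hs
        · rw [if_pos z1] at hlim
          linarith
    have := mul_le_mul_of_nonneg_right k2 (sub_nonneg.2 hu.2)
    linarith
  · intro _ hz v hv
    rw [hfx'] at hz ⊢
    have k1 := hback (by linarith) v hv
    refine k1.trans (mul_le_mul_of_nonneg_right ?_ (by linarith [hv.2]))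
    split_ifs with z1 z2 z2
    · exact le_rfl
    · exact hσ
    · linarith
    · exact le_rfl

/-- Write `σ = S r` and `τ = S' s`. On the border `f x - g y = d`, moving `x` alone costs `σ` per
unit, and moving `y` alone costs `τ / 2`. Moving both with equal rises stays on the border and costs
`σ τ / (σ + τ)`, which exceeds neither, as `σ ≤ τ`. -/
theorem PathInv.step_both (h : PathInv f g d a₁ a₂ b₁ b₂ m p S m' p' S' x y r s)
    (hF : ConvexLin f a₁ a₂ m p S C) (hG : ConvexLin g b₁ b₂ m' p' S' C') (ha : a₁ ≤ a₂)
    (hb : b₁ ≤ b₂) (hd : 0 ≤ d) (hr : r < m) (hs : s < m')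
    (heq : f x - g y = d) (hσ : 0 < S r) (hστ : S r ≤ S' s)
    {x' y' : ℝ} (hx' : x' ∈ Icc x (p (r + 1))) (hy' : y' ∈ Icc y (p' (s + 1)))
    (hrise : S r * (x' - x) = S' s * (y' - y)) :
    f x' = f x + S r * (x' - x) ∧ g y' = g y + S r * (x' - x) ∧
    OptimalStep f g d a₁ a₂ b₁ b₂ x y x' y' (S r * S' s / (S r + S' s)) ∧
    PathInv f g d a₁ a₂ b₁ b₂ m p S m' p' S' x' y' r s := by
  have hxI := h.x_mem_Icc hF.toPiecewiseLin ha
  have hyI := h.swap.x_mem_Icc hG.toPiecewiseLin hb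
  have hxp := h.x_mem hr
  have hyp := h.y_mem hs
  have hx'I : x' ∈ Icc a₁ a₂ := ⟨hxI.1.trans hx'.1, hx'.2.trans (hF.le_right hr)⟩
  have hy'I : y' ∈ Icc b₁ b₂ := ⟨hyI.1.trans hy'.1, hy'.2.trans (hG.le_right hs)⟩
  have hτ : 0 < S' s := hσ.trans_le hστ
  have hlin : ∀ z ∈ Icc x (p (r + 1)), f z = f x + S r * (z - x) := by
    intro z hz
    rw [hF.linear r hr z ⟨hxp.1.trans hz.1, hz.2⟩, hF.linear r hr x hxp]; ring
  have hlin' : ∀ z ∈ Icc y (p' (s + 1)), g z = g y + S' s * (z - y) := by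
    intro z hz
    rw [hG.linear s hs z ⟨hyp.1.trans hz.1, hz.2⟩, hG.linear s hs y hyp]; ring
  have hfx' := hlin x' hx'
  have hgy' : g y' = g y + S r * (x' - x) := by rw [hlin' y' hy', hrise]
  have hbal : balance f g d x y = f x := by
    rw [balance, max_eq_left, max_eq_left]
    · linarith
    · exact (show _ ≤ f x by linarith).trans (le_max_left _ _)
  have hsup : ∀ u ∈ Icc a₁ a₂, ∀ v ∈ Icc b₁ b₂,
      balance f g d x y + S r * S' s / (S r + S' s) * (u - x + (v - y)) ≤
        balance f g d u v := by
    intro u hu v hv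
    have k1 := hF.line_le' hr hxp hu
    have k1' := hG.line_le' hs hyp hv
    have k2 : max (max (f u) (g v)) ((f u + g v + d) / 2) = balance f g d u v := rfl
    have k3 := le_max_left (max (f u) (g v)) ((f u + g v + d) / 2)
    have k4 := le_max_right (max (f u) (g v)) ((f u + g v + d) / 2)
    have k5 := max_le_iff.1 k3
    rw [k2] at k4 k5
    rw [hbal]
    generalize balance f g d u v = Φ at *
    have hpos : 0 < S r + S' s := by linarith
    rw [div_mul_eq_mul_div, ← le_sub_iff_add_le', div_le_iff₀ hpos]
    -- The bound `f u ≤ Φ` with weight `S' s - S r` and the average bound with weight `2 * S r` add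
    -- up to `S' s * f u + S r * (g v + d) ≤ (S r + S' s) * Φ`; then the subgradients of `f` and `g`
    -- are inserted.
    have e1 := mul_le_mul_of_nonneg_left k5.1 (sub_nonneg.2 hστ)
    have e2 := mul_le_mul_of_nonneg_left k4 hσ.le
    have e3 := mul_le_mul_of_nonneg_left k1 hτ.le
    have e4 := mul_le_mul_of_nonneg_left k1' hσ.le
    have e5 : g y = f x - d := by linarith
    rw [e5] at e4
    nlinarith
  have hκ : 0 ≤ S r * S' s / (S r + S' s) := by positivity
  have hend : balance f g d x' y' ≤
      balance f g d x y + S r * S' s / (S r + S' s) * (x' - x + (y' - y)) := by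
    have e : S r * S' s / (S r + S' s) * (x' - x + (y' - y)) = S r * (x' - x) := by
      have : S r + S' s ≠ 0 := by linarith
      rw [div_mul_eq_mul_div, div_eq_iff this]
      linear_combination (-(S r)) * hrise
    rw [hbal, e, balance, hfx', hgy']
    refine max_le (max_le ?_ ?_) ?_ <;> linarith
  refine ⟨hfx', hgy', ⟨hx'.1, hy'.1, hκ, le_antisymm hend (hsup x' hx'I y' hy'I), fun α hα => ?_⟩,
    h.r_le, h.s_le, fun _ => ⟨hxp.1.trans hx'.1, hx'.2⟩, fun _ => ⟨hyp.1.trans hy'.1, hy'.2⟩,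
    fun hr' => by omega, fun hs' => by omega, ?_, ?_⟩
  · exact minBalance_eq_of_support hxI hyI hx'I hy'I hx'.1 hy'.1
      (fun z hz => hlin z ⟨hz.1, hz.2.trans hx'.2⟩) (fun z hz => hlin' z ⟨hz.1, hz.2.trans hy'.2⟩)
      hsup hend hα
  · intro _ _ u hu
    have k1 := hF.line_le' hr (x := x') (u := u) ⟨hxp.1.trans hx'.1, hx'.2⟩
      ⟨hu.1, hu.2.trans hx'I.2⟩
    rw [if_neg (by linarith)]
    have := mul_le_mul_of_nonneg_right hστ (sub_nonneg.2 hu.2)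
    linarith
  -- Vacuous, since equal rises keep the difference equal to `d`.
  · intro _ hz
    linarith

end Path

/-! ### Evacuation along a chain -/

/-- The smallest of the capacities `K t, …, K (c - 1)`. -/
noncomputable def bottleneck (K : ℕ → ℝ) (t c : ℕ) : ℝ := sInf (K '' Ico t c)

theorem bottleneck_self (K : ℕ → ℝ) (t : ℕ) : bottleneck K t (t + 1) = K t := by
  rw [bottleneck, show Ico t (t + 1) = {t} by ext u; simp; omega, image_singleton, csInf_singleton]

theorem bottleneck_cons (K : ℕ → ℝ) {t c : ℕ} (h : t + 1 < c) :
    bottleneck K t c = min (K t) (bottleneck K (t + 1) c) := by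
  have hfin : (K '' Ico (t + 1) c).Finite := (finite_Ico _ _).image _
  rw [bottleneck, show Ico t c = insert t (Ico (t + 1) c) by ext u; simp; omega, image_insert_eq,
    csInf_insert hfin.bddBelow ⟨_, t + 1, ⟨le_rfl, h⟩, rfl⟩]
  rfl

theorem bottleneck_pos {K : ℕ → ℝ} {t c : ℕ} (h : t < c) (hK : ∀ u < c, 0 < K u) :
    0 < bottleneck K t c := by
  obtain ⟨u, hu, he⟩ := (PathNet.isLeast_capInf K h).1
  rw [bottleneck, ← he]
  exact hK u hu.2

theorem bottleneck_anti (K : ℕ → ℝ) {t t' c c' : ℕ} (h : t ≤ t') (h' : t' < c) (hc : c ≤ c') :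
    bottleneck K t c' ≤ bottleneck K t' c := by
  have hfin : (K '' Ico t c').Finite := (finite_Ico _ _).image _
  refine csInf_le_csInf hfin.bddBelow ⟨_, t', ⟨le_rfl, h'⟩, rfl⟩ (image_mono ?_)
  exact Ico_subset_Ico h hc

/-- The vertices on one side of the sink, numbered from the far end: `X t` is the distance of the
vertex `t` from the far end, `S t` is the total weight of the vertices `0, …, t`, when the weight
of the vertex `v` is `a`, and `K t` is the capacity of the edge `(t, t + 1)`. -/
structure Chain where
  X : ℕ → ℝ
  S : ℕ → ℝ
  K : ℕ → ℝ
  v : ℕ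
  a : ℝ

namespace Chain

/-- The time in which the weight of the vertices `0, …, t` reaches the location `y` on the edge
that enters the vertex `c`, if the weight of `v` is `a`. -/
noncomputable def val (C : Chain) (c : ℕ) (y : ℝ) (t : ℕ) : ℝ :=
  if 0 < C.S t then y - C.X t + C.S t / bottleneck C.K t c else 0

/-- The derivative of the arrival time with respect to the weight of `v`, which belongs to the
partial sum of `t` exactly when `v ≤ t`. -/
noncomputable def slope (C : Chain) (c t : ℕ) : ℝ :=
  if C.v ≤ t then 1 / bottleneck C.K t c else 0

/-- The time in which all the weight of the vertices before `c` reaches `y`, when the weight of `v`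
is `α`. -/
noncomputable def fn (C : Chain) (c : ℕ) (y α : ℝ) : ℝ :=
  upperEnv (fun t α => C.slope c t * α + (C.val c y t - C.slope c t * C.a)) c α

/-- The weight of `v` is `α`, and it is constant if the weight of the vertices up to `v` may
vanish. -/
structure Admissible (C : Chain) (c : ℕ) (α : ℝ) : Prop where
  le : C.a ≤ α
  eq : ∀ t < c, C.v ≤ t → ¬ 0 < C.S t → α = C.a

variable {C : Chain} {c : ℕ} {y α : ℝ}

theorem slope_nonneg {t : ℕ} (hK : ∀ u < c, 0 < C.K u) (ht : t < c) : 0 ≤ C.slope c t := by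
  unfold slope
  split_ifs
  · exact (one_div_pos.2 (bottleneck_pos ht hK)).le
  · exact le_rfl

/-- If a partial sum that contains `v` vanishes, admissibility freezes the weight at its base value.
Thus the affine expression agrees with the value `0` that the closed formula assigns to a vertex
without load. -/
theorem line_eq_zero (h : C.Admissible c α) {t : ℕ} (ht : t < c) (hS : ¬ 0 < C.S t) :
    C.slope c t * α + (C.val c y t - C.slope c t * C.a) = 0 := by
  rw [val, if_neg hS, slope]
  split_ifs with hv
  · rw [h.eq t ht hv hS]; ring
  · ring

theorem fn_eq_zero (h : C.Admissible c α) (hS : ∀ t < c, ¬ 0 < C.S t) : C.fn c y α = 0 :=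
  le_antisymm (upperEnv_le le_rfl fun t ht => (line_eq_zero h ht (hS t ht)).le)
    (upperEnv_nonneg _ _ _)

theorem fn_nonneg : 0 ≤ C.fn c y α := upperEnv_nonneg _ _ _

theorem continuous_fn : Continuous (C.fn c y) :=
  continuous_upperEnv fun t _ => by fun_prop

/-- Every vertex with a load is delayed by exactly `z`, but the constant `0` in the envelope is not.
So some vertex has to carry a load; its line is nonnegative at `y` already and makes the constant
irrelevant. -/
theorem fn_add (hK : ∀ u < c, 0 < C.K u) (h : C.Admissible c α) (hX : ∀ t < c, C.X t ≤ y)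
    (hS : ∃ t < c, 0 < C.S t) {z : ℝ} (hz : 0 ≤ z) : C.fn c (y + z) α = C.fn c y α + z := by
  have hval : ∀ t, 0 < C.S t → C.val c (y + z) t = C.val c y t + z := by
    intro t ht
    rw [val, val, if_pos ht, if_pos ht]; ring
  have hle := fun t (ht : t < c) => le_upperEnv
    (fun t α => C.slope c t * α + (C.val c y t - C.slope c t * C.a)) ht α
  have hle' := fun t (ht : t < c) => le_upperEnv
    (fun t α => C.slope c t * α + (C.val c (y + z) t - C.slope c t * C.a)) ht α
  refine le_antisymm (upperEnv_le (add_nonneg fn_nonneg hz) ?_) ?_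
  · intro t ht
    by_cases hSt : 0 < C.S t
    · have := hle t ht
      rw [hval t hSt]
      simp only [fn] at this ⊢
      linarith
    · rw [line_eq_zero h ht hSt]
      exact add_nonneg fn_nonneg hz
  · rw [← le_sub_iff_add_le]
    refine upperEnv_le ?_ ?_
    · obtain ⟨t, ht, hSt⟩ := hS
      have h1 := hle' t ht
      have h2 := mul_nonneg (slope_nonneg hK ht) (sub_nonneg.2 h.le)
      have h3 : 0 ≤ C.val c y t := by
        rw [val, if_pos hSt]
        have := div_pos hSt (bottleneck_pos ht hK)
        linarith [hX t ht]
      rw [hval t hSt] at h1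
      simp only [fn] at h1 ⊢
      linarith
    · intro t ht
      by_cases hSt : 0 < C.S t
      · have := hle' t ht
        rw [hval t hSt] at this
        simp only [fn] at this ⊢
        linarith
      · rw [line_eq_zero h ht hSt]
        obtain ⟨t, ht, hSt⟩ := hS
        have h1 := hle' t ht
        have h2 := mul_nonneg (slope_nonneg hK ht) (sub_nonneg.2 h.le)
        have h3 : 0 ≤ C.val c y t := by
          rw [val, if_pos hSt]
          have := div_pos hSt (bottleneck_pos ht hK)
          linarith [hX t ht]
        rw [hval t hSt] at h1
        simp only [fn] at h1 ⊢
        linarith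

/-- A further vertex adds a line, and a further edge can only lower the bottlenecks, which raises
base values and slopes. This compares a sink at an end of an edge with sinks inside it. -/
theorem fn_le_succ (hK : ∀ u < c + 1, 0 < C.K u) (h : C.a ≤ α) :
    C.fn c y α ≤ C.fn (c + 1) y α := by
  refine upperEnv_le fn_nonneg fun t ht => ?_
  have h1 := le_upperEnv
    (fun t α => C.slope (c + 1) t * α + (C.val (c + 1) y t - C.slope (c + 1) t * C.a))
    (show t < c + 1 by omega) α
  have hb := bottleneck_anti C.K le_rfl ht (Nat.le_succ c)
  have hb0 := bottleneck_pos (show t < c + 1 by omega) hK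
  have h2 : C.slope c t ≤ C.slope (c + 1) t := by
    unfold slope
    split_ifs
    · exact one_div_le_one_div_of_le hb0 hb
    · exact le_rfl
  have h3 : C.val c y t ≤ C.val (c + 1) y t := by
    unfold val
    split_ifs with hS
    · have := div_le_div_of_nonneg_left hS.le hb0 hb
      linarith
    · exact le_rfl
  have h4 := mul_le_mul_of_nonneg_right h2 (sub_nonneg.2 h)
  simp only [fn] at h1 ⊢
  linarith

end Chain

/-- The real supremum of the empty set is `0`, which is the value where the envelope starts; if the
set is not empty, nonnegativity makes that starting value harmless. -/
theorem sSup_image_Iio {φ : ℕ → ℝ} {ℓ : ℕ → ℝ → ℝ} {c : ℕ} {x : ℝ} (h0 : ∀ t < c, 0 ≤ φ t)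
    (h : ∀ t < c, φ t = ℓ t x) : sSup (φ '' Iio c) = upperEnv ℓ c x := by
  rcases Nat.eq_zero_or_pos c with rfl | hc
  · rw [show Iio 0 = (∅ : Set ℕ) by ext; simp, image_empty, Real.sSup_empty]; rfl
  · have hfin : (φ '' Iio c).Finite := (finite_Iio _).image _
    have hle : ∀ t < c, φ t ≤ sSup (φ '' Iio c) := fun t ht =>
      le_csSup hfin.bddAbove ⟨t, ht, rfl⟩
    refine le_antisymm (csSup_le ⟨_, 0, hc, rfl⟩ ?_)
      (upperEnv_le ((h0 0 hc).trans (hle 0 hc)) fun t ht => by rw [← h t ht]; exact hle t ht)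
    rintro _ ⟨t, ht, rfl⟩
    rw [h t ht]
    exact le_upperEnv ℓ ht x

/-! ### The evacuation times of a path as envelopes along its two chains. -/

section Evacuation

variable (P : PathNet) (R : WeightRanges P.n) (i j : ℕ) (B : WeightBox)

/-- The vertices to the left of the sink. -/
noncomputable def leftChain : Chain where
  X := P.pos
  S := PathNet.total (R.twoVarying i j B.a₁ B.b₁) 0
  K := P.cap
  v := i
  a := B.a₁

/-- The vertices to the right of the sink, from right to left. -/
noncomputable def rightChain : Chain where
  X := fun t => P.pos P.n - P.pos (P.n - t)
  S := fun t => PathNet.total (R.twoVarying i j B.a₁ B.b₁) (P.n - t) P.n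
  K := fun t => P.cap (P.n - 1 - t)
  v := P.n - j
  a := B.b₁

variable {P R i j B}

theorem twoVarying_nonneg {α β : ℝ} (hα : 0 ≤ α) (hβ : 0 ≤ β) :
    ∀ t ≤ P.n, 0 ≤ R.twoVarying i j α β t := by
  intro t ht
  unfold WeightRanges.twoVarying
  split_ifs
  · exact hα
  · exact hβ
  · exact (R.lo_nonneg t ht).trans (R.lo_le_hi t ht)
  · exact R.lo_nonneg t ht

theorem total_twoVarying (hij : i < j) (a b α β : ℝ) (u v : ℕ) :
    PathNet.total (R.twoVarying i j α β) u v = PathNet.total (R.twoVarying i j a b) u v +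
      (if u ≤ i ∧ i ≤ v then α - a else 0) + (if u ≤ j ∧ j ≤ v then β - b else 0) := by
  have e : ∀ t, R.twoVarying i j α β t = R.twoVarying i j a b t + (if t = i then α - a else 0) +
      (if t = j then β - b else 0) := by
    intro t
    unfold WeightRanges.twoVarying
    split_ifs <;> first | omega | ring
  simp only [PathNet.total, e, Finset.sum_add_distrib, Finset.sum_ite_eq', Finset.mem_Icc]

/-- The left-hand side is the partial sum up to `v_i`, which does not reach the vertices with raised
weights because `i < j`; partial sums grow with `t`. -/
theorem left_weight_le (hij : i < j) {t : ℕ} (hit : i ≤ t) (ht : t ≤ P.n) :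
    B.a₁ + ∑ r ∈ Finset.Ico 0 i, R.lo r ≤ (leftChain P R i j B).S t := by
  have h1 : ∑ r ∈ Finset.Icc 0 i, R.twoVarying i j B.a₁ B.b₁ r ≤ (leftChain P R i j B).S t :=
    Finset.sum_le_sum_of_subset_of_nonneg (Finset.Icc_subset_Icc_right hit)
      fun r hr _ => twoVarying_nonneg B.a_nonneg B.b_nonneg r ((Finset.mem_Icc.1 hr).2.trans ht)
  refine le_trans (le_of_eq ?_) h1
  rw [← Finset.Ico_insert_right (Nat.zero_le i), Finset.sum_insert (by simp)]
  congr 1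
  · simp [WeightRanges.twoVarying]
  · refine Finset.sum_congr rfl fun r hr => ?_
    have := Finset.mem_Ico.1 hr
    rw [WeightRanges.twoVarying, if_neg (by omega), if_neg (by omega), if_neg (by omega)]

theorem right_weight_le (hij : i < j) (hj : j ≤ P.n) {t : ℕ} (hjt : P.n - j ≤ t) :
    B.b₁ + ∑ r ∈ Finset.Ioc j P.n, R.lo r ≤ (rightChain P R i j B).S t := by
  have h1 : ∑ r ∈ Finset.Icc j P.n, R.twoVarying i j B.a₁ B.b₁ r ≤ (rightChain P R i j B).S t :=
    Finset.sum_le_sum_of_subset_of_nonneg (Finset.Icc_subset_Icc_left (by omega))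
      fun r hr _ => twoVarying_nonneg B.a_nonneg B.b_nonneg r (Finset.mem_Icc.1 hr).2
  refine le_trans (le_of_eq ?_) h1
  rw [← Finset.Ioc_insert_left hj, Finset.sum_insert (by simp)]
  congr 1
  · simp [WeightRanges.twoVarying, show j ≠ i by omega]
  · refine Finset.sum_congr rfl fun r hr => ?_
    have := Finset.mem_Ioc.1 hr
    rw [WeightRanges.twoVarying, if_neg (by omega), if_neg (by omega), if_neg (by omega)]

/-- Here the positivity hypothesis enters: if `α` exceeds `a₁`, then `a₁ < a₂`, so every partial sum
from `v_i` on is positive already at the base weight. -/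
theorem left_admissible (hij : i < j)
    (hA : B.a₁ < B.a₂ → 0 < B.a₁ + ∑ t ∈ Finset.Ico 0 i, R.lo t) {c : ℕ} (hc : c ≤ P.n) {α : ℝ}
    (hα : α ∈ Icc B.a₁ B.a₂) : (leftChain P R i j B).Admissible c α := by
  refine ⟨hα.1, fun t ht hv hS => ?_⟩
  by_contra hne
  have h1 : B.a₁ < α := lt_of_le_of_ne hα.1 (Ne.symm hne)
  exact hS ((hA (h1.trans_le hα.2)).trans_le (left_weight_le hij hv (by omega)))

theorem right_admissible (hij : i < j) (hj : j ≤ P.n)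
    (hB : B.b₁ < B.b₂ → 0 < B.b₁ + ∑ t ∈ Finset.Ioc j P.n, R.lo t) {c : ℕ} {α : ℝ}
    (hα : α ∈ Icc B.b₁ B.b₂) : (rightChain P R i j B).Admissible c α := by
  refine ⟨hα.1, fun t ht hv hS => ?_⟩
  by_contra hne
  have h1 : B.b₁ < α := lt_of_le_of_ne hα.1 (Ne.symm hne)
  exact hS ((hB (h1.trans_le hα.2)).trans_le (right_weight_le hij hj hv))

/-- `c` is the number of vertices strictly to the left of `y`, so the bottlenecks end with the edge
that enters the vertex `c`. Because `c ≤ j`, the weight `β` of `v_j` is in none of the partial sums.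
-/
theorem thetaL_eq_fn (hij : i < j) (hj : j ≤ P.n)
    (hA : B.a₁ < B.a₂ → 0 < B.a₁ + ∑ t ∈ Finset.Ico 0 i, R.lo t) {α β : ℝ}
    (hα : α ∈ Icc B.a₁ B.a₂) (hβ : 0 ≤ β) {c : ℕ} (hc : c ≤ j) {y : ℝ} (hy : 0 ≤ y)
    (h1 : ∀ t < c, P.pos t < y) (h2 : y ≤ P.pos c) :
    P.thetaL (R.twoVarying i j α β) y = (leftChain P R i j B).fn c y α := by
  have hadm := left_admissible hij hA (hc.trans hj) hα
  rw [P.thetaL_eq _ (twoVarying_nonneg (B.a_nonneg.trans hα.1) hβ) y hy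
    (h2.trans (P.pos_le (hc.trans hj) le_rfl))]
  rw [show {t | t ≤ P.n ∧ P.pos t < y} = Iio c from ?_]
  · have key : ∀ t < c, P.costL (R.twoVarying i j α β) y t =
        (leftChain P R i j B).slope c t * α +
          ((leftChain P R i j B).val c y t - (leftChain P R i j B).slope c t * B.a₁) := by
      intro t ht
      have hS : PathNet.total (R.twoVarying i j α β) 0 t = (leftChain P R i j B).S t +
          if i ≤ t then α - B.a₁ else 0 := by
        rw [total_twoVarying hij B.a₁ B.b₁]
        simp [leftChain, show ¬ j ≤ t by omega]
      have hm : P.minCap (P.pos t) y = bottleneck P.cap t c :=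
        P.minCap_eq (hc.trans hj) ht le_rfl (P.pos_lt (Nat.lt_succ_self t) (by omega)) h2 h1
      rw [PathNet.costL, hS, hm]
      by_cases hS0 : 0 < (leftChain P R i j B).S t
      · rw [if_pos, Chain.val, if_pos hS0, Chain.slope]
        · change _ = (if i ≤ t then 1 / bottleneck P.cap t c else 0) * α +
            (y - P.pos t + (leftChain P R i j B).S t / bottleneck P.cap t c -
              (if i ≤ t then 1 / bottleneck P.cap t c else 0) * B.a₁)
          split_ifs <;> ring
        · split_ifs
          · linarith [hα.1]
          · linarith
      · have e := Chain.line_eq_zero (y := y) hadm ht hS0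
        change _ = 0 at e
        refine Eq.trans (if_neg ?_) e.symm
        split_ifs with hv
        · rw [hadm.eq t ht hv hS0]
          change ¬ 0 < (leftChain P R i j B).S t + (B.a₁ - B.a₁)
          rwa [sub_self, add_zero]
        · rwa [add_zero]
    refine sSup_image_Iio (fun t ht => ?_) key
    rw [PathNet.costL]
    split_ifs with hpos
    · have hm : P.minCap (P.pos t) y = bottleneck P.cap t c :=
        P.minCap_eq (hc.trans hj) ht le_rfl (P.pos_lt (Nat.lt_succ_self t) (by omega)) h2 h1
      rw [hm]
      have := div_pos hpos (bottleneck_pos ht fun u hu => P.cap_pos u (by omega))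
      linarith [h1 t ht]
    · exact le_rfl
  · ext t
    simp only [mem_ofPred_eq, mem_Iio]
    constructor
    · rintro ⟨h3, h4⟩
      by_contra hcon
      linarith [P.pos_le (not_lt.1 hcon) h3]
    · intro ht
      exact ⟨by omega, h1 t ht⟩

/-- The mirror image: the vertex `n - t` and the edge `n - 1 - t` have the number `t`, and `c ≤ n -
i` keeps `v_i` out of the partial sums. -/
theorem thetaR_eq_fn (hij : i < j) (hj : j ≤ P.n)
    (hB : B.b₁ < B.b₂ → 0 < B.b₁ + ∑ t ∈ Finset.Ioc j P.n, R.lo t) {α β : ℝ}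
    (hα : 0 ≤ α) (hβ : β ∈ Icc B.b₁ B.b₂) {c : ℕ} (hc : c ≤ P.n - i) {y : ℝ} (hy : y ≤ P.pos P.n)
    (h1 : ∀ t < c, y < P.pos (P.n - t)) (h2 : P.pos (P.n - c) ≤ y) :
    P.thetaR (R.twoVarying i j α β) y =
      (rightChain P R i j B).fn c (P.pos P.n - y) β := by
  have hadm := right_admissible (c := c) hij hj hB hβ
  have hpos0 : 0 ≤ P.pos (P.n - c) := by
    have := P.pos_le (Nat.zero_le (P.n - c)) (Nat.sub_le _ _)
    simpa [PathNet.pos] using this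
  rw [P.thetaR_eq _ (twoVarying_nonneg hα (B.b_nonneg.trans hβ.1)) y (hpos0.trans h2) hy]
  have hset : {t | t ≤ P.n ∧ y < P.pos t} = (fun t => P.n - t) '' Iio c := by
    ext t
    simp only [mem_ofPred_eq, mem_image, mem_Iio]
    constructor
    · rintro ⟨h3, h4⟩
      refine ⟨P.n - t, ?_, by omega⟩
      by_contra hcon
      linarith [P.pos_le (show t ≤ P.n - c by omega) (Nat.sub_le _ _)]
    · rintro ⟨t, ht, rfl⟩
      exact ⟨Nat.sub_le _ _, h1 t ht⟩
  rw [hset, image_image]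
  have hm : ∀ t < c, P.minCap y (P.pos (P.n - t)) = bottleneck (rightChain P R i j B).K t c := by
    intro t ht
    rw [P.minCap_eq (Nat.sub_le _ _) (show P.n - c < P.n - t by omega) h2 ?_ le_rfl
      (fun r hr => P.pos_lt hr (Nat.sub_le _ _))]
    -- The reflection `u ↦ n - 1 - u` maps the edges `n - c, …, n - t - 1` onto the numbers `t, …, c
    -- - 1`.
    · rw [bottleneck, rightChain]
      congr 1
      ext z
      simp only [mem_image, mem_Ico]
      constructor
      · rintro ⟨u, hu, rfl⟩
        exact ⟨P.n - 1 - u, by omega, by congr 1; omega⟩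
      · rintro ⟨u, hu, rfl⟩
        exact ⟨P.n - 1 - u, by omega, rfl⟩
    · have := h1 (c - 1) (by omega)
      rwa [show P.n - (c - 1) = P.n - c + 1 by omega] at this
  have key : ∀ t < c, P.costR (R.twoVarying i j α β) y (P.n - t) =
      (rightChain P R i j B).slope c t * β +
        ((rightChain P R i j B).val c (P.pos P.n - y) t -
          (rightChain P R i j B).slope c t * B.b₁) := by
    intro t ht
    have hS : PathNet.total (R.twoVarying i j α β) (P.n - t) P.n = (rightChain P R i j B).S t +
        if P.n - j ≤ t then β - B.b₁ else 0 := by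
      rw [total_twoVarying hij B.a₁ B.b₁, if_neg (show ¬ (P.n - t ≤ i ∧ i ≤ P.n) by omega),
        add_zero]
      congr 1
      by_cases h : P.n - j ≤ t
      · rw [if_pos h, if_pos (by omega)]
      · rw [if_neg h, if_neg (by omega)]
    rw [PathNet.costR, hS, hm t ht]
    by_cases hS0 : 0 < (rightChain P R i j B).S t
    · rw [if_pos, Chain.val, if_pos hS0, Chain.slope]
      · change _ = (if P.n - j ≤ t then 1 / bottleneck (rightChain P R i j B).K t c else 0) * β +
          (P.pos P.n - y - (P.pos P.n - P.pos (P.n - t)) +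
            (rightChain P R i j B).S t / bottleneck (rightChain P R i j B).K t c -
            (if P.n - j ≤ t then 1 / bottleneck (rightChain P R i j B).K t c else 0) * B.b₁)
        split_ifs <;> ring
      · split_ifs
        · linarith [hβ.1]
        · linarith
    · have e := Chain.line_eq_zero (y := P.pos P.n - y) hadm ht hS0
      change _ = 0 at e
      refine Eq.trans (if_neg ?_) e.symm
      split_ifs with hv
      · rw [hadm.eq t ht hv hS0]
        change ¬ 0 < (rightChain P R i j B).S t + (B.b₁ - B.b₁)
        rwa [sub_self, add_zero]
      · rwa [add_zero]
  refine sSup_image_Iio (fun t ht => ?_) key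
  rw [PathNet.costR]
  split_ifs with hpos
  · rw [hm t ht]
    have := div_pos hpos (bottleneck_pos (K := (rightChain P R i j B).K) ht
      fun u hu => P.cap_pos (P.n - 1 - u) (by omega))
    linarith [h1 t ht]
  · exact le_rfl

end Evacuation

/-- If `v + d` fits under the maximum, `z = 0` works. Otherwise `z` makes the second inequality
tight, and the average term of the maximum gives the first one. -/
theorem exists_shift {u v d : ℝ} (hd : 0 ≤ d) : ∃ z ∈ Icc 0 d,
    u + z ≤ max (max u v) ((u + v + d) / 2) ∧ v + (d - z) ≤ max (max u v) ((u + v + d) / 2) := by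
  have h1 := le_max_left (max u v) ((u + v + d) / 2)
  have h2 := le_max_right (max u v) ((u + v + d) / 2)
  have h3 := max_le_iff.1 h1
  generalize max (max u v) ((u + v + d) / 2) = Φ at *
  rcases le_total (v + d) Φ with h | h
  · exact ⟨0, ⟨le_rfl, hd⟩, by linarith, by linarith⟩
  · exact ⟨v + d - Φ, ⟨by linarith, by linarith⟩, by linarith, by linarith⟩

/-! ### Eliminating the position of the sink on its edge. -/

section Evacuation

variable {P : PathNet} {R : WeightRanges P.n} {i j k : ℕ} {B : WeightBox}

/-- The minimum of three values, for sinks inside the edge `(v_k, v_{k+1})` and for sinks at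
`v_k` and at `v_{k+1}`. -/
noncomputable def edgeMin (P : PathNet) (R : WeightRanges P.n) (i j k : ℕ) (B : WeightBox)
    (α : ℝ) : ℝ :=
  min (min
    (minBalance ((leftChain P R i j B).fn (k + 1) (P.pos k))
      ((rightChain P R i j B).fn (P.n - k) (P.pos P.n - P.pos (k + 1)))
      (P.len k) B.a₁ B.a₂ B.b₁ B.b₂ α)
    (minBalance ((leftChain P R i j B).fn k (P.pos k))
      ((rightChain P R i j B).fn (P.n - k) (P.pos P.n - P.pos k)) 0 B.a₁ B.a₂ B.b₁ B.b₂ α))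
    (minBalance ((leftChain P R i j B).fn (k + 1) (P.pos (k + 1)))
      ((rightChain P R i j B).fn (P.n - k - 1) (P.pos P.n - P.pos (k + 1)))
      0 B.a₁ B.a₂ B.b₁ B.b₂ α)

theorem balance_zero (f g : ℝ → ℝ) (x y : ℝ) : balance f g 0 x y = max (f x) (g y) := by
  have h1 := le_max_left (f x) (g y)
  have h2 := le_max_right (f x) (g y)
  exact max_eq_left (by linarith)

/-- As long as both sides carry weight, both times are affine in the position of the sink inside the
edge, and `exists_shift` removes the position. Two things need care: the best shift may fall on an
end of the edge, and a side without weight does not react to shifts. In both cases an end of the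
edge does at least as well, because fewer edges count there (`Chain.fn_le_succ`). -/
theorem isLeast_evacTimes (hik : i ≤ k) (hkj : k < j) (hj : j ≤ P.n)
    (hA : B.a₁ < B.a₂ → 0 < B.a₁ + ∑ t ∈ Finset.Ico 0 i, R.lo t)
    (hB : B.b₁ < B.b₂ → 0 < B.b₁ + ∑ t ∈ Finset.Ioc j P.n, R.lo t)
    {α : ℝ} (hα : α ∈ Icc (B.a₁ + B.b₁) (B.a₂ + B.b₂)) :
    IsLeast (evacTimes P R i j k B α) (edgeMin P R i j k B α) := by
  set L := leftChain P R i j B with hL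
  set Q := rightChain P R i j B with hQ
  have hij : i < j := by omega
  have hxk : P.pos k < P.pos (k + 1) := P.pos_lt (Nat.lt_succ_self k) (by omega)
  have hx0 : 0 ≤ P.pos k := by
    have := P.pos_le (Nat.zero_le k) (by omega)
    simpa [PathNet.pos] using this
  have hxn : P.pos (k + 1) ≤ P.pos P.n := P.pos_le (by omega) le_rfl
  have hlen : P.pos (k + 1) = P.pos k + P.len k := P.pos_succ k
  have hdpos := P.len_pos k (by omega)
  have hKL : ∀ u < k + 1, 0 < L.K u := fun u hu => P.cap_pos u (by omega)
  have hKR : ∀ u < P.n - k, 0 < Q.K u := fun u hu => P.cap_pos _ (by omega)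
  have hXL : ∀ t < k + 1, L.X t ≤ P.pos k := fun t ht => P.pos_le (by omega) (by omega)
  have hXR : ∀ t < P.n - k, Q.X t ≤ P.pos P.n - P.pos (k + 1) := fun t ht => by
    have := P.pos_le (show k + 1 ≤ P.n - t by omega) (by omega)
    change P.pos P.n - P.pos (P.n - t) ≤ _
    linarith
  -- the sink at the left end
  have hl : ∀ p ∈ B.slice α, P.theta (R.twoVarying i j p.1 p.2) (P.pos k) =
      balance (L.fn k (P.pos k)) (Q.fn (P.n - k) (P.pos P.n - P.pos k)) 0 p.1 p.2 := by
    intro p hp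
    rw [balance_zero, PathNet.theta, thetaL_eq_fn hij hj hA hp.1 (B.b_nonneg.trans hp.2.1.1)
      hkj.le hx0 (fun t ht => P.pos_lt ht (by omega)) le_rfl,
      thetaR_eq_fn hij hj hB (B.a_nonneg.trans hp.1.1) hp.2.1 (c := P.n - k) (by omega)
      (hxk.le.trans hxn) (fun t ht => P.pos_lt (by omega) (by omega))
      (P.pos_le (by omega) (by omega))]
  have hr : ∀ p ∈ B.slice α, P.theta (R.twoVarying i j p.1 p.2) (P.pos (k + 1)) =
      balance (L.fn (k + 1) (P.pos (k + 1)))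
        (Q.fn (P.n - k - 1) (P.pos P.n - P.pos (k + 1))) 0 p.1 p.2 := by
    intro p hp
    rw [balance_zero, PathNet.theta, thetaL_eq_fn hij hj hA hp.1 (B.b_nonneg.trans hp.2.1.1)
      hkj (hx0.trans hxk.le) (fun t ht => P.pos_lt ht (by omega)) le_rfl,
      thetaR_eq_fn hij hj hB (B.a_nonneg.trans hp.1.1) hp.2.1 (c := P.n - k - 1) (by omega)
      hxn (fun t ht => P.pos_lt (by omega) (by omega))
      (P.pos_le (by omega) (by omega))]
  -- Strictly inside the edge both sides use `e_k`: there are `k + 1` vertices on the left and `n -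
  -- k` on the right.
  have hm : ∀ p ∈ B.slice α, ∀ y, P.pos k < y → y < P.pos (k + 1) →
      P.theta (R.twoVarying i j p.1 p.2) y =
        max (L.fn (k + 1) y p.1) (Q.fn (P.n - k) (P.pos P.n - y) p.2) := by
    intro p hp y hy1 hy2
    rw [PathNet.theta, thetaL_eq_fn hij hj hA hp.1 (B.b_nonneg.trans hp.2.1.1)
      hkj (hx0.trans hy1.le) (fun t ht => (P.pos_le (by omega) (by omega)).trans_lt hy1) hy2.le,
      thetaR_eq_fn hij hj hB (B.a_nonneg.trans hp.1.1) hp.2.1 (c := P.n - k) (by omega)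
      (hy2.le.trans hxn) (fun t ht => hy2.trans_le (P.pos_le (by omega) (by omega)))
      ((P.pos_le (by omega) (by omega)).trans hy1.le)]
  have admL : ∀ p ∈ B.slice α, L.Admissible (k + 1) p.1 := fun p hp =>
    left_admissible hij hA (by omega) hp.1
  have admR : ∀ p ∈ B.slice α, Q.Admissible (P.n - k) p.2 := fun p hp =>
    right_admissible hij hj hB hp.2.1
  have admR' : ∀ p ∈ B.slice α, Q.Admissible (P.n - k - 1) p.2 := fun p hp =>
    right_admissible hij hj hB hp.2.1
  have admL' : ∀ p ∈ B.slice α, L.Admissible k p.1 := fun p hp =>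
    left_admissible hij hA (by omega) hp.1
  have shiftL : (∃ t < k + 1, 0 < L.S t) → ∀ p ∈ B.slice α, ∀ y, P.pos k ≤ y →
      L.fn (k + 1) y p.1 = L.fn (k + 1) (P.pos k) p.1 + (y - P.pos k) := by
    intro hS p hp y hy
    have := Chain.fn_add hKL (admL p hp) hXL hS (sub_nonneg.2 hy)
    rwa [add_sub_cancel] at this
  have shiftR : (∃ t < P.n - k, 0 < Q.S t) → ∀ p ∈ B.slice α, ∀ y, y ≤ P.pos (k + 1) →
      Q.fn (P.n - k) (P.pos P.n - y) p.2 =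
        Q.fn (P.n - k) (P.pos P.n - P.pos (k + 1)) p.2 + (P.pos (k + 1) - y) := by
    intro hS p hp y hy
    have := Chain.fn_add hKR (admR p hp) hXR hS (sub_nonneg.2 hy)
    rwa [show P.pos P.n - P.pos (k + 1) + (P.pos (k + 1) - y) = P.pos P.n - y by ring] at this
  have lessL : ∀ p ∈ B.slice α, L.fn k (P.pos k) p.1 ≤ L.fn (k + 1) (P.pos k) p.1 := fun p hp =>
    Chain.fn_le_succ hKL (admL p hp).le
  have lessR : ∀ p ∈ B.slice α, Q.fn (P.n - k - 1) (P.pos P.n - P.pos (k + 1)) p.2 ≤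
      Q.fn (P.n - k) (P.pos P.n - P.pos (k + 1)) p.2 := fun p hp => by
    have := Chain.fn_le_succ (C := Q) (c := P.n - k - 1) (y := P.pos P.n - P.pos (k + 1))
      (fun u hu => hKR u (by omega)) (admR p hp).le
    rwa [show P.n - k - 1 + 1 = P.n - k by omega] at this
  have zeroL : (¬ ∃ t < k + 1, 0 < L.S t) → ∀ p ∈ B.slice α, ∀ y, L.fn (k + 1) y p.1 = 0 := by
    intro hS p hp y
    push Not at hS
    exact Chain.fn_eq_zero (admL p hp) fun t ht => not_lt.2 (hS t ht)
  have zeroR : (¬ ∃ t < P.n - k, 0 < Q.S t) → ∀ p ∈ B.slice α, ∀ y,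
      Q.fn (P.n - k) y p.2 = 0 := by
    intro hS p hp y
    push Not at hS
    exact Chain.fn_eq_zero (admR p hp) fun t ht => not_lt.2 (hS t ht)
  have I1 := isLeast_minBalance (L.continuous_fn (c := k + 1) (y := P.pos k))
    (Q.continuous_fn (c := P.n - k) (y := P.pos P.n - P.pos (k + 1))) (d := P.len k)
    B.a_le B.b_le hα
  have I2 := isLeast_minBalance (L.continuous_fn (c := k) (y := P.pos k))
    (Q.continuous_fn (c := P.n - k) (y := P.pos P.n - P.pos k)) (d := 0) B.a_le B.b_le hα
  have I3 := isLeast_minBalance (L.continuous_fn (c := k + 1) (y := P.pos (k + 1)))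
    (Q.continuous_fn (c := P.n - k - 1) (y := P.pos P.n - P.pos (k + 1))) (d := 0)
    B.a_le B.b_le hα
  rw [edgeMin, ← hL, ← hQ]
  set V1 := minBalance (L.fn (k + 1) (P.pos k)) (Q.fn (P.n - k) (P.pos P.n - P.pos (k + 1)))
    (P.len k) B.a₁ B.a₂ B.b₁ B.b₂ α
  set V2 := minBalance (L.fn k (P.pos k)) (Q.fn (P.n - k) (P.pos P.n - P.pos k)) 0
    B.a₁ B.a₂ B.b₁ B.b₂ α
  set V3 := minBalance (L.fn (k + 1) (P.pos (k + 1)))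
    (Q.fn (P.n - k - 1) (P.pos P.n - P.pos (k + 1))) 0 B.a₁ B.a₂ B.b₁ B.b₂ α
  have le2 : ∀ p ∈ B.slice α, V2 ≤ P.theta (R.twoVarying i j p.1 p.2) (P.pos k) := by
    intro p hp
    rw [hl p hp]
    exact I2.2 ⟨p.1, hp.1, p.2, hp.2.1, hp.2.2, rfl⟩
  have le3 : ∀ p ∈ B.slice α, V3 ≤ P.theta (R.twoVarying i j p.1 p.2) (P.pos (k + 1)) := by
    intro p hp
    rw [hr p hp]
    exact I3.2 ⟨p.1, hp.1, p.2, hp.2.1, hp.2.2, rfl⟩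
  have mem2 : ∃ θ ∈ evacTimes P R i j k B α, θ ≤ V2 := by
    obtain ⟨x, hx, y, hy, hxy, he⟩ := I2.1
    exact ⟨_, ⟨(x, y), ⟨hx, hy, hxy⟩, P.pos k, ⟨le_rfl, hxk.le⟩, rfl⟩,
      by rw [hl _ ⟨hx, hy, hxy⟩]; exact he.le⟩
  have mem3 : ∃ θ ∈ evacTimes P R i j k B α, θ ≤ V3 := by
    obtain ⟨x, hx, y, hy, hxy, he⟩ := I3.1
    exact ⟨_, ⟨(x, y), ⟨hx, hy, hxy⟩, P.pos (k + 1), ⟨hxk.le, le_rfl⟩, rfl⟩,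
      by rw [hr _ ⟨hx, hy, hxy⟩]; exact he.le⟩
  -- `V1` itself need not be an evacuation time: an end of the edge may beat the limit of interior
  -- positions, and without weight on one side the average in `balance` may be too large. An
  -- evacuation time that is at most `V1` is enough.
  have mem1 : ∃ θ ∈ evacTimes P R i j k B α, θ ≤ V1 := by
    obtain ⟨x, hx, y, hy, hxy, he⟩ := I1.1
    have hp : (x, y) ∈ B.slice α := ⟨hx, hy, hxy⟩
    have le_f : L.fn (k + 1) (P.pos k) x ≤ V1 :=
      he ▸ (le_max_left _ _).trans (le_max_left _ _)
    have le_g : Q.fn (P.n - k) (P.pos P.n - P.pos (k + 1)) y ≤ V1 :=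
      he ▸ (le_max_right _ _).trans (le_max_left _ _)
    by_cases hSL : ∃ t < k + 1, 0 < L.S t
    · by_cases hSR : ∃ t < P.n - k, 0 < Q.S t
      · obtain ⟨z, hz, z1, z2⟩ := exists_shift (u := L.fn (k + 1) (P.pos k) x)
          (v := Q.fn (P.n - k) (P.pos P.n - P.pos (k + 1)) y) hdpos.le
        have he' : max (max (L.fn (k + 1) (P.pos k) x)
          (Q.fn (P.n - k) (P.pos P.n - P.pos (k + 1)) y)) ((L.fn (k + 1) (P.pos k) x +
          Q.fn (P.n - k) (P.pos P.n - P.pos (k + 1)) y + P.len k) / 2) = V1 := he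
        rw [he'] at z1 z2
        have sR := shiftR hSR _ hp
        have sL := shiftL hSL _ hp
        refine ⟨_, ⟨(x, y), hp, P.pos k + z, ⟨by linarith [hz.1], by linarith [hz.2]⟩, rfl⟩, ?_⟩
        rcases hz.1.eq_or_lt with h0 | h0
        · rw [← h0, add_zero, hl _ hp, balance_zero]
          have := sR (P.pos k) hxk.le
          have := lessL _ hp
          refine max_le ?_ ?_ <;> simp only at * <;> linarith
        · rcases hz.2.eq_or_lt with h1 | h1
          · rw [h1, ← hlen, hr _ hp, balance_zero]
            have := sL (P.pos (k + 1)) hxk.le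
            have := lessR _ hp
            refine max_le ?_ ?_ <;> simp only at * <;> linarith
          · rw [hm _ hp _ (by linarith) (by linarith)]
            have := sL (P.pos k + z) (by linarith)
            have := sR (P.pos k + z) (by linarith)
            refine max_le ?_ ?_ <;> simp only at * <;> linarith
      -- Nothing has to come from the right, so the sink goes to the left end.
      · refine ⟨_, ⟨(x, y), hp, P.pos k, ⟨le_rfl, hxk.le⟩, rfl⟩, ?_⟩
        rw [hl _ hp, balance_zero]
        have h0 := zeroR hSR _ hp (P.pos P.n - P.pos k)
        have h0' := zeroR hSR _ hp (P.pos P.n - P.pos (k + 1))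
        have := lessL _ hp
        refine max_le ?_ ?_ <;> simp only at * <;> linarith
    · refine ⟨_, ⟨(x, y), hp, P.pos (k + 1), ⟨hxk.le, le_rfl⟩, rfl⟩, ?_⟩
      rw [hr _ hp, balance_zero]
      have h0 := zeroL hSL _ hp (P.pos k)
      have h0' := zeroL hSL _ hp (P.pos (k + 1))
      have := lessR _ hp
      refine max_le ?_ ?_ <;> simp only at * <;> linarith
  have lower : ∀ θ ∈ evacTimes P R i j k B α, min (min V1 V2) V3 ≤ θ := by
    rintro θ ⟨p, hp, y, hy, rfl⟩
    rcases hy.1.eq_or_lt with h0 | h0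
    · rw [← h0]
      exact (min_le_left _ _).trans ((min_le_right _ _).trans (le2 p hp))
    · rcases hy.2.eq_or_lt with h1 | h1
      · rw [h1]
        exact (min_le_right _ _).trans (le3 p hp)
      · by_cases hSL : ∃ t < k + 1, 0 < L.S t
        · by_cases hSR : ∃ t < P.n - k, 0 < Q.S t
          · refine ((min_le_left _ _).trans (min_le_left _ _)).trans
              (le_trans (I1.2 ⟨p.1, hp.1, p.2, hp.2.1, hp.2.2, rfl⟩) ?_)
            rw [hm p hp y h0 h1, shiftL hSL p hp y h0.le, shiftR hSR p hp y h1.le]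
            -- Wherever the sink is inside the edge, the two times add up to `f + g + d`, so the
            -- larger one is at least half of this.
            have e1 := le_max_left (L.fn (k + 1) (P.pos k) p.1 + (y - P.pos k))
              (Q.fn (P.n - k) (P.pos P.n - P.pos (k + 1)) p.2 + (P.pos (k + 1) - y))
            have e2 := le_max_right (L.fn (k + 1) (P.pos k) p.1 + (y - P.pos k))
              (Q.fn (P.n - k) (P.pos P.n - P.pos (k + 1)) p.2 + (P.pos (k + 1) - y))
            refine max_le (max_le ?_ ?_) ?_ <;> linarith
          · refine (min_le_left _ _).trans ((min_le_right _ _).trans ((le2 p hp).trans ?_))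
            rw [hl p hp, balance_zero, hm p hp y h0 h1, zeroR hSR p hp, zeroR hSR p hp]
            refine max_le_max ((lessL p hp).trans ?_) le_rfl
            rw [shiftL hSL p hp y h0.le]
            linarith
        · refine (min_le_right _ _).trans ((le3 p hp).trans ?_)
          rw [hr p hp, balance_zero, hm p hp y h0 h1, zeroL hSL p hp, zeroL hSL p hp]
          refine max_le_max le_rfl ((lessR p hp).trans ?_)
          by_cases hSR : ∃ t < P.n - k, 0 < Q.S t
          · rw [shiftR hSR p hp y h1.le]
            linarith
          · rw [zeroR hSR p hp, zeroR hSR p hp]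
  have hmem : ∃ θ ∈ evacTimes P R i j k B α, θ ≤ min (min V1 V2) V3 := by
    rcases min_choice (min V1 V2) V3 with h | h
    · rw [h]
      rcases min_choice V1 V2 with h' | h'
      · rw [h']; exact mem1
      · rw [h']; exact mem2
    · rw [h]; exact mem3
  obtain ⟨θ, hθ, hle⟩ := hmem
  refine ⟨?_, lower⟩
  rwa [le_antisymm hle (lower θ hθ)] at hθ

theorem evacTimes_nonneg {α θ : ℝ} (h : θ ∈ evacTimes P R i j k B α) : 0 ≤ θ := by
  obtain ⟨p, _, y, _, rfl⟩ := h
  exact (Real.sInf_nonneg fun T hT => hT.1).trans (le_max_left _ _)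

/-- If the sink is `v_{k+1}`, a load of at least `A` passes through `v_k`, strictly to its left; for
every other sink on the edge a load of at least `B` passes through `v_{k+1}`, strictly to its right.
-/
theorem evacTimes_pos (hik : i ≤ k) (hkj : k < j) (hj : j ≤ P.n)
    (hA : 0 < B.a₁ + ∑ t ∈ Finset.Ico 0 i, R.lo t)
    (hB : 0 < B.b₁ + ∑ t ∈ Finset.Ioc j P.n, R.lo t) {α θ : ℝ}
    (h : θ ∈ evacTimes P R i j k B α) : 0 < θ := by
  obtain ⟨p, hp, y, hy, rfl⟩ := h
  have hij : i < j := by omega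
  have hxk : P.pos k < P.pos (k + 1) := P.pos_lt (Nat.lt_succ_self k) (by omega)
  have hx0 : 0 ≤ P.pos k := by
    have := P.pos_le (Nat.zero_le k) (by omega)
    simpa [PathNet.pos] using this
  have hxn : P.pos (k + 1) ≤ P.pos P.n := P.pos_le (by omega) le_rfl
  have aux : ∀ (C : Chain) (c : ℕ) (y α : ℝ), (∀ u < c + 1, 0 < C.K u) → C.a ≤ α → 0 < C.S c →
      C.X c ≤ y → 0 < C.fn (c + 1) y α := by
    intro C c y α hK hα hS hX
    have h1 := le_upperEnv
      (fun t α => C.slope (c + 1) t * α + (C.val (c + 1) y t - C.slope (c + 1) t * C.a))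
      (Nat.lt_succ_self c) α
    have h2 := mul_nonneg (Chain.slope_nonneg hK (Nat.lt_succ_self c)) (sub_nonneg.2 hα)
    have h3 : 0 < C.val (c + 1) y c := by
      rw [Chain.val, if_pos hS]
      have := div_pos hS (bottleneck_pos (Nat.lt_succ_self c) hK)
      linarith
    simp only [Chain.fn] at h1 ⊢
    linarith
  rcases hy.2.eq_or_lt with h1 | h1
  · refine lt_of_lt_of_le ?_ (le_max_left _ _)
    rw [thetaL_eq_fn hij hj (fun _ => hA) hp.1 (B.b_nonneg.trans hp.2.1.1) (c := k + 1)
      hkj (hx0.trans hy.1) (fun t ht => h1 ▸ P.pos_lt ht (by omega)) hy.2]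
    exact aux _ _ _ _ (fun u hu => P.cap_pos u (by omega)) hp.1.1
      (hA.trans_le (left_weight_le hij hik (by omega))) hy.1
  · refine lt_of_lt_of_le ?_ (le_max_right _ _)
    rw [thetaR_eq_fn hij hj (fun _ => hB) (B.a_nonneg.trans hp.1.1) hp.2.1 (c := P.n - k - 1 + 1)
      (by omega) (hy.2.trans hxn) (fun t ht => h1.trans_le (P.pos_le (by omega) (by omega)))
      ((P.pos_le (by omega) (by omega)).trans hy.1)]
    refine aux _ _ _ _ (fun u hu => P.cap_pos _ (by omega)) hp.2.1.1
      (hB.trans_le (right_weight_le hij hj (by omega))) ?_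
    change P.pos P.n - P.pos (P.n - (P.n - k - 1)) ≤ _
    rw [show P.n - (P.n - k - 1) = k + 1 by omega]
    linarith

end Evacuation

namespace RealRAM

infixr:30 " ;; " => Prog.seq

theorem frame_exec {p : Prog} (hp : p.loopFree = true) (σ : State) : Frame p σ (p.exec σ) := by
  obtain ⟨T, _, hr⟩ := run_exec p hp σ
  exact hr.frame

attribute [local simp] Prog.exec NExp.eval RExp.eval Test.Holds store_apply Function.update_apply

/-! ### The lines of a chain, in order of slope -/

/-- The real arrays `10`, `11`, `12` hold, from the index `b` on, the first `N` vertices of the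
chain `C`. -/
structure State.HoldsChain (σ : State) (b N : ℕ) (C : Chain) : Prop where
  X : ∀ t < N, σ.realArr 10 (b + t) = C.X t
  S : ∀ t < N, σ.realArr 11 (b + t) = C.S t
  K : ∀ t, t + 1 < N → σ.realArr 12 (b + t) = C.K t

/-- Go to the preceding vertex, and update the bottleneck in the real register `7`. -/
def bottleneckStep : Prog :=
  .setNat 9 (.sub (.reg 9) (.lit 1)) ;;
  .branch (.natEq (.add (.reg 9) (.lit 1)) (.reg 6))
    (.setReal 7 (.read 12 (.add (.reg 7) (.reg 9))))
    (.branch (.realLt (.read 12 (.add (.reg 7) (.reg 9))) (.reg 7))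
      (.setReal 7 (.read 12 (.add (.reg 7) (.reg 9)))) .skip)

/-- Compute the value of the current line at the base weight in the real register `16`. -/
def valStep : Prog :=
  .branch (.realLt (.lit 0) (.read 11 (.add (.reg 7) (.reg 9))))
    (.setReal 16 (.add (.sub (.reg 4) (.read 10 (.add (.reg 7) (.reg 9))))
      (.div (.read 11 (.add (.reg 7) (.reg 9))) (.reg 7))))
    (.setReal 16 (.lit 0))

/-- Write the current line into the arrays `13` and `14`. -/
def storeLine : Prog :=
  .branch (.natLt (.reg 9) (.reg 8))
    (.writeReal 13 (.reg 9) (.lit 0) ;; .writeReal 14 (.reg 9) (.reg 16))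
    (.writeReal 13 (.add (.reg 8) (.sub (.sub (.reg 6) (.lit 1)) (.reg 9)))
        (.div (.lit 1) (.reg 7)) ;;
      .writeReal 14 (.add (.reg 8) (.sub (.sub (.reg 6) (.lit 1)) (.reg 9)))
        (.sub (.reg 16) (.mul (.div (.lit 1) (.reg 7)) (.reg 5))))

def linesBody : Prog := bottleneckStep ;; valStep ;; storeLine

/-- The integer registers `6`, `7`, `8` and the real registers `4`, `5` hold the number `c` of
vertices, the place and the distinguished vertex of a chain, the location `y`, and the base value
of the distinguished weight.  The slopes and the intercepts of the `c` lines are written to the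
arrays `13` and `14`. -/
def linesProg : Prog := .setNat 9 (.reg 6) ;; .loop (.natLt (.lit 0) (.reg 9)) linesBody

/-- The place of the line of the vertex `t` among `c` lines. -/
def linePlace (v c t : ℕ) : ℕ := if t < v then t else v + (c - 1 - t)

theorem bottleneckStep_spec {σ : State} {K : ℕ → ℝ} {b c t : ℕ} (h9 : σ.nat 9 = t + 1)
    (h6 : σ.nat 6 = c) (h7 : σ.nat 7 = b) (ht : t < c) (hK : σ.realArr 12 (b + t) = K t)
    (hr : t + 1 < c → σ.real 7 = bottleneck K (t + 1) c) :
    (bottleneckStep.exec σ).nat 9 = t ∧ (bottleneckStep.exec σ).real 7 = bottleneck K t c := by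
  by_cases h : t + 1 = c
  · subst h
    simp [bottleneckStep, h9, h6, h7, hK, bottleneck_self]
  · rw [bottleneck_cons K (by omega), ← hr (by omega)]
    by_cases h' : K t < σ.real 7
    · simp [bottleneckStep, h9, h6, h7, hK, h, h', min_eq_left h'.le]
    · simp [bottleneckStep, h9, h6, h7, hK, h, h', min_eq_right (not_lt.1 h')]

theorem valStep_spec {σ : State} {C : Chain} {b c t : ℕ} {y : ℝ} (h9 : σ.nat 9 = t)
    (h7 : σ.nat 7 = b) (hS : σ.realArr 11 (b + t) = C.S t) (hX : σ.realArr 10 (b + t) = C.X t)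
    (hr : σ.real 7 = bottleneck C.K t c) (hy : σ.real 4 = y) :
    (valStep.exec σ).real 16 = C.val c y t := by
  by_cases h : 0 < C.S t
  · simp [valStep, h9, h7, hS, hX, hr, hy, h, Chain.val]
  · simp [valStep, h9, h7, hS, hX, hr, hy, h, Chain.val]

theorem storeLine_spec {σ : State} {C : Chain} {c t : ℕ} {y : ℝ} (h9 : σ.nat 9 = t)
    (h6 : σ.nat 6 = c) (h8 : σ.nat 8 = C.v) (hr : σ.real 7 = bottleneck C.K t c)
    (hv : σ.real 16 = C.val c y t) (ha : σ.real 5 = C.a) (s : ℕ) :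
    (storeLine.exec σ).realArr 13 s =
      (if s = linePlace C.v c t then C.slope c t else σ.realArr 13 s) ∧
    (storeLine.exec σ).realArr 14 s =
      (if s = linePlace C.v c t then C.val c y t - C.slope c t * C.a else σ.realArr 14 s) := by
  by_cases h : t < C.v
  · have hs : C.slope c t = 0 := if_neg (by omega)
    simp [storeLine, h9, h8, h, hv, linePlace, hs]
  · have hs : C.slope c t = 1 / bottleneck C.K t c := if_pos (by omega)
    simp [storeLine, h9, h8, h6, h, hv, hr, ha, linePlace, hs]

/-- The vertices are visited from the sink outwards, so that a running minimum maintains the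
bottleneck with one comparison per vertex. -/
theorem linesProg_spec : ∃ K : ℕ, ∀ (σ : State) (C : Chain) (b N c : ℕ) (y : ℝ),
    σ.HoldsChain b N C → c < N → σ.nat 6 = c → σ.nat 7 = b → σ.nat 8 = C.v → σ.real 4 = y →
    σ.real 5 = C.a →
    HaltsWithin linesProg (K * N) σ fun σ' => ∀ t < c,
      σ'.realArr 13 (linePlace C.v c t) = C.slope c t ∧
      σ'.realArr 14 (linePlace C.v c t) = C.val c y t - C.slope c t * C.a := by
  refine ⟨(Test.natLt (.lit 0) (.reg 9)).cost + 1 + linesBody.time + 2, ?_⟩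
  intro σ C b N c y hC hcN h6 h7 h8 hy ha
  refine HaltsWithin.mono (HaltsWithin.seq (haltsWithin_exec rfl
    (Q := fun σ' => σ'.nat 9 = c) (by simp [h6])) fun σ₀ hf h9 => HaltsWithin.mono (haltsWithin_loop rfl
      (fun τ μ => μ = τ.nat 9 ∧ μ ≤ c ∧ (μ < c → τ.real 7 = bottleneck C.K μ c) ∧
        ∀ t < c, μ ≤ t → τ.realArr 13 (linePlace C.v c t) = C.slope c t ∧
          τ.realArr 14 (linePlace C.v c t) = C.val c y t - C.slope c t * C.a) ?_ c
      ⟨h9.symm, le_rfl, fun h => absurd h (lt_irrefl _), fun t h1 h2 => by omega⟩) le_rfl ?_) ?_ fun _ h => h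
  · rintro τ μ hf' ⟨hμ, hμc, h7', hent⟩ hb
    have e6 : τ.nat 6 = c := by rw [hf'.nat 6 rfl, hf.nat 6 rfl, h6]
    have e7 : τ.nat 7 = b := by rw [hf'.nat 7 rfl, hf.nat 7 rfl, h7]
    have e8 : τ.nat 8 = C.v := by rw [hf'.nat 8 rfl, hf.nat 8 rfl, h8]
    have e4 : τ.real 4 = y := by rw [hf'.real 4 rfl, hf.real 4 rfl, hy]
    have e5 : τ.real 5 = C.a := by rw [hf'.real 5 rfl, hf.real 5 rfl, ha]
    have hpos : 0 < μ := by simpa [← hμ] using hb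
    obtain ⟨t, rfl⟩ : ∃ t, μ = t + 1 := ⟨μ - 1, by omega⟩
    have eX : τ.realArr 10 (b + t) = C.X t := by
      rw [hf'.arr 10 rfl, hf.arr 10 rfl]; exact hC.X t (by omega)
    have eS : τ.realArr 11 (b + t) = C.S t := by
      rw [hf'.arr 11 rfl, hf.arr 11 rfl]; exact hC.S t (by omega)
    have eK : τ.realArr 12 (b + t) = C.K t := by
      rw [hf'.arr 12 rfl, hf.arr 12 rfl]; exact hC.K t (by omega)
    refine ⟨t, by omega, ?_⟩
    rw [show linesBody.exec τ = storeLine.exec (valStep.exec (bottleneckStep.exec τ)) from rfl]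
    have f1 := frame_exec (p := bottleneckStep) rfl τ
    obtain ⟨a9, a7⟩ := bottleneckStep_spec hμ.symm e6 e7 (by omega) eK h7'
    generalize bottleneckStep.exec τ = τ₁ at *
    have f2 := frame_exec (p := valStep) rfl τ₁
    have a16 := valStep_spec (y := y) a9 (by rw [f1.nat 7 rfl, e7]) (by rw [f1.arr 11 rfl, eS])
      (by rw [f1.arr 10 rfl, eX]) a7 (by rw [f1.real 4 rfl, e4])
    generalize valStep.exec τ₁ = τ₂ at *
    rw [← f2.nat 9 rfl] at a9
    rw [← f2.real 7 rfl] at a7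
    have f3 := frame_exec (p := storeLine) rfl τ₂
    have a := storeLine_spec a9 (by rw [f2.nat 6 rfl, f1.nat 6 rfl, e6])
      (by rw [f2.nat 8 rfl, f1.nat 8 rfl, e8]) a7 a16 (by rw [f2.real 5 rfl, f1.real 5 rfl, e5])
    generalize storeLine.exec τ₂ = τ₃ at *
    refine ⟨by rw [f3.nat 9 rfl, a9], by omega, fun _ => by rw [f3.real 7 rfl, a7],
      fun t' ht' htt' => ?_⟩
    rw [(a _).1, (a _).2]
    by_cases h : t' = t
    · subst h; simp
    -- Different vertices have different places, so the entries written before survive.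
    · have hpl : linePlace C.v c t' ≠ linePlace C.v c t := by
        unfold linePlace
        split_ifs <;> omega
      rw [if_neg hpl, if_neg hpl, f2.arr 13 rfl, f2.arr 14 rfl, f1.arr 13 rfl, f1.arr 14 rfl]
      exact hent t' ht' (by omega)
  · rintro σ' ⟨_, ⟨μ, hμ, _, _, h⟩, hb⟩ t ht
    refine h t ht ?_
    have : σ'.nat 9 = 0 := by simpa using hb
    omega
  · have : (Prog.setNat 9 (NExp.reg 6)).time = 2 := rfl
    rw [this]
    nlinarith [Nat.zero_le linesBody.time, Nat.zero_le (Test.natLt (.lit 0) (.reg 9)).cost]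

end RealRAM

/-! ### Building an upper envelope -/

theorem RealRAM.linePlace_lt {v c t : ℕ} (ht : t < c) : RealRAM.linePlace v c t < c := by
  unfold RealRAM.linePlace; split_ifs <;> omega

/-- The arrangement is a permutation: first the constant lines, then the others from the sink
outwards. -/
theorem RealRAM.exists_linePlace {v c r : ℕ} (hr : r < c) :
    ∃ t < c, RealRAM.linePlace v c t = r := by
  by_cases h : r < v
  · exact ⟨r, hr, if_pos h⟩
  · exact ⟨v + (c - 1 - r), by omega, by unfold RealRAM.linePlace; rw [if_neg (by omega)]; omega⟩

/-- The lines of a chain, arranged by slope. -/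
structure LineArray (C : Chain) (c : ℕ) (y : ℝ) (s i : ℕ → ℝ) : Prop where
  slope : ∀ t < c, s (RealRAM.linePlace C.v c t) = C.slope c t
  icpt : ∀ t < c, i (RealRAM.linePlace C.v c t) = C.val c y t - C.slope c t * C.a

namespace LineArray

variable {C : Chain} {c : ℕ} {y : ℝ} {s i : ℕ → ℝ}

theorem nonneg (h : LineArray C c y s i) (hK : ∀ u < c, 0 < C.K u) : ∀ r < c, 0 ≤ s r := by
  intro r hr
  obtain ⟨t, ht, rfl⟩ := RealRAM.exists_linePlace (v := C.v) hr
  rw [h.slope t ht]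
  exact Chain.slope_nonneg hK ht

/-- After the constant lines the places run outwards from the sink. Bottlenecks shrink in that
direction, so the slopes do not decrease; this replaces sorting. -/
theorem mono (h : LineArray C c y s i) (hK : ∀ u < c, 0 < C.K u) :
    ∀ r, r + 1 < c → s r ≤ s (r + 1) := by
  intro r hr
  by_cases hv : r < C.v
  · have e := h.slope r (by omega)
    rw [RealRAM.linePlace, if_pos hv] at e
    rw [e, Chain.slope, if_neg (by omega)]
    exact h.nonneg hK _ hr
  · have e1 := h.slope (C.v + (c - 1 - r)) (by omega)
    have e2 := h.slope (C.v + (c - 1 - (r + 1))) (by omega)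
    rw [RealRAM.linePlace, if_neg (by omega),
      show C.v + (c - 1 - (C.v + (c - 1 - r))) = r by omega] at e1
    rw [RealRAM.linePlace, if_neg (by omega),
      show C.v + (c - 1 - (C.v + (c - 1 - (r + 1)))) = r + 1 by omega] at e2
    rw [e1, e2, Chain.slope, Chain.slope, if_pos (by omega), if_pos (by omega)]
    exact one_div_le_one_div_of_le (bottleneck_pos (by omega) hK)
      (bottleneck_anti _ (by omega) (by omega) le_rfl)

theorem upperEnv_eq (h : LineArray C c y s i) :
    upperEnv (fun t x => s t * x + i t) c = C.fn c y := by
  funext x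
  refine le_antisymm (upperEnv_le Chain.fn_nonneg fun r hr => ?_)
    (upperEnv_le (upperEnv_nonneg _ _ _) fun t ht => ?_)
  · obtain ⟨t, ht, rfl⟩ := RealRAM.exists_linePlace (v := C.v) hr
    rw [h.slope t ht, h.icpt t ht]
    exact le_upperEnv (fun t α => C.slope c t * α + (C.val c y t - C.slope c t * C.a)) ht x
  · have := le_upperEnv (fun t x => s t * x + i t) (RealRAM.linePlace_lt (v := C.v) ht) x
    simp only [h.slope t ht, h.icpt t ht] at this
    exact this

end LineArray

/-- The stack of an upper envelope: the `m` pieces describe the envelope of the first `t` lines on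
`[lo, q m]`, and beyond `q m` the next line lies above that envelope. -/
structure EnvStack (ℓ i : ℕ → ℝ) (N : ℕ) (lo hi : ℝ) (t m : ℕ) (q s c : ℕ → ℝ) : Prop where
  pl : PiecewiseLin (upperEnv (fun t x => ℓ t * x + i t) t) lo (q m) m q s c
  slope_mono : ∀ r, r + 1 < m → s r ≤ s (r + 1)
  line_le : ∀ r < m, ∀ x ∈ Icc lo hi, s r * x + c r ≤ upperEnv (fun t x => ℓ t * x + i t) t x
  end_le : q m ≤ hi
  dom : (0 < m ∧ q m = hi) ∨
    (t < N ∧ ∀ x ∈ Icc (q m) hi, upperEnv (fun t x => ℓ t * x + i t) t x ≤ ℓ t * x + i t)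
  size : m ≤ t + 1

namespace EnvStack

variable {ℓ i : ℕ → ℝ} {N : ℕ} {lo hi : ℝ} {t m : ℕ} {q s c q' s' c' : ℕ → ℝ}

theorem line_le_succ (h : EnvStack ℓ i N lo hi t m q s c) {r : ℕ} (hr : r < m) {x : ℝ}
    (hx : x ∈ Icc lo hi) :
    s r * x + c r ≤ upperEnv (fun t x => ℓ t * x + i t) (t + 1) x :=
  (h.line_le r hr x hx).trans (le_max_left _ _)

/-- To the left of a point where the new line is not above the envelope, it stays below. -/
theorem below {x z : ℝ} (hℓ : ∀ t < N, 0 ≤ ℓ t) (hmono : ∀ t, t + 1 < N → ℓ t ≤ ℓ (t + 1))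
    (ht : t < N) (hz : ℓ t * z + i t ≤ upperEnv (fun t x => ℓ t * x + i t) t z) (hxz : x ≤ z) :
    upperEnv (fun t x => ℓ t * x + i t) (t + 1) x = upperEnv (fun t x => ℓ t * x + i t) t x := by
  have hm : ∀ r < t, ℓ r ≤ ℓ t := by
    intro r hr
    induction t, Nat.succ_le_of_lt hr using Nat.le_induction with
    | base => exact hmono r ht
    | succ u hu ih =>
      have hs : ∀ w, ∀ v ≤ w, w < N → ℓ v ≤ ℓ w := by
        intro w
        induction w with
        | zero => intro v hv _; rw [Nat.le_zero.1 hv]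
        | succ w ihw =>
          intro v hv hw
          rcases Nat.le_succ_iff.1 hv with hv | rfl
          · exact (ihw v hv (by omega)).trans (hmono w hw)
          · exact le_rfl
      exact hs (u + 1) r hr.le ht
  -- From `x` to `z` the envelope rises by at most `ℓ t * (z - x)`, which is exactly the rise of the
  -- line, so the order at `z` holds at `x` too.
  have := upperEnv_lipschitz (S := ℓ) (C := i) (N := t) (hℓ t ht) hm hxz
  refine max_eq_left ?_
  simp only
  linarith

theorem finished (h : EnvStack ℓ i N lo hi N m q s c) :
    0 < m ∧ ConvexLin (upperEnv (fun t x => ℓ t * x + i t) N) lo hi m q s c := by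
  rcases h.dom with hd | hd
  · exact ⟨hd.1, ⟨hd.2 ▸ h.pl, h.slope_mono, h.line_le⟩⟩
  · omega

/-- The stack must reach `hi` here, for otherwise `dom` would put the new line above the envelope at
the end of the stack. Being the steepest so far and lower at `hi`, the line is not above the
envelope anywhere. -/
theorem skip (h : EnvStack ℓ i N lo hi t (m + 1) q s c) (hℓ : ∀ t < N, 0 ≤ ℓ t)
    (hmono : ∀ t, t + 1 < N → ℓ t ≤ ℓ (t + 1)) (ht : t < N)
    (hlt : ℓ t * q (m + 1) + i t < s m * q (m + 1) + c m) :
    EnvStack ℓ i N lo hi (t + 1) (m + 1) q s c := by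
  have hF := h.pl.linear m (by omega) (q (m + 1)) ⟨h.pl.sorted m (by omega), le_rfl⟩
  have he : q (m + 1) = hi := by
    rcases h.dom with hd | hd
    · exact hd.2
    · have := hd.2 (q (m + 1)) ⟨le_rfl, h.end_le⟩
      linarith
  have hb : ∀ x ≤ hi, upperEnv (fun t x => ℓ t * x + i t) (t + 1) x =
      upperEnv (fun t x => ℓ t * x + i t) t x := fun x hx =>
    below hℓ hmono ht (z := q (m + 1)) (by linarith) (hx.trans he.ge)
  refine ⟨h.pl.congr (fun _ _ => rfl) (fun _ _ => rfl) (fun _ _ => rfl)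
    fun x hx => hb x (hx.2.trans he.le), h.slope_mono, fun r hr x hx => h.line_le_succ hr hx,
    h.end_le, Or.inl ⟨by omega, he⟩, by have := h.size; omega⟩

/-- The new line is above the last piece at both of its ends, hence along the whole piece, which
therefore disappears; the range where the line dominates extends to the left by this piece. -/
theorem pop (h : EnvStack ℓ i N lo hi t (m + 1) q s c) (ht : t < N)
    (h1 : ¬ ℓ t * q (m + 1) + i t < s m * q (m + 1) + c m)
    (h2 : ¬ ℓ t * q m + i t < s m * q m + c m) : EnvStack ℓ i N lo hi t m q s c := by
  have hq := h.pl.sorted m (by omega)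
  have hF := h.pl.linear m (by omega)
  refine ⟨h.pl.init, fun r hr => h.slope_mono r (by omega), fun r hr => h.line_le r (by omega),
    hq.trans h.end_le, Or.inr ⟨ht, fun x hx => ?_⟩, by have := h.size; omega⟩
  rcases le_total x (q (m + 1)) with hx' | hx'
  · rw [hF x ⟨hx.1, hx'⟩]
    -- The comparison is carried to `x` from the left end if the line is the steeper one, and from
    -- the right end otherwise.
    rcases le_total (s m) (ℓ t) with hs | hs
    · have := mul_le_mul_of_nonneg_right hs (sub_nonneg.2 hx.1)
      linarith
    · have := mul_le_mul_of_nonneg_right hs (sub_nonneg.2 hx')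
      linarith
  · rcases h.dom with hd | hd
    · obtain rfl : x = q (m + 1) := le_antisymm (hx.2.trans hd.2.ge) hx'
      rw [hF _ ⟨hq, le_rfl⟩]
      linarith
    · exact hd.2 x ⟨hx', hx.2⟩

/-- On an empty stack `dom` says that the new line dominates on all of `[lo, hi]`, so it becomes the
only piece. -/
theorem push_first (h : EnvStack ℓ i N lo hi t 0 q s c) (hℓ : ∀ t < N, 0 ≤ ℓ t)
    (hq : q' 0 = q 0) (hq1 : q' 1 = hi) (hs : s' 0 = ℓ t) (hc : c' 0 = i t) :
    t < N ∧ EnvStack ℓ i N lo hi (t + 1) 1 q' s' c' := by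
  have hlo : q 0 = lo := h.pl.left
  rcases h.dom with hd | hd
  · omega
  · have hF : ∀ x ∈ Icc lo hi, upperEnv (fun t x => ℓ t * x + i t) (t + 1) x = s' 0 * x + c' 0 := by
      intro x hx
      rw [hs, hc]
      refine max_eq_right (hd.2 x ?_)
      rwa [hlo]
    have hle := h.end_le
    refine ⟨hd.1, ⟨?_, fun r hr => by omega, fun r hr x hx => ?_, hq1.le, Or.inl ⟨by omega, hq1⟩,
      by omega⟩⟩
    · rw [hq1]
      refine (PiecewiseLin.nil _ (hq.trans hlo)).append (by rwa [← hlo]) hq1 ?_ hF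
      rw [hs]; exact hℓ t hd.1
    · obtain rfl : r = 0 := by omega
      exact (hF x hx).ge

/-- The new line is lower at the left end of the last piece but not at its right end. So it is
strictly steeper, the crossing lies in this piece, and the line is the envelope from there up to
`hi`. -/
theorem push (h : EnvStack ℓ i N lo hi t (m + 1) q s c) (hℓ : ∀ t < N, 0 ≤ ℓ t)
    (hmono : ∀ t, t + 1 < N → ℓ t ≤ ℓ (t + 1)) (ht : t < N)
    (h1 : ¬ ℓ t * q (m + 1) + i t < s m * q (m + 1) + c m)
    (h2 : ℓ t * q m + i t < s m * q m + c m)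
    (hq : ∀ r ≤ m, q' r = q r) (hq1 : q' (m + 1) = (c m - i t) / (ℓ t - s m))
    (hq2 : q' (m + 2) = hi) (hs : ∀ r ≤ m, s' r = s r) (hs1 : s' (m + 1) = ℓ t)
    (hc : ∀ r ≤ m, c' r = c r) (hc1 : c' (m + 1) = i t) :
    EnvStack ℓ i N lo hi (t + 1) (m + 2) q' s' c' := by
  have hqm := h.pl.sorted m (by omega)
  have hF := h.pl.linear m (by omega)
  have hlt : s m < ℓ t := by
    by_contra hcon
    have := mul_le_mul_of_nonneg_right (not_lt.1 hcon) (sub_nonneg.2 hqm)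
    linarith
  have hpos : 0 < ℓ t - s m := sub_pos.2 hlt
  set z := (c m - i t) / (ℓ t - s m) with hz
  have hzeq : ℓ t * z + i t = s m * z + c m := by
    have : z * (ℓ t - s m) = c m - i t := div_mul_cancel₀ _ hpos.ne'
    linarith
  have hz1 : q m ≤ z := by
    rw [hz, le_div_iff₀ hpos]; linarith
  have hz2 : z ≤ q (m + 1) := by
    rw [hz, div_le_iff₀ hpos]; linarith
  have hzhi : z ≤ hi := hz2.trans h.end_le
  have hlow : ∀ x ≤ z, upperEnv (fun t x => ℓ t * x + i t) (t + 1) x =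
      upperEnv (fun t x => ℓ t * x + i t) t x := fun x hx =>
    below hℓ hmono ht (z := z) (by rw [hF z ⟨hz1, hz2⟩, hzeq]) hx
  have hhigh : ∀ x ∈ Icc z hi, upperEnv (fun t x => ℓ t * x + i t) (t + 1) x = ℓ t * x + i t := by
    intro x hx
    refine max_eq_right ?_
    rcases le_total x (q (m + 1)) with hx' | hx'
    · rw [hF x ⟨hz1.trans hx.1, hx'⟩]
      have := mul_le_mul_of_nonneg_right hlt.le (sub_nonneg.2 hx.1)
      linarith
    · rcases h.dom with hd | hd
      · obtain rfl : x = q (m + 1) := le_antisymm (hx.2.trans hd.2.ge) hx'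
        rw [hF _ ⟨hqm, le_rfl⟩]
        linarith
      · exact hd.2 x ⟨hx', hx.2⟩
  have hsn := h.pl.slope_nonneg
  refine ⟨?_, ?_, ?_, hq2.le, Or.inl ⟨by omega, hq2⟩, by have := h.size; omega⟩
  · rw [hq2]
    have p1 : PiecewiseLin (upperEnv (fun t x => ℓ t * x + i t) (t + 1)) lo (q m) m q' s' c' :=
      h.pl.init.congr (fun r hr => hq r hr) (fun r hr => hs r hr.le) (fun r hr => hc r hr.le)
        fun x hx => hlow x (hx.2.trans hz1)
    have p2 := p1.append hz1 hq1 (by rw [hs m le_rfl]; exact hsn m (by omega)) (fun x hx => by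
      rw [hlow x hx.2, hs m le_rfl, hc m le_rfl]
      exact hF x ⟨hx.1, hx.2.trans hz2⟩)
    exact p2.append hzhi hq2 (by rw [hs1]; exact hℓ t ht) fun x hx => by
      rw [hs1, hc1]; exact hhigh x hx
  · intro r hr
    rcases Nat.lt_succ_iff_lt_or_eq.1 (show r < m + 1 by omega) with hr' | rfl
    · rw [hs r hr'.le, hs (r + 1) (by omega)]
      exact h.slope_mono r (by omega)
    · rw [hs r le_rfl, hs1]; exact hlt.le
  · intro r hr x hx
    rcases Nat.lt_succ_iff_lt_or_eq.1 (show r < m + 1 + 1 by omega) with hr' | rfl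
    · rw [hs r (by omega), hc r (by omega)]
      exact h.line_le_succ hr' hx
    · rw [hs1, hc1]
      exact le_max_right _ _

end EnvStack

/-! ### Functions stored in memory. -/

namespace RealRAM

attribute [local simp] Prog.exec NExp.eval RExp.eval Test.Holds store_apply Function.update_apply

/-- The real arrays `7`, `8`, `9` hold, from the index `b` on, the critical points, slopes and
intercepts of the `m` pieces of `f` on `[A, B]`. -/
def State.Stores (σ : State) (f : ℝ → ℝ) (A B : ℝ) (b m : ℕ) : Prop :=
  PiecewiseLin f A B m (fun t => σ.realArr 7 (b + t)) (fun t => σ.realArr 8 (b + t))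
    (fun t => σ.realArr 9 (b + t))

def State.StoresConvex (σ : State) (f : ℝ → ℝ) (A B : ℝ) (b m : ℕ) : Prop :=
  ConvexLin f A B m (fun t => σ.realArr 7 (b + t)) (fun t => σ.realArr 8 (b + t))
    (fun t => σ.realArr 9 (b + t))

/-- The arrays `7`, `8`, `9` of `σ` and `τ` agree below the index `h`. -/
def State.AgreeBelow (h : ℕ) (σ τ : State) : Prop :=
  ∀ t < h, τ.realArr 7 t = σ.realArr 7 t ∧ τ.realArr 8 t = σ.realArr 8 t ∧
    τ.realArr 9 t = σ.realArr 9 t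

theorem State.AgreeBelow.trans {h : ℕ} {σ₁ σ₂ σ₃ : State} (h₁ : State.AgreeBelow h σ₁ σ₂)
    (h₂ : State.AgreeBelow h σ₂ σ₃) : State.AgreeBelow h σ₁ σ₃ := fun t ht =>
  ⟨(h₂ t ht).1.trans (h₁ t ht).1, (h₂ t ht).2.1.trans (h₁ t ht).2.1,
    (h₂ t ht).2.2.trans (h₁ t ht).2.2⟩

theorem State.AgreeBelow.mono {h h' : ℕ} {σ₁ σ₂ : State} (h₁ : State.AgreeBelow h σ₁ σ₂)
    (hh : h' ≤ h) : State.AgreeBelow h' σ₁ σ₂ := fun t ht => h₁ t (by omega)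

theorem State.AgreeBelow.of_arr {σ₁ σ₂ : State} (h7 : σ₂.realArr 7 = σ₁.realArr 7)
    (h8 : σ₂.realArr 8 = σ₁.realArr 8) (h9 : σ₂.realArr 9 = σ₁.realArr 9) (h : ℕ) :
    State.AgreeBelow h σ₁ σ₂ := fun t _ => by rw [h7, h8, h9]; exact ⟨rfl, rfl, rfl⟩

theorem State.AgreeBelow.of_frame {p : Prog} {σ₁ σ₂ : State} (hf : Frame p σ₁ σ₂)
    (h : (p.writesTo 7 || p.writesTo 8 || p.writesTo 9) = false) (b : ℕ) :
    State.AgreeBelow b σ₁ σ₂ := by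
  simp only [Bool.or_eq_false_iff] at h
  exact .of_arr (hf.arr 7 h.1.1) (hf.arr 8 h.1.2) (hf.arr 9 h.2) b

/-- The inequality `b + m < h` is strict because `m` pieces have `m + 1` critical points. -/
theorem State.Stores.agree {σ τ : State} {f : ℝ → ℝ} {A B : ℝ} {b m h : ℕ}
    (hS : σ.Stores f A B b m) (hA : State.AgreeBelow h σ τ) (hb : b + m < h) :
    τ.Stores f A B b m :=
  PiecewiseLin.congr hS (fun t ht => (hA (b + t) (by omega)).1)
    (fun t ht => (hA (b + t) (by omega)).2.1) (fun t ht => (hA (b + t) (by omega)).2.2)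
    fun _ _ => rfl

theorem State.StoresConvex.stores {σ : State} {f : ℝ → ℝ} {A B : ℝ} {b m : ℕ}
    (hS : σ.StoresConvex f A B b m) : σ.Stores f A B b m := hS.toPiecewiseLin

theorem State.StoresConvex.agree {σ τ : State} {f : ℝ → ℝ} {A B : ℝ} {b m h : ℕ}
    (hS : σ.StoresConvex f A B b m) (hA : State.AgreeBelow h σ τ) (hb : b + m < h) :
    τ.StoresConvex f A B b m := by
  refine ⟨hS.stores.agree hA hb, fun t ht => ?_, fun t ht x hx => ?_⟩
  · rw [(hA (b + t) (by omega)).2.1, (hA (b + (t + 1)) (by omega)).2.1]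
    exact hS.slope_mono t ht
  · rw [(hA (b + t) (by omega)).2.1, (hA (b + t) (by omega)).2.2]
    exact hS.line_le t ht x hx

/-! ### The program for upper envelopes -/

def envInit : Prog :=
  .setNat 9 (.lit 0) ;; .setNat 10 (.lit 1) ;;
  .writeReal 7 (.reg 5) (.reg 5) ;; .writeReal 7 (.add (.reg 5) (.lit 1)) (.reg 6) ;;
  .writeReal 8 (.reg 5) (.lit 0) ;; .writeReal 9 (.reg 5) (.lit 0)

def envPushFirst : Prog :=
  .writeReal 8 (.reg 5) (.read 13 (.reg 9)) ;; .writeReal 9 (.reg 5) (.read 14 (.reg 9)) ;;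
  .writeReal 7 (.add (.reg 5) (.lit 1)) (.reg 6) ;; .setNat 10 (.lit 1) ;;
  .setNat 9 (.add (.reg 9) (.lit 1))

def envPush : Prog :=
  .writeReal 7 (.add (.reg 5) (.reg 10))
    (.div (.sub (.read 9 (.add (.reg 5) (.sub (.reg 10) (.lit 1)))) (.read 14 (.reg 9)))
      (.sub (.read 13 (.reg 9)) (.read 8 (.add (.reg 5) (.sub (.reg 10) (.lit 1)))))) ;;
  .writeReal 8 (.add (.reg 5) (.reg 10)) (.read 13 (.reg 9)) ;;
  .writeReal 9 (.add (.reg 5) (.reg 10)) (.read 14 (.reg 9)) ;;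
  .writeReal 7 (.add (.reg 5) (.add (.reg 10) (.lit 1))) (.reg 6) ;;
  .setNat 10 (.add (.reg 10) (.lit 1)) ;; .setNat 9 (.add (.reg 9) (.lit 1))

/-- The new line lies below the last piece of the stack at the critical point with the given
number. -/
def envTest (e : NExp) : Test :=
  .realLt (.add (.mul (.read 13 (.reg 9)) (.read 7 (.add (.reg 5) e))) (.read 14 (.reg 9)))
    (.add (.mul (.read 8 (.add (.reg 5) (.sub (.reg 10) (.lit 1)))) (.read 7 (.add (.reg 5) e)))
      (.read 9 (.add (.reg 5) (.sub (.reg 10) (.lit 1)))))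

def envBody : Prog :=
  .branch (.natEq (.reg 10) (.lit 0)) envPushFirst
    (.branch (envTest (.reg 10)) (.setNat 9 (.add (.reg 9) (.lit 1)))
      (.branch (envTest (.sub (.reg 10) (.lit 1))) envPush
        (.setNat 10 (.sub (.reg 10) (.lit 1)))))

/-- The upper envelope of `0` and the lines in the arrays `13` and `14`, whose number is held by
the integer register `6`, on the interval between the real registers `5` and `6`.  The result is
stored at the place given by the integer register `5`, and its size is held by the register
`10`. -/
def envProg : Prog := envInit ;; .loop (.natLt (.reg 9) (.reg 6)) envBody

/-- A round either uses up a line and adds at most one piece, or removes a piece; the potential `2 *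
(c - t) + m` decreases in both cases. The stack starts with one piece for the constant `0`, hence at
most `c + 1` pieces result. -/
theorem envProg_spec : ∃ K : ℕ, ∀ (σ : State) (N c h : ℕ) (lo hi : ℝ), c < N → σ.nat 6 = c →
    σ.nat 5 = h → σ.real 5 = lo → σ.real 6 = hi → lo ≤ hi →
    (∀ t < c, 0 ≤ σ.realArr 13 t) → (∀ t, t + 1 < c → σ.realArr 13 t ≤ σ.realArr 13 (t + 1)) →
    HaltsWithin envProg (K * N) σ fun σ' => ∃ m, σ'.nat 10 = m ∧ 0 < m ∧ m ≤ c + 1 ∧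
      σ'.StoresConvex (upperEnv (fun t x => σ.realArr 13 t * x + σ.realArr 14 t) c) lo hi h m ∧
      State.AgreeBelow h σ σ' := by
  refine ⟨envInit.time + 2 * ((Test.natLt (.reg 9) (.reg 6)).cost + 1 + envBody.time), ?_⟩
  intro σ N c h lo hi hcN h6 h5 hlo hhi hle hℓ hmono
  refine HaltsWithin.mono (HaltsWithin.seq (haltsWithin_exec (p := envInit) rfl
    (Q := fun σ' => σ'.nat 9 = 0 ∧ σ'.nat 10 = 1 ∧ σ'.realArr 7 h = lo ∧
      σ'.realArr 7 (h + 1) = hi ∧ σ'.realArr 8 h = 0 ∧ σ'.realArr 9 h = 0 ∧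
      State.AgreeBelow h σ σ') ?_) fun σ₀ hf hQ => HaltsWithin.mono (haltsWithin_loop rfl
      (fun τ μ => ∃ t m, τ.nat 9 = t ∧ τ.nat 10 = m ∧ μ = 2 * (c - t) + m ∧ t ≤ c ∧
        State.AgreeBelow h σ τ ∧
        EnvStack (σ.realArr 13) (σ.realArr 14) c lo hi t m (fun t => τ.realArr 7 (h + t))
          (fun t => τ.realArr 8 (h + t)) (fun t => τ.realArr 9 (h + t))) ?_ (2 * c + 1)
      ⟨0, 1, hQ.1, hQ.2.1, by omega, by omega, hQ.2.2.2.2.2.2, ?_⟩) le_rfl ?_) ?_ fun _ h => h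
  · refine ⟨by simp [envInit], by simp [envInit], by simp [envInit, h5, hlo],
      by simp [envInit, h5, hhi], by simp [envInit, h5], by simp [envInit, h5], ?_⟩
    intro t ht
    simp [envInit, h5, show t ≠ h by omega, show t ≠ h + 1 by omega]
  · rintro τ μ hf' ⟨t, m, h9, h10, hμ, htc, hag, hst⟩ hb
    have e5 : τ.nat 5 = h := by rw [hf'.nat 5 rfl, hf.nat 5 rfl, h5]
    have e6 : τ.nat 6 = c := by rw [hf'.nat 6 rfl, hf.nat 6 rfl, h6]
    have r6 : τ.real 6 = hi := by rw [hf'.real 6 rfl, hf.real 6 rfl, hhi]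
    have e13 : τ.realArr 13 = σ.realArr 13 := by rw [hf'.arr 13 rfl, hf.arr 13 rfl]
    have e14 : τ.realArr 14 = σ.realArr 14 := by rw [hf'.arr 14 rfl, hf.arr 14 rfl]
    have ht : t < c := by simpa [h9, e6] using hb
    have htest : ∀ (e : NExp) (r : ℕ), e.eval τ = r → ((envTest e).Holds τ ↔
        σ.realArr 13 t * τ.realArr 7 (h + r) + σ.realArr 14 t <
          τ.realArr 8 (h + (m - 1)) * τ.realArr 7 (h + r) + τ.realArr 9 (h + (m - 1))) := by
      intro e r her
      simp [envTest, h9, h10, e5, e13, e14, her]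
    rcases Nat.eq_zero_or_pos m with rfl | hm
    · have he : envBody.exec τ = envPushFirst.exec τ := by
        simp only [envBody, Prog.exec]
        rw [if_pos]
        simpa using h10
      rw [he]
      obtain ⟨_, hst'⟩ := hst.push_first (q' := fun t => (envPushFirst.exec τ).realArr 7 (h + t))
        (s' := fun t => (envPushFirst.exec τ).realArr 8 (h + t))
        (c' := fun t => (envPushFirst.exec τ).realArr 9 (h + t)) hℓ
        (by simp [envPushFirst, e5]) (by simp [envPushFirst, e5, r6])
        (by simp [envPushFirst, e5, h9, e13]) (by simp [envPushFirst, e5, h9, e14])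
      refine ⟨_, ?_, t + 1, 1, by simp [envPushFirst, h9], by simp [envPushFirst], rfl, ht,
        hag.trans fun r hr => ?_, hst'⟩
      · omega
      · simp [envPushFirst, e5, show r ≠ h by omega, show r ≠ h + 1 by omega]
    · obtain ⟨m, rfl⟩ : ∃ m', m = m' + 1 := ⟨m - 1, by omega⟩
      simp only [Nat.add_sub_cancel] at htest
      have hm0 : ¬ (Test.natEq (.reg 10) (.lit 0)).Holds τ := by simp [h10]
      by_cases h1 : (envTest (.reg 10)).Holds τ
      · have he : envBody.exec τ = (Prog.setNat 9 (.add (.reg 9) (.lit 1))).exec τ := by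
          rw [envBody, exec_branch_neg hm0, exec_branch_pos h1]
        rw [he]
        rw [htest (.reg 10) (m + 1) h10] at h1
        exact ⟨_, by omega, t + 1, m + 1, by simp [h9], by simp [h10], rfl, ht, hag,
          hst.skip hℓ hmono ht h1⟩
      · by_cases h2 : (envTest (.sub (.reg 10) (.lit 1))).Holds τ
        · have he : envBody.exec τ = envPush.exec τ := by
            rw [envBody, exec_branch_neg hm0, exec_branch_neg h1, exec_branch_pos h2]
          rw [he]
          rw [htest (.reg 10) (m + 1) h10] at h1
          rw [htest (.sub (.reg 10) (.lit 1)) m (by simp [h10])] at h2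
          have hst' := hst.push (q' := fun t => (envPush.exec τ).realArr 7 (h + t))
            (s' := fun t => (envPush.exec τ).realArr 8 (h + t))
            (c' := fun t => (envPush.exec τ).realArr 9 (h + t)) hℓ hmono ht h1 h2
            (fun r hr => by
              simp [envPush, e5, h10, show r ≠ m + 1 by omega, show r ≠ m + 1 + 1 by omega])
            (by simp [envPush, e5, h10, h9, e13, e14])
            (by simp [envPush, e5, h10, r6])
            (fun r hr => by simp [envPush, e5, h10, show r ≠ m + 1 by omega])
            (by simp [envPush, e5, h10, h9, e13])
            (fun r hr => by simp [envPush, e5, h10, show r ≠ m + 1 by omega])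
            (by simp [envPush, e5, h10, h9, e14])
          refine ⟨_, ?_, t + 1, m + 2, by simp [envPush, h9], by simp [envPush, h10], rfl, ht,
            hag.trans fun r hr => ?_, hst'⟩
          · omega
          · simp [envPush, e5, h10, show r ≠ h + (m + 1) by omega,
              show r ≠ h + (m + 1 + 1) by omega]
        · have he : envBody.exec τ = (Prog.setNat 10 (.sub (.reg 10) (.lit 1))).exec τ := by
            rw [envBody, exec_branch_neg hm0, exec_branch_neg h1, exec_branch_neg h2]
          rw [he]
          rw [htest (.reg 10) (m + 1) h10] at h1
          rw [htest (.sub (.reg 10) (.lit 1)) m (by simp [h10])] at h2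
          exact ⟨_, by omega, t, m, by simp [h9], by simp [h10], rfl, htc, hag,
            hst.pop ht h1 h2⟩
  · obtain ⟨_, _, q7, q7', q8, q9, _⟩ := hQ
    refine ⟨?_, fun r hr => by omega, fun r hr x hx => ?_, q7'.le, Or.inl ⟨by omega, q7'⟩, by omega⟩
    · rw [q7']
      refine (PiecewiseLin.nil _ (by simpa using q7)).append hle q7' (by simp [q8]) fun x hx => ?_
      simp [q8, q9, upperEnv]
    · obtain rfl : r = 0 := by omega
      simp [q8, q9, upperEnv]
  · rintro τ ⟨hf', ⟨μ, t, m, h9, h10, _, htc, hag, hst⟩, hb⟩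
    have e6 : τ.nat 6 = c := by rw [hf'.nat 6 rfl, hf.nat 6 rfl, h6]
    obtain rfl : t = c := by
      have : ¬ t < c := by simpa [h9, e6] using hb
      omega
    exact ⟨m, h10, hst.finished.1, hst.size, hst.finished.2, hag⟩
  · generalize (Test.natLt (NExp.reg 9) (.reg 6)).cost + 1 + envBody.time = k at *
    have h1 : envInit.time ≤ envInit.time * N := Nat.le_mul_of_pos_right _ (by omega)
    have h2 : k * (2 * c + 1 + 1) ≤ k * (2 * N) := Nat.mul_le_mul_left _ (by omega)
    calc _ ≤ envInit.time * N + k * (2 * N) := add_le_add h1 h2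
      _ = _ := by ring

end RealRAM

namespace RealRAM

attribute [local simp] Prog.exec NExp.eval RExp.eval Test.Holds store_apply Function.update_apply

/-! ### Appending a piece -/

/-- Append the piece with slope and intercept in the real registers `16` and `24`, which ends at
the value of the real register `25`, to the function at the place given by the integer register
`5`, whose size is held by the integer register `10`. -/
def emit : Prog :=
  .writeReal 8 (.add (.reg 5) (.reg 10)) (.reg 16) ;;
  .writeReal 9 (.add (.reg 5) (.reg 10)) (.reg 24) ;;
  .writeReal 7 (.add (.reg 5) (.add (.reg 10) (.lit 1))) (.reg 25) ;;
  .setNat 10 (.add (.reg 10) (.lit 1))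

theorem emit_spec {σ : State} {f : ℝ → ℝ} {A α : ℝ} {h m : ℕ} (h5 : σ.nat 5 = h)
    (h10 : σ.nat 10 = m) (hS : σ.Stores f A α h m) (hα : α ≤ σ.real 25) (hκ : 0 ≤ σ.real 16)
    (hf : ∀ x ∈ Icc α (σ.real 25), f x = σ.real 16 * x + σ.real 24) :
    (emit.exec σ).Stores f A (σ.real 25) h (m + 1) ∧ (emit.exec σ).nat 10 = m + 1 ∧
      State.AgreeBelow h σ (emit.exec σ) := by
  refine ⟨?_, by simp [emit, h10], fun t ht => ?_⟩
  · have h1 : PiecewiseLin f A α m (fun t => (emit.exec σ).realArr 7 (h + t))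
        (fun t => (emit.exec σ).realArr 8 (h + t)) (fun t => (emit.exec σ).realArr 9 (h + t)) :=
      PiecewiseLin.congr hS (fun t ht => by simp [emit, h5, h10, show t ≠ m + 1 by omega])
        (fun t ht => by simp [emit, h5, h10, show t ≠ m by omega])
        (fun t ht => by simp [emit, h5, h10, show t ≠ m by omega]) fun _ _ => rfl
    refine h1.append hα (by simp [emit, h5, h10]) (by simpa [emit, h5, h10] using hκ) ?_
    intro x hx
    rw [hf x hx]
    simp [emit, h5, h10]
  · simp [emit, h5, h10, show t ≠ h + (m + 1) by omega, show t ≠ h + m by omega]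

/-! ### The minimum of two functions -/

def minInit : Prog :=
  .setNat 15 (.lit 0) ;; .setNat 16 (.lit 0) ;; .setNat 10 (.lit 0) ;;
  .setReal 9 (.read 7 (.reg 11)) ;; .writeReal 7 (.reg 5) (.read 7 (.reg 11))

/-- The critical points at the ends of the current pieces. -/
abbrev endF : RExp := .read 7 (.add (.reg 11) (.add (.reg 15) (.lit 1)))

abbrev endG : RExp := .read 7 (.add (.reg 13) (.add (.reg 16) (.lit 1)))

/-- Load the current pieces, the next critical point, and the differences of the two functions at
the ends of the interval between the current and the next critical point. -/
def minLoad : Prog :=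
  .setReal 14 (.read 8 (.add (.reg 11) (.reg 15))) ;;
  .setReal 15 (.read 9 (.add (.reg 11) (.reg 15))) ;;
  .setReal 20 (.read 8 (.add (.reg 13) (.reg 16))) ;;
  .setReal 21 (.read 9 (.add (.reg 13) (.reg 16))) ;;
  .branch (.realLt endG endF) (.setReal 25 endG) (.setReal 25 endF)

def minDiff (e : ℕ) : RExp :=
  .sub (.add (.mul (.reg 14) (.reg e)) (.reg 15)) (.add (.mul (.reg 20) (.reg e)) (.reg 21))

/-- Move the end of the new piece to the crossing point. -/
def minCross : Prog :=
  .setReal 25 (.add (.reg 9) (.mul (.sub (.reg 25) (.reg 9))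
    (.div (.reg 22) (.sub (.reg 22) (.reg 23)))))

def takeF : Prog :=
  .setReal 16 (.reg 14) ;; .setReal 24 (.reg 15) ;; .branch (.realLt (.lit 0) (.reg 23)) minCross .skip

def takeG : Prog :=
  .setReal 16 (.reg 20) ;; .setReal 24 (.reg 21) ;; .branch (.realLt (.reg 23) (.lit 0)) minCross .skip

def minChoose : Prog :=
  .setReal 22 (minDiff 9) ;; .setReal 23 (minDiff 25) ;;
  .branch (.realLt (.reg 22) (.lit 0)) takeF
    (.branch (.realLt (.lit 0) (.reg 22)) takeG
      (.branch (.realLt (.lit 0) (.reg 23)) takeG takeF))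

def minAdvance : Prog :=
  .branch (.realLt (.reg 25) endF) .skip (.setNat 15 (.add (.reg 15) (.lit 1))) ;;
  .branch (.realLt (.reg 25) endG) .skip (.setNat 16 (.add (.reg 16) (.lit 1))) ;;
  .setReal 9 (.reg 25)

def minBody : Prog := minLoad ;; minChoose ;; emit ;; minAdvance

/-- The minimum of the functions whose places and sizes are held by the integer registers `11`,
`12` and `13`, `14`; the result is stored at the place given by the integer register `5`, and its
size is held by the register `10`. -/
def minProg : Prog :=
  minInit ;; .loop (.and (.natLt (.reg 15) (.reg 12)) (.natLt (.reg 16) (.reg 14))) minBody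

/-- The zero of an affine function by linear interpolation: opposite signs at the ends make the
denominator nonzero and put the ratio into `[0, 1]`. -/
theorem cross_spec {a b x e : ℝ} (hx : x ≤ e)
    (h : (a * x + b < 0 ∧ 0 < a * e + b) ∨ (0 < a * x + b ∧ a * e + b < 0)) {z : ℝ}
    (hz : z = x + (e - x) * ((a * x + b) / (a * x + b - (a * e + b)))) :
    x ≤ z ∧ z ≤ e ∧ a * z + b = 0 := by
  have hne : a * x + b - (a * e + b) ≠ 0 := by
    rcases h with h | h
    · exact ne_of_lt (by linarith)
    · exact ne_of_gt (by linarith)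
  have h01 : 0 ≤ (a * x + b) / (a * x + b - (a * e + b)) ∧
      (a * x + b) / (a * x + b - (a * e + b)) ≤ 1 := by
    rcases h with h | h
    · exact ⟨div_nonneg_of_nonpos (by linarith) (by linarith),
        (div_le_one_of_neg (by linarith)).2 (by linarith)⟩
    · exact ⟨div_nonneg (by linarith) (by linarith),
        (div_le_one (by linarith)).2 (by linarith)⟩
  have hd : (a * x + b) / (a * x + b - (a * e + b)) * (a * x + b - (a * e + b)) = a * x + b :=
    div_mul_cancel₀ _ hne
  generalize (a * x + b) / (a * x + b - (a * e + b)) = θ at *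
  refine ⟨?_, ?_, ?_⟩
  · have := mul_nonneg (sub_nonneg.2 hx) h01.1
    linarith
  · have := mul_le_mul_of_nonneg_left h01.2 (sub_nonneg.2 hx)
    linarith
  · rw [hz]
    linear_combination -hd

theorem affine_nonpos {a b x e z : ℝ} (hx : a * x + b ≤ 0) (he : a * e + b ≤ 0)
    (hz : z ∈ Icc x e) : a * z + b ≤ 0 := by
  rcases le_total 0 a with ha | ha
  · have := mul_le_mul_of_nonneg_left hz.2 ha
    linarith
  · have := mul_le_mul_of_nonpos_left hz.1 ha
    linarith

/-- `hD'` says that a tie at `x` has been decided by the values at `e`. Consequently the piece is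
cut at a crossing only if the two functions differ at `x`. -/
theorem takeF_spec {σ : State} {a b a' b' x e : ℝ} (h14 : σ.real 14 = a) (h15 : σ.real 15 = b)
    (h9 : σ.real 9 = x) (h25 : σ.real 25 = e)
    (h22 : σ.real 22 = a * x + b - (a' * x + b')) (h23 : σ.real 23 = a * e + b - (a' * e + b'))
    (hx : x ≤ e) (hD : a * x + b - (a' * x + b') ≤ 0)
    (hD' : a * x + b - (a' * x + b') = 0 → a * e + b - (a' * e + b') ≤ 0) :
    ∃ z ∈ Icc x e, (takeF.exec σ).real 16 = a ∧ (takeF.exec σ).real 24 = b ∧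
      (takeF.exec σ).real 25 = z ∧ (∀ w ∈ Icc x z, a * w + b ≤ a' * w + b') ∧
      (z = e ∨ (a * x + b ≠ a' * x + b' ∧ a * z + b = a' * z + b')) := by
  by_cases h : 0 < a * e + b - (a' * e + b')
  · have hlt : a * x + b - (a' * x + b') < 0 :=
      lt_of_le_of_ne hD fun h0 => absurd (hD' h0) (not_le.2 h)
    obtain ⟨h1, h2, h3⟩ := cross_spec (a := a - a') (b := b - b') hx
      (Or.inl ⟨by linarith, by linarith⟩) rfl
    have hh : 0 < σ.real 23 := by rw [h23]; exact h
    refine ⟨_, ⟨h1, h2⟩, ?_, ?_, ?_, fun w hw => ?_, Or.inr ⟨fun h0 => ?_, ?_⟩⟩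
    · simp [takeF, minCross, hh, h14]
    · simp [takeF, minCross, hh, h15]
    · have e' : (takeF.exec σ).real 25 = σ.real 9 +
          (σ.real 25 - σ.real 9) * (σ.real 22 / (σ.real 22 - σ.real 23)) := by
        simp [takeF, minCross, hh]
      rw [e', h9, h25, h22, h23, show a * x + b - (a' * x + b') = (a - a') * x + (b - b') by ring,
        show a * e + b - (a' * e + b') = (a - a') * e + (b - b') by ring]
    · have := affine_nonpos (a := a - a') (b := b - b') (by linarith) h3.le hw
      linarith
    · linarith
    · linarith
  · have hh : ¬ 0 < σ.real 23 := by rw [h23]; exact h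
    refine ⟨e, ⟨hx, le_rfl⟩, by simp [takeF, hh, h14], by simp [takeF, hh, h15],
      by simp [takeF, hh, h25], fun w hw => ?_, Or.inl rfl⟩
    have := affine_nonpos (a := a - a') (b := b - b') (by linarith) (by linarith) hw
    linarith

theorem takeG_spec {σ : State} {a b a' b' x e : ℝ} (h14 : σ.real 20 = a) (h15 : σ.real 21 = b)
    (h9 : σ.real 9 = x) (h25 : σ.real 25 = e)
    (h22 : σ.real 22 = a' * x + b' - (a * x + b)) (h23 : σ.real 23 = a' * e + b' - (a * e + b))
    (hx : x ≤ e) (hD : a * x + b - (a' * x + b') ≤ 0)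
    (hD' : a * x + b - (a' * x + b') = 0 → a * e + b - (a' * e + b') ≤ 0) :
    ∃ z ∈ Icc x e, (takeG.exec σ).real 16 = a ∧ (takeG.exec σ).real 24 = b ∧
      (takeG.exec σ).real 25 = z ∧ (∀ w ∈ Icc x z, a * w + b ≤ a' * w + b') ∧
      (z = e ∨ (a' * x + b' ≠ a * x + b ∧ a' * z + b' = a * z + b)) := by
  by_cases h : 0 < a * e + b - (a' * e + b')
  · have hlt : a * x + b - (a' * x + b') < 0 :=
      lt_of_le_of_ne hD fun h0 => absurd (hD' h0) (not_le.2 h)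
    obtain ⟨h1, h2, h3⟩ := cross_spec (a := a' - a) (b := b' - b) hx
      (Or.inr ⟨by linarith, by linarith⟩) rfl
    have hh : σ.real 23 < 0 := by rw [h23]; linarith
    refine ⟨_, ⟨h1, h2⟩, ?_, ?_, ?_, fun w hw => ?_, Or.inr ⟨fun h0 => ?_, ?_⟩⟩
    · simp [takeG, minCross, hh, h14]
    · simp [takeG, minCross, hh, h15]
    · have e' : (takeG.exec σ).real 25 = σ.real 9 +
          (σ.real 25 - σ.real 9) * (σ.real 22 / (σ.real 22 - σ.real 23)) := by
        simp [takeG, minCross, hh]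
      rw [e', h9, h25, h22, h23, show a' * x + b' - (a * x + b) = (a' - a) * x + (b' - b) by ring,
        show a' * e + b' - (a * e + b) = (a' - a) * e + (b' - b) by ring]
    · have := affine_nonpos (a := a - a') (b := b - b') (by linarith) (by linarith) hw
      linarith
    · linarith
    · linarith
  · have hh : ¬ σ.real 23 < 0 := by rw [h23]; linarith
    refine ⟨e, ⟨hx, le_rfl⟩, by simp [takeG, hh, h14], by simp [takeG, hh, h15],
      by simp [takeG, hh, h25], fun w hw => ?_, Or.inl rfl⟩
    have := affine_nonpos (a := a - a') (b := b - b') (by linarith) (by linarith) hw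
    linarith

theorem minChoose_spec {σ : State} {a b a' b' x e : ℝ} (h14 : σ.real 14 = a) (h15 : σ.real 15 = b)
    (h20 : σ.real 20 = a') (h21 : σ.real 21 = b') (h9 : σ.real 9 = x) (h25 : σ.real 25 = e)
    (hx : x ≤ e) :
    ∃ z ∈ Icc x e, (minChoose.exec σ).real 25 = z ∧
      (((minChoose.exec σ).real 16 = a ∧ (minChoose.exec σ).real 24 = b ∧
        ∀ w ∈ Icc x z, a * w + b ≤ a' * w + b') ∨
      ((minChoose.exec σ).real 16 = a' ∧ (minChoose.exec σ).real 24 = b' ∧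
        ∀ w ∈ Icc x z, a' * w + b' ≤ a * w + b)) ∧
      (z = e ∨ (a * x + b ≠ a' * x + b' ∧ a * z + b = a' * z + b')) := by
  set D : Prog := .setReal 22 (minDiff 9) ;; .setReal 23 (minDiff 25) with hDdef
  have hexec : minChoose.exec σ = (Prog.branch (.realLt (.reg 22) (.lit 0)) takeF
    (.branch (.realLt (.lit 0) (.reg 22)) takeG
      (.branch (.realLt (.lit 0) (.reg 23)) takeG takeF))).exec (D.exec σ) := rfl
  have k22 : (D.exec σ).real 22 = a * x + b - (a' * x + b') := by
    simp [hDdef, minDiff, h14, h15, h20, h21, h9, h25]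
  have k23 : (D.exec σ).real 23 = a * e + b - (a' * e + b') := by
    simp [hDdef, minDiff, h14, h15, h20, h21, h9, h25]
  have hf := frame_exec (p := D) rfl σ
  rw [hexec]
  generalize D.exec σ = τ at *
  rw [← hf.real 14 rfl] at h14
  rw [← hf.real 15 rfl] at h15
  rw [← hf.real 20 rfl] at h20
  rw [← hf.real 21 rfl] at h21
  rw [← hf.real 9 rfl] at h9
  rw [← hf.real 25 rfl] at h25
  have hF : (a * x + b - (a' * x + b') ≤ 0) →
      (a * x + b - (a' * x + b') = 0 → a * e + b - (a' * e + b') ≤ 0) →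
      ∃ z ∈ Icc x e, (takeF.exec τ).real 25 = z ∧
      (((takeF.exec τ).real 16 = a ∧ (takeF.exec τ).real 24 = b ∧
        ∀ w ∈ Icc x z, a * w + b ≤ a' * w + b') ∨
      ((takeF.exec τ).real 16 = a' ∧ (takeF.exec τ).real 24 = b' ∧
        ∀ w ∈ Icc x z, a' * w + b' ≤ a * w + b)) ∧
      (z = e ∨ (a * x + b ≠ a' * x + b' ∧ a * z + b = a' * z + b')) := fun h1 h2 => by
    obtain ⟨z, hz, e1, e2, e3, e4, e5⟩ := takeF_spec h14 h15 h9 h25 k22 k23 hx h1 h2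
    exact ⟨z, hz, e3, Or.inl ⟨e1, e2, e4⟩, e5⟩
  have hG : (a' * x + b' - (a * x + b) ≤ 0) →
      (a' * x + b' - (a * x + b) = 0 → a' * e + b' - (a * e + b) ≤ 0) →
      ∃ z ∈ Icc x e, (takeG.exec τ).real 25 = z ∧
      (((takeG.exec τ).real 16 = a ∧ (takeG.exec τ).real 24 = b ∧
        ∀ w ∈ Icc x z, a * w + b ≤ a' * w + b') ∨
      ((takeG.exec τ).real 16 = a' ∧ (takeG.exec τ).real 24 = b' ∧
        ∀ w ∈ Icc x z, a' * w + b' ≤ a * w + b)) ∧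
      (z = e ∨ (a * x + b ≠ a' * x + b' ∧ a * z + b = a' * z + b')) := fun h1 h2 => by
    obtain ⟨z, hz, e1, e2, e3, e4, e5⟩ := takeG_spec h20 h21 h9 h25 k22 k23 hx h1 h2
    exact ⟨z, hz, e3, Or.inr ⟨e1, e2, e4⟩, e5⟩
  by_cases c1 : a * x + b - (a' * x + b') < 0
  · rw [exec_branch_pos (by simp only [Test.Holds, RExp.eval, k22]; simpa using c1)]
    exact hF c1.le fun h0 => by linarith
  · rw [exec_branch_neg (by simp only [Test.Holds, RExp.eval, k22]; simpa using c1)]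
    by_cases c2 : 0 < a * x + b - (a' * x + b')
    · rw [exec_branch_pos (by simp only [Test.Holds, RExp.eval, k22]; simpa using c2)]
      exact hG (by linarith) fun h0 => by linarith
    · rw [exec_branch_neg (by simp only [Test.Holds, RExp.eval, k22]; simpa using c2)]
      by_cases c3 : 0 < a * e + b - (a' * e + b')
      · rw [exec_branch_pos (by simp only [Test.Holds, RExp.eval, k23]; simpa using c3)]
        exact hG (by linarith) fun _ => by linarith
      · rw [exec_branch_neg (by simp only [Test.Holds, RExp.eval, k23]; simpa using c3)]
        exact hF (by linarith) fun _ => by linarith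

/-- `x` lies in the piece with number `r` between the critical points `q`. -/
structure PieceAt (q : ℕ → ℝ) (m : ℕ) (B x : ℝ) (r : ℕ) : Prop where
  le : r ≤ m
  mem : r < m → x ∈ Icc (q r) (q (r + 1))
  eq_right : r = m → x = B

theorem PieceAt.start {f : ℝ → ℝ} {A B : ℝ} {m : ℕ} {q s c : ℕ → ℝ}
    (h : PiecewiseLin f A B m q s c) (hm : 0 < m) : PieceAt q m B A 0 :=
  ⟨hm.le, fun _ => ⟨h.left.le, h.left ▸ h.sorted 0 hm⟩, fun h => by omega⟩

theorem PieceAt.advance {f : ℝ → ℝ} {A B : ℝ} {m : ℕ} {q s c : ℕ → ℝ}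
    (h : PiecewiseLin f A B m q s c) {x z : ℝ} {r : ℕ} (hx : PieceAt q m B x r) (hr : r < m)
    (hz : z ∈ Icc x (q (r + 1))) : PieceAt q m B z (if z < q (r + 1) then r else r + 1) := by
  split_ifs with hlt
  · exact ⟨hr.le, fun _ => ⟨(hx.mem hr).1.trans hz.1, hz.2⟩, fun h => by omega⟩
  · have e := le_antisymm hz.2 (not_lt.1 hlt)
    exact ⟨hr, fun h' => ⟨e.ge, e ▸ h.sorted _ h'⟩, fun h' => by rw [e, h', h.right]⟩

/-- The bound `2 * (mF + mG) + 1` leaves room for a crossing before each of the at most `mF + mG`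
events at which pieces end. -/
theorem minProg_spec : ∃ K : ℕ, ∀ (σ : State) (F G : ℝ → ℝ) (A B : ℝ) (N bF mF bG mG h : ℕ),
    mF + mG ≤ N → 0 < mF → 0 < mG → bF + mF < h → bG + mG < h → σ.nat 5 = h →
    σ.nat 11 = bF → σ.nat 12 = mF → σ.nat 13 = bG → σ.nat 14 = mG →
    σ.Stores F A B bF mF → σ.Stores G A B bG mG →
    HaltsWithin minProg (K * N) σ fun σ' => ∃ m, σ'.nat 10 = m ∧ 0 < m ∧
      m ≤ 2 * (mF + mG) + 1 ∧ σ'.Stores (fun x => min (F x) (G x)) A B h m ∧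
      State.AgreeBelow h σ σ' := by
  refine ⟨minInit.time + 4 * ((Test.and (.natLt (.reg 15) (.reg 12))
    (.natLt (.reg 16) (.reg 14))).cost + 1 + minBody.time), ?_⟩
  intro σ F G A B N bF mF bG mG h hN hmF hmG hbF hbG h5 h11 h12 h13 h14 hF hG
  have hF0 : σ.realArr 7 bF = A := hF.left
  refine HaltsWithin.mono (HaltsWithin.seq (haltsWithin_exec (p := minInit) rfl
    (Q := fun σ' => σ'.nat 15 = 0 ∧ σ'.nat 16 = 0 ∧ σ'.nat 10 = 0 ∧ σ'.real 9 = A ∧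
      σ'.realArr 7 h = A ∧ State.AgreeBelow h σ σ') ?_) fun σ₀ hf hQ => HaltsWithin.mono
      (haltsWithin_loop rfl
      (fun τ μ => ∃ r s m x, τ.nat 15 = r ∧ τ.nat 16 = s ∧ τ.nat 10 = m ∧ τ.real 9 = x ∧
        PieceAt (fun t => σ.realArr 7 (bF + t)) mF B x r ∧
        PieceAt (fun t => σ.realArr 7 (bG + t)) mG B x s ∧
        τ.Stores (fun x => min (F x) (G x)) A x h m ∧ m + μ ≤ 2 * (mF + mG) + 1 ∧
        (μ = 2 * (mF - r + (mG - s)) + 1 ∨ (μ = 2 * (mF - r + (mG - s)) ∧ F x = G x)) ∧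
        (m = 0 → r = 0 ∧ s = 0) ∧ State.AgreeBelow h σ τ) ?_ (2 * (mF + mG) + 1)
      ⟨0, 0, 0, A, hQ.1, hQ.2.1, hQ.2.2.1, hQ.2.2.2.1, PieceAt.start hF hmF, PieceAt.start hG hmG,
        PiecewiseLin.nil _ hQ.2.2.2.2.1, by omega, Or.inl rfl, fun _ => ⟨rfl, rfl⟩,
        hQ.2.2.2.2.2⟩) le_rfl ?_) ?_ fun _ h => h
  · refine ⟨by simp [minInit], by simp [minInit], by simp [minInit], by simp [minInit, h11, hF0],
      by simp [minInit, h5, h11, hF0], fun t ht => by simp [minInit, h5, show t ≠ h by omega]⟩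
  · rintro τ μ hf' ⟨r, s, m, x, h15, h16, h10, h9, hr, hs, hS, hmμ, hμ, hm0, hag⟩ hb
    have e5 : τ.nat 5 = h := by rw [hf'.nat 5 rfl, hf.nat 5 rfl, h5]
    have e11 : τ.nat 11 = bF := by rw [hf'.nat 11 rfl, hf.nat 11 rfl, h11]
    have e12 : τ.nat 12 = mF := by rw [hf'.nat 12 rfl, hf.nat 12 rfl, h12]
    have e13 : τ.nat 13 = bG := by rw [hf'.nat 13 rfl, hf.nat 13 rfl, h13]
    have e14 : τ.nat 14 = mG := by rw [hf'.nat 14 rfl, hf.nat 14 rfl, h14]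
    obtain ⟨hrm, hsm⟩ : r < mF ∧ s < mG := by simpa [h15, h16, e12, e14] using hb
    have hFr := hF.linear r hrm
    have hGs := hG.linear s hsm
    have hσF := hF.slope_nonneg r hrm
    have hσG := hG.slope_nonneg s hsm
    have qF := (hag (bF + (r + 1)) (by omega)).1
    have qG := (hag (bG + (s + 1)) (by omega)).1
    have aF := (hag (bF + r) (by omega)).2
    have aG := (hag (bG + s) (by omega)).2
    beta_reduce at hFr hGs hσF hσG
    have xF := hr.mem hrm
    have xG := hs.mem hsm
    beta_reduce at xF xG
    set pF := σ.realArr 7 (bF + (r + 1)) with hpF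
    set pG := σ.realArr 7 (bG + (s + 1)) with hpG
    have hxe : x ≤ min pG pF := le_min xG.2 xF.2
    rw [show minBody.exec τ = minAdvance.exec (emit.exec (minChoose.exec (minLoad.exec τ))) from rfl]
    have f1 := frame_exec (p := minLoad) rfl τ
    have b14 : (minLoad.exec τ).real 14 = σ.realArr 8 (bF + r) := by
      by_cases hc : pG < pF <;> simp [minLoad, e11, e13, h15, h16, qF, qG, aF, hc]
    have b15 : (minLoad.exec τ).real 15 = σ.realArr 9 (bF + r) := by
      by_cases hc : pG < pF <;> simp [minLoad, e11, e13, h15, h16, qF, qG, aF, hc]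
    have b20 : (minLoad.exec τ).real 20 = σ.realArr 8 (bG + s) := by
      by_cases hc : pG < pF <;> simp [minLoad, e11, e13, h15, h16, qF, qG, aG, hc]
    have b21 : (minLoad.exec τ).real 21 = σ.realArr 9 (bG + s) := by
      by_cases hc : pG < pF <;> simp [minLoad, e11, e13, h15, h16, qF, qG, aG, hc]
    have b25 : (minLoad.exec τ).real 25 = min pG pF := by
      by_cases hc : pG < pF
      · simp [minLoad, e11, e13, h15, h16, qF, qG, hc, min_eq_left hc.le]
      · simp [minLoad, e11, e13, h15, h16, qF, qG, hc, min_eq_right (not_lt.1 hc)]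
    generalize minLoad.exec τ = τ₁ at *
    have f2 := frame_exec (p := minChoose) rfl τ₁
    obtain ⟨z, hz, c25, hline, hend⟩ :=
      minChoose_spec b14 b15 b20 b21 (by rw [f1.real 9 rfl, h9]) b25 hxe
    generalize minChoose.exec τ₁ = τ₂ at *
    have hzF : z ≤ pF := hz.2.trans (min_le_right _ _)
    have hzG : z ≤ pG := hz.2.trans (min_le_left _ _)
    have f3 := frame_exec (p := emit) rfl τ₂
    have hag2 : State.AgreeBelow (h + m + 1) τ τ₂ :=
      (State.AgreeBelow.of_frame f1 rfl _).trans (State.AgreeBelow.of_frame f2 rfl _)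
    obtain ⟨d1, d2, d3⟩ := emit_spec (σ := τ₂) (h := h) (m := m) (α := x)
      (f := fun x => min (F x) (G x)) (A := A)
      (by rw [f2.nat 5 rfl, f1.nat 5 rfl, e5]) (by rw [f2.nat 10 rfl, f1.nat 10 rfl, h10])
      (hS.agree hag2 (by omega)) (by rw [c25]; exact hz.1)
      (by rcases hline with h | h <;> rw [h.1] <;> assumption) (by
        intro w hw
        rw [c25] at hw
        have w1 := hFr w ⟨xF.1.trans hw.1, hw.2.trans hzF⟩
        have w2 := hGs w ⟨xG.1.trans hw.1, hw.2.trans hzG⟩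
        rcases hline with ⟨l1, l2, l3⟩ | ⟨l1, l2, l3⟩
        · rw [l1, l2, w1, w2]; exact min_eq_left (l3 w hw)
        · rw [l1, l2, w1, w2]; exact min_eq_right (l3 w hw))
    rw [c25] at d1
    have hag3 : State.AgreeBelow h σ (emit.exec τ₂) :=
      (hag.trans (hag2.mono (by omega))).trans d3
    have g11 : (emit.exec τ₂).nat 11 = bF := by
      rw [f3.nat 11 rfl, f2.nat 11 rfl, f1.nat 11 rfl, e11]
    have g13 : (emit.exec τ₂).nat 13 = bG := by
      rw [f3.nat 13 rfl, f2.nat 13 rfl, f1.nat 13 rfl, e13]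
    have g15 : (emit.exec τ₂).nat 15 = r := by
      rw [f3.nat 15 rfl, f2.nat 15 rfl, f1.nat 15 rfl, h15]
    have g16 : (emit.exec τ₂).nat 16 = s := by
      rw [f3.nat 16 rfl, f2.nat 16 rfl, f1.nat 16 rfl, h16]
    have g25 : (emit.exec τ₂).real 25 = z := by rw [f3.real 25 rfl, c25]
    have gF := (hag3 (bF + (r + 1)) (by omega)).1
    have gG := (hag3 (bG + (s + 1)) (by omega)).1
    rw [← hpF] at gF
    rw [← hpG] at gG
    generalize emit.exec τ₂ = τ₃ at *
    have f4 := frame_exec (p := minAdvance) rfl τ₃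
    have k15 : (minAdvance.exec τ₃).nat 15 = if z < pF then r else r + 1 := by
      by_cases c1 : z < pF <;> by_cases c2 : z < pG <;>
        simp [minAdvance, g11, g13, g15, g16, g25, gF, gG, c1, c2]
    have k16 : (minAdvance.exec τ₃).nat 16 = if z < pG then s else s + 1 := by
      by_cases c1 : z < pF <;> by_cases c2 : z < pG <;>
        simp [minAdvance, g11, g13, g15, g16, g25, gF, gG, c1, c2]
    have k9 : (minAdvance.exec τ₃).real 9 = z := by
      by_cases c1 : z < pF <;> by_cases c2 : z < pG <;>
        simp [minAdvance, g11, g13, g15, g16, g25, gF, gG, c1, c2]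
    have hag4 : ∀ b, State.AgreeBelow b τ₃ (minAdvance.exec τ₃) :=
      fun b => State.AgreeBelow.of_frame f4 rfl b
    have kr := hr.advance hF hrm (z := z) ⟨hz.1, hzF⟩
    have ks := hs.advance hG hsm (z := z) ⟨hz.1, hzG⟩
    simp only [← hpF] at kr
    simp only [← hpG] at ks
    have k10 : (minAdvance.exec τ₃).nat 10 = m + 1 := by rw [f4.nat 10 rfl, d2]
    generalize minAdvance.exec τ₃ = τ₄ at *
    have base : ∀ μ', μ' < μ →
        (μ' = 2 * (mF - (if z < pF then r else r + 1) + (mG - (if z < pG then s else s + 1))) + 1 ∨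
        (μ' = 2 * (mF - (if z < pF then r else r + 1) + (mG - (if z < pG then s else s + 1))) ∧
          F z = G z)) → ∃ μ' < μ, ∃ r s m x, τ₄.nat 15 = r ∧ τ₄.nat 16 = s ∧ τ₄.nat 10 = m ∧
        τ₄.real 9 = x ∧
        PieceAt (fun t => σ.realArr 7 (bF + t)) mF B x r ∧
        PieceAt (fun t => σ.realArr 7 (bG + t)) mG B x s ∧
        τ₄.Stores (fun x => min (F x) (G x)) A x h m ∧ m + μ' ≤ 2 * (mF + mG) + 1 ∧
        (μ' = 2 * (mF - r + (mG - s)) + 1 ∨ (μ' = 2 * (mF - r + (mG - s)) ∧ F x = G x)) ∧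
        (m = 0 → r = 0 ∧ s = 0) ∧ State.AgreeBelow h σ τ₄ := fun μ' h1 h2 =>
      ⟨μ', h1, _, _, m + 1, z, k15, k16, k10, k9, kr, ks, d1.agree (hag4 (h + (m + 1) + 1)) (by omega),
        by omega, h2, fun h => by omega, hag3.trans (hag4 h)⟩
    -- If a piece ends at `z`, the doubled number of remaining pieces drops by at least two.
    -- Otherwise `z` is a crossing; the functions differed at `x` and agree at `z`, so the extra
    -- unit of the potential is spent and no second crossing can follow before a piece ends.
    by_cases hze : z = min pG pF
    · refine base _ ?_ (Or.inl rfl)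
      rcases min_choice pG pF with hc | hc
      · rw [hc] at hze
        rw [if_neg (show ¬ z < pG from hze ▸ lt_irrefl _)]
        split_ifs <;> omega
      · rw [hc] at hze
        rw [if_neg (show ¬ z < pF from hze ▸ lt_irrefl _)]
        split_ifs <;> omega
    · obtain ⟨n1, n2⟩ := hend.resolve_left hze
      have hlt := lt_min_iff.1 (lt_of_le_of_ne hz.2 hze)
      have x1 := hFr x xF
      have x2 := hGs x xG
      have w1 := hFr z ⟨xF.1.trans hz.1, hzF⟩
      have w2 := hGs z ⟨xG.1.trans hz.1, hzG⟩
      refine base (2 * (mF - r + (mG - s))) ?_ (Or.inr ⟨?_, by rw [w1, w2, n2]⟩)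
      · rcases hμ with h | h
        · omega
        · rw [x1, x2] at h
          exact absurd h.2 n1
      · rw [if_pos hlt.1, if_pos hlt.2]
  · rintro τ ⟨hf', ⟨μ, r, s, m, x, h15, h16, h10, h9, hr, hs, hS, hmμ, hμ, hm0, hag⟩, hb⟩
    have e12 : τ.nat 12 = mF := by rw [hf'.nat 12 rfl, hf.nat 12 rfl, h12]
    have e14 : τ.nat 14 = mG := by rw [hf'.nat 14 rfl, hf.nat 14 rfl, h14]
    have hb' : ¬ (r < mF ∧ s < mG) := by simpa [h15, h16, e12, e14] using hb
    have h1 := hr.le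
    have h2 := hs.le
    obtain rfl : x = B := by
      by_cases h : r = mF
      · exact hr.eq_right h
      · exact hs.eq_right (by omega)
    -- The output is not empty: `m = 0` would mean that no piece has been passed, whereas one of the
    -- two operands is exhausted.
    exact ⟨m, h10, by omega, by omega, hS, hag⟩
  · generalize (Test.and (.natLt (.reg 15) (.reg 12)) (.natLt (.reg 16) (.reg 14))).cost + 1 +
      minBody.time = k at *
    have h1 : minInit.time ≤ minInit.time * N := Nat.le_mul_of_pos_right _ (by omega)
    have h2 : k * (2 * (mF + mG) + 1 + 1) ≤ k * (4 * N) := Nat.mul_le_mul_left _ (by omega)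
    calc _ ≤ minInit.time * N + k * (4 * N) := add_le_add h1 h2
      _ = _ := by ring

end RealRAM

/-! ### One step of the greedy path -/

open Classical in
/-- The phase of the greedy path between two ends of pieces; `p` tells whether `x` is to move
where both can. -/
noncomputable def walkPhase (d u v : ℝ) (p : Prop) : ℕ :=
  if d < u - v ∨ d < v - u then 2 else if (p ∧ u - v = d) ∨ (¬ p ∧ v - u = d) then 0 else 1

theorem walkPhase_le (d u v : ℝ) (p : Prop) : walkPhase d u v p ≤ 2 := by
  unfold walkPhase
  split_ifs <;> omega

theorem walkPhase_swap (d u v : ℝ) (p : Prop) : walkPhase d v u (¬ p) = walkPhase d u v p := by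
  unfold walkPhase
  split_ifs <;> first | rfl | (exfalso; tauto)

/-- A move that the limit stops before the end of its piece arrives at a border of the band `|u - v|
≤ d`. Coming from outside it leaves phase `2`; coming from inside it reaches the border where both
points move, which is phase `0`. -/
theorem walkPhase_rise {d u v ρ : ℝ} {p : Prop} (hd : 0 ≤ d) (hp : ¬ d < v - u → u - v < d → p)
    (h : riseLimit d u v ρ < ρ) : walkPhase d (u + riseLimit d u v ρ) v p < walkPhase d u v p := by
  unfold riseLimit at *
  split_ifs at h ⊢ with h1 h2
  · rw [walkPhase, walkPhase, if_pos (Or.inr h1), if_neg]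
    · split_ifs <;> omega
    · rintro (h' | h') <;> linarith
  · have := hp h1 h2
    rw [walkPhase, walkPhase, if_neg, if_pos (Or.inl ⟨this, by ring⟩), if_neg, if_neg]
    · omega
    · rintro (h' | h')
      · linarith [h'.2]
      · exact h'.1 this
    · rintro (h' | h') <;> linarith
    · rintro (h' | h') <;> linarith
  · exact absurd h (lt_irrefl _)

/-- A bound on the number of steps that the greedy path has still to make. -/
noncomputable def walkMeasure (d : ℝ) (m m' : ℕ) (S S' : ℕ → ℝ) (u v : ℝ) (r s : ℕ) : ℕ :=
  3 * (m - r + (m' - s)) + walkPhase d u v (r < m ∧ (s = m' ∨ S r ≤ S' s))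

structure WalkStep (f g : ℝ → ℝ) (d a₁ a₂ b₁ b₂ : ℝ) (m : ℕ) (p S : ℕ → ℝ) (m' : ℕ)
    (p' S' : ℕ → ℝ) (x y : ℝ) (r s : ℕ) (x' y' : ℝ) (r' s' : ℕ) (κ : ℝ) : Prop where
  f_eq : f x' = f x + S r * (x' - x)
  g_eq : g y' = g y + S' s * (y' - y)
  optimal : OptimalStep f g d a₁ a₂ b₁ b₂ x y x' y' κ
  inv : PathInv f g d a₁ a₂ b₁ b₂ m p S m' p' S' x' y' r' s'
  measure_lt : walkMeasure d m m' S S' (f x') (g y') r' s' < walkMeasure d m m' S S' (f x) (g y) r s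

section Walk

variable {f g : ℝ → ℝ} {d a₁ a₂ b₁ b₂ : ℝ} {m m' : ℕ} {p S C p' S' C' : ℕ → ℝ} {x y : ℝ}
  {r s : ℕ}

open Classical in
/-- Where `x` goes, when it moves towards the end `e` of its piece of slope `σ`. -/
noncomputable def slideTo (d u v x e σ : ℝ) : ℝ :=
  if riseLimit d u v (σ * (e - x)) < σ * (e - x) then x + riseLimit d u v (σ * (e - x)) / σ else e

open Classical in
noncomputable def slidePiece (d u v x e σ : ℝ) (r : ℕ) : ℕ :=
  if riseLimit d u v (σ * (e - x)) < σ * (e - x) then r else r + 1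

/-- The point moves to the end of its piece or to where the rate changes, whichever comes first; in
the first case a piece is finished, in the second the phase drops. -/
theorem PathInv.slide (h : PathInv f g d a₁ a₂ b₁ b₂ m p S m' p' S' x y r s)
    (hF : ConvexLin f a₁ a₂ m p S C) (hG : ConvexLin g b₁ b₂ m' p' S' C') (ha : a₁ ≤ a₂)
    (hb : b₁ ≤ b₂) (hd : 0 ≤ d) (hr : r < m)
    (hmode : s = m' ∨ d < g y - f x ∨
      (f x - g y ≤ d ∧ S r ≤ S' s ∧ (f x - g y < d ∨ S r = 0))) {q : Prop}
    (hq : ¬ d < g y - f x → f x - g y < d → q) {e : ℝ} (he : e = p (r + 1)) :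
    f (slideTo d (f x) (g y) x e (S r)) = f x + S r * (slideTo d (f x) (g y) x e (S r) - x) ∧
    OptimalStep f g d a₁ a₂ b₁ b₂ x y (slideTo d (f x) (g y) x e (S r)) y
      (pathSlope d (f x) (g y) (S r)) ∧
    PathInv f g d a₁ a₂ b₁ b₂ m p S m' p' S' (slideTo d (f x) (g y) x e (S r)) y
      (slidePiece d (f x) (g y) x e (S r) r) s ∧
    (slidePiece d (f x) (g y) x e (S r) r = r + 1 ∨
      (slidePiece d (f x) (g y) x e (S r) r = r ∧
        walkPhase d (f (slideTo d (f x) (g y) x e (S r))) (g y) q <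
          walkPhase d (f x) (g y) q)) := by
  subst he
  have hx := h.x_mem hr
  have hσ := hF.slope_nonneg r hr
  unfold slideTo slidePiece
  set ρ := S r * (p (r + 1) - x) with hρ
  split_ifs with hlt
  · have hl : 0 ≤ riseLimit d (f x) (g y) ρ := by
      unfold riseLimit at hlt ⊢
      split_ifs at hlt ⊢ <;> linarith
    -- On a flat piece the rise is `0`, which cannot exceed the nonnegative limit.
    have hσ' : 0 < S r := by
      rcases hσ.lt_or_eq with h0 | h0
      · exact h0
      · rw [← h0, zero_mul] at hρ
        linarith
    have e1 : S r * (riseLimit d (f x) (g y) ρ / S r) = riseLimit d (f x) (g y) ρ :=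
      mul_div_cancel₀ _ hσ'.ne'
    have hxx : x + riseLimit d (f x) (g y) ρ / S r ∈ Icc x (p (r + 1)) := by
      refine ⟨by linarith [div_nonneg hl hσ], ?_⟩
      have : riseLimit d (f x) (g y) ρ / S r ≤ p (r + 1) - x := by
        rw [div_le_iff₀ hσ', mul_comm]
        exact hlt.le
      linarith
    obtain ⟨k1, k2, k3⟩ := h.step_x hF hG ha hb hd hr hmode hxx (ρ := ρ)
      (by rw [add_sub_cancel_left, e1])
    refine ⟨k1, k2, k3, Or.inr ⟨rfl, ?_⟩⟩
    rw [k1, add_sub_cancel_left, e1]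
    exact walkPhase_rise hd hq hlt
  · obtain ⟨k1, k2, k3⟩ := h.step_x hF hG ha hb hd hr hmode ⟨hx.2, le_rfl⟩ (ρ := ρ)
      (not_lt.1 hlt)
    exact ⟨k1, k2, k3.advance hF hr rfl, Or.inl rfl⟩

theorem PathInv.walk_x (h : PathInv f g d a₁ a₂ b₁ b₂ m p S m' p' S' x y r s)
    (hF : ConvexLin f a₁ a₂ m p S C) (hG : ConvexLin g b₁ b₂ m' p' S' C') (ha : a₁ ≤ a₂)
    (hb : b₁ ≤ b₂) (hd : 0 ≤ d) (hr : r < m)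
    (hmode : s = m' ∨ d < g y - f x ∨
      (f x - g y ≤ d ∧ S r ≤ S' s ∧ (f x - g y < d ∨ S r = 0))) {e : ℝ} (he : e = p (r + 1)) :
    WalkStep f g d a₁ a₂ b₁ b₂ m p S m' p' S' x y r s (slideTo d (f x) (g y) x e (S r)) y
      (slidePiece d (f x) (g y) x e (S r) r) s (pathSlope d (f x) (g y) (S r)) := by
  obtain ⟨k1, k2, k3, k4⟩ := h.slide hF hG ha hb hd hr hmode
    (q := r < m ∧ (s = m' ∨ S r ≤ S' s)) (fun h1 h2 => ⟨hr, by tauto⟩) he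
  refine ⟨k1, by ring, k2, k3, ?_⟩
  unfold walkMeasure
  rcases k4 with k4 | ⟨k4, k5⟩
  -- A finished piece lowers the first term of the measure by `3`, while the new phase is at most
  -- `2`.
  · rw [k4]
    have := walkPhase_le d (f (slideTo d (f x) (g y) x e (S r))) (g y)
      (r + 1 < m ∧ (s = m' ∨ S (r + 1) ≤ S' s))
    omega
  · rw [k4]
    omega

/-- The mirror image of `PathInv.walk_x`. Ties between the slopes are broken in favour of `x`, in
accordance with the phase; this is why `S' s < S r` is strict. -/
theorem PathInv.walk_y (h : PathInv f g d a₁ a₂ b₁ b₂ m p S m' p' S' x y r s)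
    (hF : ConvexLin f a₁ a₂ m p S C) (hG : ConvexLin g b₁ b₂ m' p' S' C') (ha : a₁ ≤ a₂)
    (hb : b₁ ≤ b₂) (hd : 0 ≤ d) (hs : s < m')
    (hmode : r = m ∨ d < f x - g y ∨
      (g y - f x ≤ d ∧ S' s < S r ∧ (g y - f x < d ∨ S' s = 0))) {e : ℝ} (he : e = p' (s + 1)) :
    WalkStep f g d a₁ a₂ b₁ b₂ m p S m' p' S' x y r s x (slideTo d (g y) (f x) y e (S' s))
      r (slidePiece d (g y) (f x) y e (S' s) s) (pathSlope d (g y) (f x) (S' s)) := by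
  obtain ⟨k1, k2, k3, k4⟩ := h.swap.slide hG hF hb ha hd hs
    (hmode.imp_right (Or.imp_right fun h => ⟨h.1, h.2.1.le, h.2.2⟩))
    (q := ¬ (r < m ∧ (s = m' ∨ S r ≤ S' s))) (fun h1 h2 => by
      rintro ⟨h3, h4⟩
      rcases h4 with h4 | h4
      · omega
      · rcases hmode with h5 | h5 | h5
        · omega
        · exact h1 h5
        · exact absurd h4 (not_le.2 h5.2.1)) he
  refine ⟨by ring, k1, k2.swap, k3.swap, ?_⟩
  unfold walkMeasure
  rcases k4 with k4 | ⟨k4, k5⟩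
  · rw [k4]
    have := walkPhase_le d (f x) (g (slideTo d (g y) (f x) y e (S' s)))
      (r < m ∧ (s + 1 = m' ∨ S r ≤ S' (s + 1)))
    omega
  · rw [k4]
    rw [walkPhase_swap, walkPhase_swap] at k5
    omega

/-- The rises are equal, so the piece with the smaller remaining rise is finished, and the other
point moves by this rise divided by its slope. -/
theorem PathInv.walk_both (h : PathInv f g d a₁ a₂ b₁ b₂ m p S m' p' S' x y r s)
    (hF : ConvexLin f a₁ a₂ m p S C) (hG : ConvexLin g b₁ b₂ m' p' S' C') (ha : a₁ ≤ a₂)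
    (hb : b₁ ≤ b₂) (hd : 0 ≤ d) (hr : r < m) (hs : s < m')
    (hmode : (f x - g y = d ∧ 0 < S r ∧ S r ≤ S' s) ∨ (g y - f x = d ∧ 0 < S' s ∧ S' s ≤ S r)) :
    (S' s * (p' (s + 1) - y) < S r * (p (r + 1) - x) →
      WalkStep f g d a₁ a₂ b₁ b₂ m p S m' p' S' x y r s
        (x + S' s * (p' (s + 1) - y) / S r) (p' (s + 1)) r (s + 1)
        (S r * S' s / (S r + S' s))) ∧
    (S r * (p (r + 1) - x) ≤ S' s * (p' (s + 1) - y) →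
      WalkStep f g d a₁ a₂ b₁ b₂ m p S m' p' S' x y r s
        (p (r + 1)) (y + S r * (p (r + 1) - x) / S' s) (r + 1) s
        (S r * S' s / (S r + S' s))) := by
  have hx := h.x_mem hr
  have hy := h.y_mem hs
  have hσ : 0 < S r := by
    rcases hmode with h | h
    · exact h.2.1
    · exact h.2.1.trans_le h.2.2
  have hτ : 0 < S' s := by
    rcases hmode with h | h
    · exact h.2.1.trans_le h.2.2
    · exact h.2.1
  have key : ∀ x' ∈ Icc x (p (r + 1)), ∀ y' ∈ Icc y (p' (s + 1)),
      S r * (x' - x) = S' s * (y' - y) →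
      f x' = f x + S r * (x' - x) ∧ g y' = g y + S' s * (y' - y) ∧
      OptimalStep f g d a₁ a₂ b₁ b₂ x y x' y' (S r * S' s / (S r + S' s)) ∧
      PathInv f g d a₁ a₂ b₁ b₂ m p S m' p' S' x' y' r s := by
    intro x' hx' y' hy' hrise
    rcases hmode with h1 | h1
    · obtain ⟨k1, k2, k3, k4⟩ := h.step_both hF hG ha hb hd hr hs h1.1 h1.2.1 h1.2.2 hx' hy' hrise
      exact ⟨k1, by rw [k2, hrise], k3, k4⟩
    · obtain ⟨k1, k2, k3, k4⟩ :=
        h.swap.step_both hG hF hb ha hd hs hr h1.1 h1.2.1 h1.2.2 hy' hx' hrise.symm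
      refine ⟨by rw [k2, hrise], k1, ?_, k4.swap⟩
      rw [mul_comm (S r), add_comm (S r)]
      exact k3.swap
  constructor
  · intro hlt
    have e1 : S r * (S' s * (p' (s + 1) - y) / S r) = S' s * (p' (s + 1) - y) :=
      mul_div_cancel₀ _ hσ.ne'
    have h1 : S' s * (p' (s + 1) - y) / S r ≤ p (r + 1) - x := by
      rw [div_le_iff₀ hσ, mul_comm _ (S r)]
      exact hlt.le
    have h2 := div_nonneg (mul_nonneg hτ.le (sub_nonneg.2 hy.2)) hσ.le
    obtain ⟨k1, k2, k3, k4⟩ := key (x + S' s * (p' (s + 1) - y) / S r)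
      ⟨by linarith, by linarith⟩ _ ⟨hy.2, le_rfl⟩ (by rw [add_sub_cancel_left, e1])
    refine ⟨k1, k2, k3, (k4.swap.advance hG hs rfl).swap, ?_⟩
    unfold walkMeasure
    have := walkPhase_le d (f (x + S' s * (p' (s + 1) - y) / S r)) (g (p' (s + 1)))
      (r < m ∧ (s + 1 = m' ∨ S r ≤ S' (s + 1)))
    omega
  · intro hle
    have e1 : S' s * (S r * (p (r + 1) - x) / S' s) = S r * (p (r + 1) - x) :=
      mul_div_cancel₀ _ hτ.ne'
    have h1 : S r * (p (r + 1) - x) / S' s ≤ p' (s + 1) - y := by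
      rw [div_le_iff₀ hτ, mul_comm _ (S' s)]
      exact hle
    have h2 := div_nonneg (mul_nonneg hσ.le (sub_nonneg.2 hx.2)) hτ.le
    obtain ⟨k1, k2, k3, k4⟩ := key _ ⟨hx.2, le_rfl⟩ (y + S r * (p (r + 1) - x) / S' s)
      ⟨by linarith, by linarith⟩ (by rw [add_sub_cancel_left, e1])
    refine ⟨k1, k2, k3, k4.advance hF hr rfl, ?_⟩
    unfold walkMeasure
    have := walkPhase_le d (f (p (r + 1))) (g (y + S r * (p (r + 1) - x) / S' s))
      (r + 1 < m ∧ (s = m' ∨ S (r + 1) ≤ S' s))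
    omega

end Walk

namespace RealRAM

attribute [local simp] Prog.exec NExp.eval RExp.eval Test.Holds store_apply Function.update_apply

/-! ### The program for the greedy path -/

def maxWith (r : ℕ) (e : RExp) : Prog := .branch (.realLt (.reg r) e) (.setReal r e) .skip

theorem maxWith_spec (σ : State) (r : ℕ) (e : RExp) :
    ((maxWith r e).exec σ).real r = max (σ.real r) (e.eval σ) := by
  by_cases h : σ.real r < e.eval σ
  · simp [maxWith, h, max_eq_right h.le]
  · simp [maxWith, h, max_eq_left (not_lt.1 h)]

def walkStart : Prog :=
  .setNat 15 (.lit 0) ;; .setNat 16 (.lit 0) ;; .setNat 10 (.lit 0) ;;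
  .setReal 9 (.read 7 (.reg 11)) ;; .setReal 10 (.read 7 (.reg 13)) ;;
  .setReal 11 (.add (.mul (.read 8 (.reg 11)) (.reg 9)) (.read 9 (.reg 11))) ;;
  .setReal 12 (.add (.mul (.read 8 (.reg 13)) (.reg 10)) (.read 9 (.reg 13))) ;;
  .writeReal 7 (.reg 5) (.add (.reg 9) (.reg 10))

def walkInit : Prog :=
  walkStart ;; .setReal 13 (.reg 11) ;; maxWith 13 (.reg 12) ;;
  maxWith 13 (.div (.add (.add (.reg 11) (.reg 12)) (.reg 8)) (.lit 2))

/-- Load the slopes and the ends of the current pieces. -/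
def walkLoad : Prog :=
  .setReal 14 (.read 8 (.add (.reg 11) (.reg 15))) ;;
  .setReal 15 (.read 8 (.add (.reg 13) (.reg 16))) ;;
  .setReal 20 (.read 7 (.add (.reg 11) (.add (.reg 15) (.lit 1)))) ;;
  .setReal 21 (.read 7 (.add (.reg 13) (.add (.reg 16) (.lit 1)))) ;;
  .setReal 18 (.reg 9) ;; .setReal 19 (.reg 10)

def rate (u v σ x e : ℕ) : Prog :=
  .branch (.realLt (.reg 8) (.sub (.reg v) (.reg u)))
    (.setReal 16 (.lit 0) ;; .setReal 17 (.sub (.sub (.reg v) (.reg 8)) (.reg u)))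
    (.branch (.realLt (.sub (.reg u) (.reg v)) (.reg 8))
      (.setReal 16 (.div (.reg σ) (.lit 2)) ;;
        .setReal 17 (.sub (.add (.reg v) (.reg 8)) (.reg u)))
      (.setReal 16 (.reg σ) ;; .setReal 17 (.mul (.reg σ) (.sub (.reg e) (.reg x)))))

/-- Move one of the two points; `u` and `v` are the registers of the values, `σ` and `e` those of
the slope and the end of the piece, `x` and `x'` those of the old and the new point, and `r` that
of the number of the piece. -/
def slide (u v σ x e x' r : ℕ) : Prog :=
  rate u v σ x e ;;
  .branch (.realLt (.reg 17) (.mul (.reg σ) (.sub (.reg e) (.reg x))))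
    (.setReal x' (.add (.reg x) (.div (.reg 17) (.reg σ))))
    (.setReal x' (.reg e) ;; .setNat r (.add (.reg r) (.lit 1)))

def slideX : Prog := slide 11 12 14 9 20 18 15

def slideY : Prog := slide 12 11 15 10 21 19 16

def riseX : RExp := .mul (.reg 14) (.sub (.reg 20) (.reg 9))

def riseY : RExp := .mul (.reg 15) (.sub (.reg 21) (.reg 10))

def moveBoth : Prog :=
  .setReal 16 (.div (.mul (.reg 14) (.reg 15)) (.add (.reg 14) (.reg 15))) ;;
  .branch (.realLt riseY riseX)
    (.setReal 18 (.add (.reg 9) (.div riseY (.reg 14))) ;; .setReal 19 (.reg 21) ;;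
      .setNat 16 (.add (.reg 16) (.lit 1)))
    (.setReal 18 (.reg 20) ;; .setReal 19 (.add (.reg 10) (.div riseX (.reg 15))) ;;
      .setNat 15 (.add (.reg 15) (.lit 1)))

def walkMove : Prog :=
  .branch (.natLt (.reg 15) (.reg 12))
    (.branch (.natLt (.reg 16) (.reg 14))
      (.branch (.realLt (.reg 8) (.sub (.reg 12) (.reg 11))) slideX
        (.branch (.realLt (.reg 8) (.sub (.reg 11) (.reg 12))) slideY
          (.branch (.realLt (.reg 15) (.reg 14))
            (.branch (.realLt (.sub (.reg 12) (.reg 11)) (.reg 8)) slideY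
              (.branch (.realEq (.reg 15) (.lit 0)) slideY moveBoth))
            (.branch (.realLt (.sub (.reg 11) (.reg 12)) (.reg 8)) slideX
              (.branch (.realEq (.reg 14) (.lit 0)) slideX moveBoth)))))
      slideX)
    slideY

def walkPiece : Prog :=
  .setReal 24 (.sub (.reg 13) (.mul (.reg 16) (.add (.reg 9) (.reg 10)))) ;;
  .setReal 25 (.add (.reg 18) (.reg 19))

def walkUpdate : Prog :=
  .setReal 13 (.add (.reg 13) (.mul (.reg 16) (.add (.sub (.reg 18) (.reg 9))
    (.sub (.reg 19) (.reg 10))))) ;;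
  .setReal 11 (.add (.reg 11) (.mul (.reg 14) (.sub (.reg 18) (.reg 9)))) ;;
  .setReal 12 (.add (.reg 12) (.mul (.reg 15) (.sub (.reg 19) (.reg 10)))) ;;
  .setReal 9 (.reg 18) ;; .setReal 10 (.reg 19)

def walkBody : Prog := walkLoad ;; walkMove ;; walkPiece ;; emit ;; walkUpdate

/-- The minimum over the ways to divide a weight of the balance of the two functions whose places
and sizes are held by the integer registers `11`, `12` and `13`, `14`; the real register `8` holds
the offset. The result is stored at the place given by the integer register `5`, and its size is
held by the register `10`. -/
def walkProg : Prog :=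
  walkInit ;;
  .loop (.not (.and (.not (.natLt (.reg 15) (.reg 12))) (.not (.natLt (.reg 16) (.reg 14)))))
    walkBody

/-- The inequalities between register numbers ensure that the results of `rate`, in the registers
`16` and `17`, overwrite nothing that is still to be read, and are not overwritten too early. -/
theorem slide_spec {τ : State} {u v σ x e x' r : ℕ} (hx : x ≠ 16 ∧ x ≠ 17) (he : e ≠ 16 ∧ e ≠ 17)
    (hσ : σ ≠ 16 ∧ σ ≠ 17) (hx' : x' ≠ 16) (huv : u ≠ 16 ∧ v ≠ 16) {d U V X E S : ℝ} {n : ℕ} (h8 : τ.real 8 = d)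
    (hu : τ.real u = U) (hv : τ.real v = V) (hX : τ.real x = X) (hE : τ.real e = E)
    (hS : τ.real σ = S) (hr : τ.nat r = n) :
    ((slide u v σ x e x' r).exec τ).real x' = slideTo d U V X E S ∧
    ((slide u v σ x e x' r).exec τ).real 16 = pathSlope d U V S ∧
    ((slide u v σ x e x' r).exec τ).nat r = slidePiece d U V X E S n := by
  have hrate : ((rate u v σ x e).exec τ).real 16 = pathSlope d U V S ∧
      ((rate u v σ x e).exec τ).real 17 = riseLimit d U V (S * (E - X)) ∧
      ((rate u v σ x e).exec τ).real x = X ∧ ((rate u v σ x e).exec τ).real e = E ∧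
      ((rate u v σ x e).exec τ).real σ = S ∧ ((rate u v σ x e).exec τ).nat r = n := by
    unfold pathSlope riseLimit
    by_cases h1 : d < V - U
    · simp [rate, h8, hu, hv, hX, hE, hS, hr, h1, hx, he, hσ, huv]
    · by_cases h2 : U - V < d
      · simp [rate, h8, hu, hv, hX, hE, hS, hr, h1, h2, hx, he, hσ, huv]
      · simp [rate, h8, hu, hv, hX, hE, hS, hr, h1, h2, hx, he, hσ, huv]
  unfold slide
  rw [Prog.exec]
  generalize (rate u v σ x e).exec τ = τ' at *
  obtain ⟨k16, k17, kx, ke, kσ, kr⟩ := hrate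
  unfold slideTo slidePiece
  by_cases h : riseLimit d U V (S * (E - X)) < S * (E - X)
  · simp [k17, kx, ke, kσ, kr, k16, h, hx'.symm]
  · simp [k17, kx, ke, kσ, kr, k16, h, hx'.symm]

/-- The registers in which the state of the greedy path is kept. -/
structure State.Walk (τ : State) (d x y u v σ σ' e e' : ℝ) (r s : ℕ) : Prop where
  real8 : τ.real 8 = d
  real9 : τ.real 9 = x
  real10 : τ.real 10 = y
  real11 : τ.real 11 = u
  real12 : τ.real 12 = v
  real14 : τ.real 14 = σ
  real15 : τ.real 15 = σ'
  real18 : τ.real 18 = x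
  real19 : τ.real 19 = y
  real20 : τ.real 20 = e
  real21 : τ.real 21 = e'
  nat15 : τ.nat 15 = r
  nat16 : τ.nat 16 = s

/-- The registers that describe a step of the greedy path. -/
structure State.Moved (τ : State) (x' y' κ : ℝ) (r' s' : ℕ) : Prop where
  real18 : τ.real 18 = x'
  real19 : τ.real 19 = y'
  real16 : τ.real 16 = κ
  nat15 : τ.nat 15 = r'
  nat16 : τ.nat 16 = s'

section

variable {τ : State} {d x y u v σ σ' e e' : ℝ} {r s : ℕ}

theorem slideX_spec (h : τ.Walk d x y u v σ σ' e e' r s) :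
    (slideX.exec τ).Moved (slideTo d u v x e σ) y (pathSlope d u v σ)
      (slidePiece d u v x e σ r) s := by
  obtain ⟨k1, k2, k3⟩ := slide_spec (τ := τ) (x' := 18) (r := 15) (x := 9) (e := 20) (σ := 14)
    (u := 11) (v := 12) (by decide) (by decide) (by decide) (by decide) (by decide) h.real8 h.real11 h.real12 h.real9 h.real20 h.real14 h.nat15
  have f := frame_exec (p := slideX) rfl τ
  exact ⟨k1, by rw [f.real 19 rfl, h.real19], k2, k3, by rw [f.nat 16 rfl, h.nat16]⟩

theorem slideY_spec (h : τ.Walk d x y u v σ σ' e e' r s) :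
    (slideY.exec τ).Moved x (slideTo d v u y e' σ') (pathSlope d v u σ') r
      (slidePiece d v u y e' σ' s) := by
  obtain ⟨k1, k2, k3⟩ := slide_spec (τ := τ) (x' := 19) (r := 16) (x := 10) (e := 21) (σ := 15)
    (u := 12) (v := 11) (by decide) (by decide) (by decide) (by decide) (by decide) h.real8 h.real12 h.real11 h.real10 h.real21 h.real15 h.nat16
  have f := frame_exec (p := slideY) rfl τ
  exact ⟨by rw [f.real 18 rfl, h.real18], k1, k2, by rw [f.nat 15 rfl, h.nat15], k3⟩

theorem moveBoth_spec (h : τ.Walk d x y u v σ σ' e e' r s) :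
    (σ' * (e' - y) < σ * (e - x) → (moveBoth.exec τ).Moved (x + σ' * (e' - y) / σ) e'
      (σ * σ' / (σ + σ')) r (s + 1)) ∧
    (¬ σ' * (e' - y) < σ * (e - x) → (moveBoth.exec τ).Moved e (y + σ * (e - x) / σ')
      (σ * σ' / (σ + σ')) (r + 1) s) := by
  obtain ⟨_, h2, h3, h4, h5, h6, h7, h8, h9, h10, h11, h12, h13⟩ := h
  constructor
  · intro hlt
    constructor <;> simp [moveBoth, riseX, riseY, *]
  · intro hlt
    constructor <;> simp [moveBoth, riseX, riseY, *]

/-- The tests separate exactly the cases of `PathInv.walk_x`, `PathInv.walk_y` and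
`PathInv.walk_both`. Both points move only if the smaller slope is positive, which makes the
divisions legitimate. -/
theorem walkMove_spec {f g : ℝ → ℝ} {a₁ a₂ b₁ b₂ : ℝ} {m m' : ℕ} {p S C p' S' C' : ℕ → ℝ}
    (h : τ.Walk d x y (f x) (g y) (S r) (S' s) (p (r + 1)) (p' (s + 1)) r s)
    (h12 : τ.nat 12 = m) (h14 : τ.nat 14 = m')
    (hI : PathInv f g d a₁ a₂ b₁ b₂ m p S m' p' S' x y r s) (hF : ConvexLin f a₁ a₂ m p S C)
    (hG : ConvexLin g b₁ b₂ m' p' S' C') (ha : a₁ ≤ a₂) (hb : b₁ ≤ b₂) (hd : 0 ≤ d)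
    (hrs : r < m ∨ s < m') :
    ∃ x' y' r' s' κ, (walkMove.exec τ).Moved x' y' κ r' s' ∧
      WalkStep f g d a₁ a₂ b₁ b₂ m p S m' p' S' x y r s x' y' r' s' κ := by
  have hX : walkMove.exec τ = slideX.exec τ → r < m → (s = m' ∨ d < g y - f x ∨
      (f x - g y ≤ d ∧ S r ≤ S' s ∧ (f x - g y < d ∨ S r = 0))) →
      ∃ x' y' r' s' κ, (walkMove.exec τ).Moved x' y' κ r' s' ∧
        WalkStep f g d a₁ a₂ b₁ b₂ m p S m' p' S' x y r s x' y' r' s' κ := fun he hr hmode =>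
    ⟨_, _, _, _, _, he ▸ slideX_spec h, hI.walk_x hF hG ha hb hd hr hmode rfl⟩
  have hY : walkMove.exec τ = slideY.exec τ → s < m' → (r = m ∨ d < f x - g y ∨
      (g y - f x ≤ d ∧ S' s < S r ∧ (g y - f x < d ∨ S' s = 0))) →
      ∃ x' y' r' s' κ, (walkMove.exec τ).Moved x' y' κ r' s' ∧
        WalkStep f g d a₁ a₂ b₁ b₂ m p S m' p' S' x y r s x' y' r' s' κ := fun he hs hmode =>
    ⟨_, _, _, _, _, he ▸ slideY_spec h, hI.walk_y hF hG ha hb hd hs hmode rfl⟩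
  have hB : walkMove.exec τ = moveBoth.exec τ → r < m → s < m' →
      ((f x - g y = d ∧ 0 < S r ∧ S r ≤ S' s) ∨ (g y - f x = d ∧ 0 < S' s ∧ S' s ≤ S r)) →
      ∃ x' y' r' s' κ, (walkMove.exec τ).Moved x' y' κ r' s' ∧
        WalkStep f g d a₁ a₂ b₁ b₂ m p S m' p' S' x y r s x' y' r' s' κ := fun he hr hs hmode => by
    rw [he]
    obtain ⟨k1, k2⟩ := hI.walk_both hF hG ha hb hd hr hs hmode
    by_cases hlt : S' s * (p' (s + 1) - y) < S r * (p (r + 1) - x)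
    · exact ⟨_, _, _, _, _, (moveBoth_spec h).1 hlt, k1 hlt⟩
    · exact ⟨_, _, _, _, _, (moveBoth_spec h).2 hlt, k2 (not_lt.1 hlt)⟩
  have t1 : (Test.natLt (.reg 15) (.reg 12)).Holds τ ↔ r < m := by simp [h.nat15, h12]
  have t2 : (Test.natLt (.reg 16) (.reg 14)).Holds τ ↔ s < m' := by simp [h.nat16, h14]
  have t3 : (Test.realLt (.reg 8) (.sub (.reg 12) (.reg 11))).Holds τ ↔ d < g y - f x := by
    simp only [Test.Holds, RExp.eval, h.real8, h.real11, h.real12]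
  have t4 : (Test.realLt (.reg 8) (.sub (.reg 11) (.reg 12))).Holds τ ↔ d < f x - g y := by
    simp only [Test.Holds, RExp.eval, h.real8, h.real11, h.real12]
  have t5 : (Test.realLt (.reg 15) (.reg 14)).Holds τ ↔ S' s < S r := by
    simp only [Test.Holds, RExp.eval, h.real14, h.real15]
  have t6 : (Test.realLt (.sub (.reg 12) (.reg 11)) (.reg 8)).Holds τ ↔ g y - f x < d := by
    simp only [Test.Holds, RExp.eval, h.real8, h.real11, h.real12]
  have t7 : (Test.realLt (.sub (.reg 11) (.reg 12)) (.reg 8)).Holds τ ↔ f x - g y < d := by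
    simp only [Test.Holds, RExp.eval, h.real8, h.real11, h.real12]
  have t8 : (Test.realEq (.reg 15) (.lit 0)).Holds τ ↔ S' s = 0 := by simp [h.real15]
  have t9 : (Test.realEq (.reg 14) (.lit 0)).Holds τ ↔ S r = 0 := by simp [h.real14]
  rw [walkMove] at hX hY hB ⊢
  by_cases hr : r < m
  · rw [exec_branch_pos (t1.2 hr)] at hX hY hB ⊢
    have hS := hF.slope_nonneg r hr
    by_cases hs : s < m'
    · rw [exec_branch_pos (t2.2 hs)] at hX hY hB ⊢
      have hS' := hG.slope_nonneg s hs
      by_cases c1 : d < g y - f x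
      · rw [exec_branch_pos (t3.2 c1)] at hX ⊢
        exact hX rfl hr (Or.inr (Or.inl c1))
      rw [exec_branch_neg (mt t3.1 c1)] at hX hY hB ⊢
      by_cases c2 : d < f x - g y
      · rw [exec_branch_pos (t4.2 c2)] at hY ⊢
        exact hY rfl hs (Or.inr (Or.inl c2))
      rw [exec_branch_neg (mt t4.1 c2)] at hX hY hB ⊢
      by_cases c3 : S' s < S r
      · rw [exec_branch_pos (t5.2 c3)] at hX hY hB ⊢
        by_cases c4 : g y - f x < d
        · rw [exec_branch_pos (t6.2 c4)] at hY ⊢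
          exact hY rfl hs (Or.inr (Or.inr ⟨not_lt.1 c1, c3, Or.inl c4⟩))
        rw [exec_branch_neg (mt t6.1 c4)] at hY hB ⊢
        by_cases c5 : S' s = 0
        · rw [exec_branch_pos (t8.2 c5)] at hY ⊢
          exact hY rfl hs (Or.inr (Or.inr ⟨not_lt.1 c1, c3, Or.inr c5⟩))
        rw [exec_branch_neg (mt t8.1 c5)] at hB ⊢
        exact hB rfl hr hs (Or.inr ⟨le_antisymm (not_lt.1 c1) (not_lt.1 c4),
          lt_of_le_of_ne hS' (Ne.symm c5), c3.le⟩)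
      · rw [exec_branch_neg (mt t5.1 c3)] at hX hY hB ⊢
        by_cases c4 : f x - g y < d
        · rw [exec_branch_pos (t7.2 c4)] at hX ⊢
          exact hX rfl hr (Or.inr (Or.inr ⟨not_lt.1 c2, not_lt.1 c3, Or.inl c4⟩))
        rw [exec_branch_neg (mt t7.1 c4)] at hX hB ⊢
        by_cases c5 : S r = 0
        · rw [exec_branch_pos (t9.2 c5)] at hX ⊢
          exact hX rfl hr (Or.inr (Or.inr ⟨not_lt.1 c2, not_lt.1 c3, Or.inr c5⟩))
        rw [exec_branch_neg (mt t9.1 c5)] at hB ⊢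
        exact hB rfl hr hs (Or.inl ⟨le_antisymm (not_lt.1 c2) (not_lt.1 c4),
          lt_of_le_of_ne hS (Ne.symm c5), not_lt.1 c3⟩)
    · rw [exec_branch_neg (mt t2.1 hs)] at hX ⊢
      exact hX rfl hr (Or.inl (le_antisymm hI.s_le (not_lt.1 hs)))
  · rw [exec_branch_neg (mt t1.1 hr)] at hY ⊢
    exact hY rfl (hrs.resolve_left hr) (Or.inl (le_antisymm hI.r_le (not_lt.1 hr)))

end

end RealRAM

/-! ### Correctness and running time of the greedy path. -/

namespace RealRAM

attribute [local simp] Prog.exec NExp.eval RExp.eval Test.Holds store_apply Function.update_apply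

theorem walkInit_spec {σ : State} {F G : ℝ → ℝ} {d a₁ a₂ b₁ b₂ : ℝ} {bF mF bG mG h : ℕ}
    (hmF : 0 < mF) (hmG : 0 < mG) (h5 : σ.nat 5 = h) (h11 : σ.nat 11 = bF)
    (h13 : σ.nat 13 = bG) (h8 : σ.real 8 = d) (hF : σ.Stores F a₁ a₂ bF mF)
    (hG : σ.Stores G b₁ b₂ bG mG) :
    (walkInit.exec σ).nat 15 = 0 ∧ (walkInit.exec σ).nat 16 = 0 ∧ (walkInit.exec σ).nat 10 = 0 ∧
    (walkInit.exec σ).real 9 = a₁ ∧ (walkInit.exec σ).real 10 = b₁ ∧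
    (walkInit.exec σ).real 11 = F a₁ ∧ (walkInit.exec σ).real 12 = G b₁ ∧
    (walkInit.exec σ).real 13 = balance F G d a₁ b₁ ∧
    (walkInit.exec σ).realArr 7 h = a₁ + b₁ ∧ State.AgreeBelow h σ (walkInit.exec σ) := by
  have hF0 : σ.realArr 7 bF = a₁ := hF.left
  have hG0 : σ.realArr 7 bG = b₁ := hG.left
  have hFa : σ.realArr 8 bF * a₁ + σ.realArr 9 bF = F a₁ :=
    (hF.linear 0 hmF a₁ ⟨hF.left.le, by rw [← hF.left]; exact hF.sorted 0 hmF⟩).symm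
  have hGb : σ.realArr 8 bG * b₁ + σ.realArr 9 bG = G b₁ :=
    (hG.linear 0 hmG b₁ ⟨hG.left.le, by rw [← hG.left]; exact hG.sorted 0 hmG⟩).symm
  set p₁ : Prog := walkStart ;; .setReal 13 (.reg 11) with hp₁
  have hexec : walkInit.exec σ = (maxWith 13 (.div (.add (.add (.reg 11) (.reg 12)) (.reg 8))
    (.lit 2))).exec ((maxWith 13 (.reg 12)).exec (p₁.exec σ)) := rfl
  have k15 : (p₁.exec σ).nat 15 = 0 := by simp [hp₁, walkStart]
  have k16 : (p₁.exec σ).nat 16 = 0 := by simp [hp₁, walkStart]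
  have k10 : (p₁.exec σ).nat 10 = 0 := by simp [hp₁, walkStart]
  have k8 : (p₁.exec σ).real 8 = d := by simp [hp₁, walkStart, h8]
  have k9 : (p₁.exec σ).real 9 = a₁ := by simp [hp₁, walkStart, h11, hF0]
  have k10' : (p₁.exec σ).real 10 = b₁ := by simp [hp₁, walkStart, h13, hG0]
  have k11 : (p₁.exec σ).real 11 = F a₁ := by simp [hp₁, walkStart, h11, hF0, hFa]
  have k12 : (p₁.exec σ).real 12 = G b₁ := by simp [hp₁, walkStart, h13, hG0, hGb]
  have k13 : (p₁.exec σ).real 13 = F a₁ := by simp [hp₁, walkStart, h11, hF0, hFa]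
  have k7 : (p₁.exec σ).realArr 7 h = a₁ + b₁ := by
    simp [hp₁, walkStart, h5, h11, h13, hF0, hG0]
  have kag : State.AgreeBelow h σ (p₁.exec σ) := fun t ht => by
    simp [hp₁, walkStart, h5, show t ≠ h by omega]
  rw [hexec]
  generalize p₁.exec σ = τ at *
  have f1 := frame_exec (p := maxWith 13 (.reg 12)) rfl τ
  have e1 := maxWith_spec τ 13 (.reg 12)
  generalize (maxWith 13 (.reg 12)).exec τ = τ₁ at *
  have f2 := frame_exec (p := maxWith 13 (.div (.add (.add (.reg 11) (.reg 12)) (.reg 8))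
    (.lit 2))) rfl τ₁
  have e2 := maxWith_spec τ₁ 13 (.div (.add (.add (.reg 11) (.reg 12)) (.reg 8)) (.lit 2))
  generalize (maxWith 13 (.div (.add (.add (.reg 11) (.reg 12)) (.reg 8)) (.lit 2))).exec τ₁ = τ₂
    at *
  refine ⟨by rw [f2.nat 15 rfl, f1.nat 15 rfl, k15], by rw [f2.nat 16 rfl, f1.nat 16 rfl, k16],
    by rw [f2.nat 10 rfl, f1.nat 10 rfl, k10], by rw [f2.real 9 rfl, f1.real 9 rfl, k9],
    by rw [f2.real 10 rfl, f1.real 10 rfl, k10'], by rw [f2.real 11 rfl, f1.real 11 rfl, k11],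
    by rw [f2.real 12 rfl, f1.real 12 rfl, k12], ?_, by rw [f2.arr 7 rfl, f1.arr 7 rfl, k7],
    kag.trans ((State.AgreeBelow.of_frame f1 rfl _).trans (State.AgreeBelow.of_frame f2 rfl _))⟩
  rw [e2, e1]
  simp only [RExp.eval, f1.real 11 rfl, f1.real 12 rfl, f1.real 8 rfl, k8, k11, k12, k13, balance]
  norm_num

/-- The invariant of the loop of `walkProg`, with a bound on the number of remaining steps. -/
structure WalkInv (F G : ℝ → ℝ) (d a₁ a₂ b₁ b₂ : ℝ) (mF : ℕ) (p S : ℕ → ℝ) (mG : ℕ)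
    (p' S' : ℕ → ℝ) (h : ℕ) (σ τ : State) (μ m r s : ℕ) (x y : ℝ) : Prop where
  nat15 : τ.nat 15 = r
  nat16 : τ.nat 16 = s
  nat10 : τ.nat 10 = m
  real9 : τ.real 9 = x
  real10 : τ.real 10 = y
  real11 : τ.real 11 = F x
  real12 : τ.real 12 = G y
  real13 : τ.real 13 = balance F G d x y
  path : PathInv F G d a₁ a₂ b₁ b₂ mF p S mG p' S' x y r s
  stores : τ.Stores (minBalance F G d a₁ a₂ b₁ b₂) (a₁ + b₁) (x + y) h m
  measure_eq : μ = walkMeasure d mF mG S S' (F x) (G y) r s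
  size : m + μ ≤ 3 * (mF + mG) + 2
  start : m = 0 → r = 0 ∧ s = 0
  agree : State.AgreeBelow h σ τ

/-- `hbF` and `hbG` demand one entry more than a stored function occupies, because an exhausted side
is still loaded. -/
theorem walkBody_spec {σ τ : State} {F G : ℝ → ℝ} {d a₁ a₂ b₁ b₂ : ℝ}
    {bF mF bG mG h μ m r s : ℕ} {x y : ℝ} (hbF : bF + mF + 1 < h)
    (hbG : bG + mG + 1 < h) (h5 : τ.nat 5 = h) (h11 : τ.nat 11 = bF) (h12 : τ.nat 12 = mF)
    (h13 : τ.nat 13 = bG) (h14 : τ.nat 14 = mG) (h8 : τ.real 8 = d) (ha : a₁ ≤ a₂) (hb : b₁ ≤ b₂)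
    (hd : 0 ≤ d) (hF : σ.StoresConvex F a₁ a₂ bF mF) (hG : σ.StoresConvex G b₁ b₂ bG mG)
    (hI : WalkInv F G d a₁ a₂ b₁ b₂ mF (fun t => σ.realArr 7 (bF + t))
      (fun t => σ.realArr 8 (bF + t)) mG (fun t => σ.realArr 7 (bG + t))
      (fun t => σ.realArr 8 (bG + t)) h σ τ μ m r s x y) (hrs : r < mF ∨ s < mG) :
    ∃ μ' < μ, ∃ m r s x y, WalkInv F G d a₁ a₂ b₁ b₂ mF (fun t => σ.realArr 7 (bF + t))
      (fun t => σ.realArr 8 (bF + t)) mG (fun t => σ.realArr 7 (bG + t))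
      (fun t => σ.realArr 8 (bG + t)) h σ (walkBody.exec τ) μ' m r s x y := by
  obtain ⟨h15, h16, h10, h9, h10', h11', h12', h13', hP, hS, hμ, hmμ, hm0, hag⟩ := hI
  have hrm := hP.r_le
  have hsm := hP.s_le
  rw [show walkBody.exec τ = walkUpdate.exec (emit.exec (walkPiece.exec (walkMove.exec
    (walkLoad.exec τ)))) from rfl]
  have f1 := frame_exec (p := walkLoad) rfl τ
  have hW : (walkLoad.exec τ).Walk d x y (F x) (G y) (σ.realArr 8 (bF + r))
      (σ.realArr 8 (bG + s)) (σ.realArr 7 (bF + (r + 1))) (σ.realArr 7 (bG + (s + 1))) r s := by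
    have a1 := hag (bF + r) (by omega)
    have a2 := hag (bG + s) (by omega)
    have a3 := hag (bF + (r + 1)) (by omega)
    have a4 := hag (bG + (s + 1)) (by omega)
    constructor <;> simp [walkLoad, *]
  have e12 : (walkLoad.exec τ).nat 12 = mF := by rw [f1.nat 12 rfl, h12]
  have e14 : (walkLoad.exec τ).nat 14 = mG := by rw [f1.nat 14 rfl, h14]
  generalize walkLoad.exec τ = τ₁ at *
  have f2 := frame_exec (p := walkMove) rfl τ₁
  obtain ⟨x', y', r', s', κ, hM, hstep⟩ := walkMove_spec hW e12 e14 hP hF hG ha hb hd hrs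
  have b8 : (walkMove.exec τ₁).real 8 = d := by rw [f2.real 8 rfl, hW.real8]
  have b9 : (walkMove.exec τ₁).real 9 = x := by rw [f2.real 9 rfl, hW.real9]
  have b10 : (walkMove.exec τ₁).real 10 = y := by rw [f2.real 10 rfl, hW.real10]
  have b11 : (walkMove.exec τ₁).real 11 = F x := by rw [f2.real 11 rfl, hW.real11]
  have b12 : (walkMove.exec τ₁).real 12 = G y := by rw [f2.real 12 rfl, hW.real12]
  have b13 : (walkMove.exec τ₁).real 13 = balance F G d x y := by
    rw [f2.real 13 rfl, f1.real 13 rfl, h13']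
  have b14 : (walkMove.exec τ₁).real 14 = σ.realArr 8 (bF + r) := by
    rw [f2.real 14 rfl, hW.real14]
  have b15 : (walkMove.exec τ₁).real 15 = σ.realArr 8 (bG + s) := by
    rw [f2.real 15 rfl, hW.real15]
  have c5 : (walkMove.exec τ₁).nat 5 = h := by rw [f2.nat 5 rfl, f1.nat 5 rfl, h5]
  have c10 : (walkMove.exec τ₁).nat 10 = m := by rw [f2.nat 10 rfl, f1.nat 10 rfl, h10]
  have hag2 : ∀ b, State.AgreeBelow b τ (walkMove.exec τ₁) := fun b =>
    (State.AgreeBelow.of_frame f1 rfl b).trans (State.AgreeBelow.of_frame f2 rfl b)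
  clear hW e12 e14 f2
  generalize walkMove.exec τ₁ = τ₂ at *
  have f3 := frame_exec (p := walkPiece) rfl τ₂
  -- The intercept of `α ↦ balance F G d x y + κ * (α - (x + y))`.
  have d24 : (walkPiece.exec τ₂).real 24 = balance F G d x y - κ * (x + y) := by
    simp [walkPiece, b13, b9, b10, hM.real16]
  have d25 : (walkPiece.exec τ₂).real 25 = x' + y' := by
    simp [walkPiece, hM.real18, hM.real19]
  have hag3 : ∀ b, State.AgreeBelow b τ (walkPiece.exec τ₂) := fun b =>
    (hag2 b).trans (State.AgreeBelow.of_frame f3 rfl b)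
  generalize walkPiece.exec τ₂ = τ₃ at *
  have f4 := frame_exec (p := emit) rfl τ₃
  have g16 : τ₃.real 16 = κ := by rw [f3.real 16 rfl, hM.real16]
  obtain ⟨l1, l2, l3⟩ := emit_spec (σ := τ₃) (f := minBalance F G d a₁ a₂ b₁ b₂)
    (by rw [f3.nat 5 rfl, c5]) (by rw [f3.nat 10 rfl, c10])
    (hS.agree (hag3 (h + m + 1)) (by omega))
    (by rw [d25]; linarith [hstep.optimal.x_le, hstep.optimal.y_le])
    (by rw [g16]; exact hstep.optimal.slope_nonneg) (fun α hα => by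
      rw [d25] at hα
      rw [hstep.optimal.min_eq α hα, g16, d24]
      ring)
  rw [d25] at l1
  have hag4 : State.AgreeBelow h σ (emit.exec τ₃) := (hag.trans (hag3 h)).trans l3
  generalize emit.exec τ₃ = τ₄ at *
  have f5 := frame_exec (p := walkUpdate) rfl τ₄
  refine ⟨_, hμ ▸ hstep.measure_lt, m + 1, r', s', x', y', ?_, ?_, ?_, ?_, ?_, ?_, ?_, ?_, hstep.inv,
    l1.agree (State.AgreeBelow.of_frame f5 rfl (h + (m + 1) + 1)) (by omega), rfl, ?_,
    fun h => by omega, hag4.trans (State.AgreeBelow.of_frame f5 rfl h)⟩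
  · rw [f5.nat 15 rfl, f4.nat 15 rfl, f3.nat 15 rfl, hM.nat15]
  · rw [f5.nat 16 rfl, f4.nat 16 rfl, f3.nat 16 rfl, hM.nat16]
  · rw [f5.nat 10 rfl, l2]
  · simp [walkUpdate, f4.real 18 rfl, f3.real 18 rfl, hM.real18]
  · simp [walkUpdate, f4.real 19 rfl, f3.real 19 rfl, hM.real19]
  · simp [walkUpdate, f4.real 18 rfl, f3.real 18 rfl, hM.real18, f4.real 9 rfl, f3.real 9 rfl, b9,
      f4.real 11 rfl, f3.real 11 rfl, b11, f4.real 14 rfl, f3.real 14 rfl, b14, hstep.f_eq]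
  · simp [walkUpdate, f4.real 19 rfl, f3.real 19 rfl, hM.real19, f4.real 10 rfl, f3.real 10 rfl,
      b10, f4.real 12 rfl, f3.real 12 rfl, b12, f4.real 15 rfl, f3.real 15 rfl, b15, hstep.g_eq]
  · simp [walkUpdate, f4.real 18 rfl, f3.real 18 rfl, hM.real18, f4.real 9 rfl, f3.real 9 rfl, b9,
      f4.real 19 rfl, f3.real 19 rfl, hM.real19, f4.real 10 rfl, f3.real 10 rfl, b10,
      f4.real 13 rfl, f3.real 13 rfl, b13, f4.real 16 rfl, g16, hstep.optimal.balance_eq]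
  · have := hstep.measure_lt
    omega

/-- The measure is at most `3 * (mF + mG) + 2` at the start and bounds the number of emitted pieces.
When the loop ends, both sides are exhausted, so the path has arrived at `(a₂, b₂)`. -/
theorem walkProg_spec : ∃ K : ℕ, ∀ (σ : State) (F G : ℝ → ℝ) (d a₁ a₂ b₁ b₂ : ℝ)
    (N bF mF bG mG h : ℕ), mF + mG ≤ N → 0 < mF → 0 < mG → bF + mF + 1 < h → bG + mG + 1 < h →
    σ.nat 5 = h → σ.nat 11 = bF → σ.nat 12 = mF → σ.nat 13 = bG → σ.nat 14 = mG → σ.real 8 = d →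
    a₁ ≤ a₂ → b₁ ≤ b₂ → 0 ≤ d → σ.StoresConvex F a₁ a₂ bF mF → σ.StoresConvex G b₁ b₂ bG mG →
    HaltsWithin walkProg (K * N) σ fun σ' => ∃ m, σ'.nat 10 = m ∧ 0 < m ∧
      m ≤ 3 * (mF + mG) + 2 ∧
      σ'.Stores (minBalance F G d a₁ a₂ b₁ b₂) (a₁ + b₁) (a₂ + b₂) h m ∧
      State.AgreeBelow h σ σ' := by
  refine ⟨walkInit.time + 5 * ((Test.not (.and (.not (.natLt (.reg 15) (.reg 12)))
    (.not (.natLt (.reg 16) (.reg 14))))).cost + 1 + walkBody.time), ?_⟩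
  intro σ F G d a₁ a₂ b₁ b₂ N bF mF bG mG h hN hmF hmG hbF hbG h5 h11 h12 h13 h14 h8 ha hb hd hF hG
  have hstart := pathInv_start (d := d) hF.stores hG.stores hmF hmG
  obtain ⟨q1, q2, q3, q4, q5, q6, q7, q8, q9, q10⟩ :=
    walkInit_spec hmF hmG h5 h11 h13 h8 hF.stores hG.stores
  have hle : walkMeasure d mF mG (fun t => σ.realArr 8 (bF + t)) (fun t => σ.realArr 8 (bG + t))
      (F a₁) (G b₁) 0 0 ≤ 3 * (mF + mG) + 2 := by
    exact add_le_add (by omega) (walkPhase_le _ _ _ _)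
  refine HaltsWithin.mono (HaltsWithin.seq (haltsWithin_exec (p := walkInit) rfl
    (Q := fun σ' => σ' = walkInit.exec σ) rfl) fun σ₀ hf hQ => HaltsWithin.mono
      (haltsWithin_loop rfl (fun τ μ => ∃ m r s x y, WalkInv F G d a₁ a₂ b₁ b₂ mF
        (fun t => σ.realArr 7 (bF + t)) (fun t => σ.realArr 8 (bF + t)) mG
        (fun t => σ.realArr 7 (bG + t)) (fun t => σ.realArr 8 (bG + t)) h σ τ μ m r s x y) ?_ _
      ⟨0, 0, 0, a₁, b₁, hQ ▸ q1, hQ ▸ q2, hQ ▸ q3, hQ ▸ q4, hQ ▸ q5, hQ ▸ q6, hQ ▸ q7, hQ ▸ q8,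
        hstart, PiecewiseLin.nil _ (hQ ▸ q9), rfl, by omega, fun _ => ⟨rfl, rfl⟩, hQ ▸ q10⟩)
      le_rfl ?_) ?_ fun _ h => h
  · rintro τ μ hf' ⟨m, r, s, x, y, hI⟩ hb'
    have e5 : τ.nat 5 = h := by rw [hf'.nat 5 rfl, hf.nat 5 rfl, h5]
    have e11 : τ.nat 11 = bF := by rw [hf'.nat 11 rfl, hf.nat 11 rfl, h11]
    have e12 : τ.nat 12 = mF := by rw [hf'.nat 12 rfl, hf.nat 12 rfl, h12]
    have e13 : τ.nat 13 = bG := by rw [hf'.nat 13 rfl, hf.nat 13 rfl, h13]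
    have e14 : τ.nat 14 = mG := by rw [hf'.nat 14 rfl, hf.nat 14 rfl, h14]
    have e8 : τ.real 8 = d := by rw [hf'.real 8 rfl, hf.real 8 rfl, h8]
    refine walkBody_spec hbF hbG e5 e11 e12 e13 e14 e8 ha hb hd hF hG hI ?_
    have : ¬ (¬ r < mF ∧ ¬ s < mG) := by
      simpa only [Test.Holds, NExp.eval, hI.nat15, hI.nat16, e12, e14] using hb'
    omega
  · rintro τ ⟨hf', ⟨μ, m, r, s, x, y, hI⟩, hb'⟩
    have e12 : τ.nat 12 = mF := by rw [hf'.nat 12 rfl, hf.nat 12 rfl, h12]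
    have e14 : τ.nat 14 = mG := by rw [hf'.nat 14 rfl, hf.nat 14 rfl, h14]
    have : ¬ r < mF ∧ ¬ s < mG := by
      simpa only [Test.Holds, NExp.eval, hI.nat15, hI.nat16, e12, e14, not_not] using hb'
    have h1 := hI.path.r_le
    have h2 := hI.path.s_le
    have h3 := hI.start
    obtain rfl := hI.path.x_end (by omega)
    obtain rfl := hI.path.y_end (by omega)
    exact ⟨m, hI.nat10, by omega, by linarith [hI.size], hI.stores, hI.agree⟩
  · generalize (Test.not (.and (.not (.natLt (.reg 15) (.reg 12)))
      (.not (.natLt (.reg 16) (.reg 14))))).cost + 1 + walkBody.time = k at *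
    have h1 : walkInit.time ≤ walkInit.time * N := Nat.le_mul_of_pos_right _ (by omega)
    -- Neither function is empty, so `2 ≤ mF + mG ≤ N`, and the additive constants fit into `5 * N`.
    refine le_trans (add_le_add h1 (Nat.mul_le_mul_left k
      (show _ ≤ 5 * N from ?_))) (le_of_eq (by ring))
    omega

end RealRAM

namespace RealRAM

attribute [local simp] Prog.exec NExp.eval RExp.eval Test.Holds store_apply Function.update_apply

/-! ### The program for the two chains -/

/-- The state still holds the input in the registers and arrays where `input` stores it. -/
structure State.HasInput (σ : State) (P : PathNet) (R : WeightRanges P.n) (i j k : ℕ)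
    (B : WeightBox) : Prop where
  nat : ∀ r < 4, σ.nat r = (input P R i j k B).nat r
  real : ∀ r < 4, σ.real r = (input P R i j k B).real r
  arr : ∀ a < 4, σ.realArr a = (input P R i j k B).realArr a

theorem State.HasInput.of_frame {p : Prog} {σ τ : State} {P : PathNet} {R : WeightRanges P.n}
    {i j k : ℕ} {B : WeightBox} (h : σ.HasInput P R i j k B) (hf : Frame p σ τ)
    (hp : ∀ r < 4, p.setsNat r = false ∧ p.setsReal r = false ∧ p.writesTo r = false) :
    τ.HasInput P R i j k B :=
  ⟨fun r hr => (hf.nat r (hp r hr).1).trans (h.nat r hr),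
    fun r hr => (hf.real r (hp r hr).2.1).trans (h.real r hr),
    fun r hr => (hf.arr r (hp r hr).2.2).trans (h.arr r hr)⟩

/-- Load the weight of the vertex given by the integer register `17` into the real register
`16`. -/
def loadWeight : Prog :=
  .branch (.natEq (.reg 17) (.reg 1)) (.setReal 16 (.reg 0))
    (.branch (.natEq (.reg 17) (.reg 2)) (.setReal 16 (.reg 2))
      (.branch (.and (.natLt (.reg 1) (.reg 17)) (.natLt (.reg 17) (.reg 2)))
        (.setReal 16 (.read 3 (.reg 17))) (.setReal 16 (.read 2 (.reg 17)))))

def chainStep (edge base : NExp) : Prog :=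
  .setReal 10 (.add (.reg 10) (.reg 16)) ;;
  .writeReal 10 (.add base (.reg 9)) (.reg 9) ;;
  .writeReal 11 (.add base (.reg 9)) (.reg 10) ;;
  .writeReal 12 (.add base (.reg 9)) (.read 1 edge) ;;
  .setReal 9 (.add (.reg 9) (.read 0 edge)) ;;
  .setNat 9 (.add (.reg 9) (.lit 1))

def chainBody (vertex edge base : NExp) : Prog :=
  .setNat 17 vertex ;; loadWeight ;; chainStep edge base

def chainInit : Prog := .setNat 9 (.lit 0) ;; .setReal 9 (.lit 0) ;; .setReal 10 (.lit 0)

/-- Build a chain from the index `base` on; `vertex` and `edge` tell which vertex and edge are the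
next ones, when the integer register `9` counts them. -/
def chainProg (vertex edge base : NExp) : Prog :=
  chainInit ;; .loop (.natLt (.reg 9) (.add (.reg 0) (.lit 1))) (chainBody vertex edge base)

theorem loadWeight_spec {τ : State} {P : PathNet} {R : WeightRanges P.n} {i j k : ℕ}
    {B : WeightBox} (h : τ.HasInput P R i j k B) {t : ℕ} (h17 : τ.nat 17 = t) (ht : t ≤ P.n) :
    (loadWeight.exec τ).real 16 = R.twoVarying i j B.a₁ B.b₁ t := by
  have e1 : τ.nat 1 = i := h.nat 1 (by omega)
  have e2 : τ.nat 2 = j := h.nat 2 (by omega)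
  have e3 : τ.real 0 = B.a₁ := h.real 0 (by omega)
  have e4 : τ.real 2 = B.b₁ := h.real 2 (by omega)
  have e5 : τ.realArr 2 t = R.lo t := by
    rw [h.arr 2 (by omega)]
    exact if_pos (by omega)
  have e6 : τ.realArr 3 t = R.hi t := by
    rw [h.arr 3 (by omega)]
    exact if_pos (by omega)
  unfold WeightRanges.twoVarying
  by_cases c1 : t = i
  · simp [loadWeight, h17, e1, c1, e3]
  by_cases c2 : t = j
  · simp [loadWeight, h17, e1, e2, c1, c2, e4, show ¬ j = i by omega]
  by_cases c3 : i < t ∧ t < j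
  · simp [loadWeight, h17, e1, e2, c1, c2, c3, e6]
  · simp [loadWeight, h17, e1, e2, c1, c2, c3, e5]

/-- One statement for both directions. The round for the last vertex reads an edge that does not
exist; nothing is claimed about the capacity stored and the distance reached there. -/
theorem chainProg_spec {vertex edge base : NExp} {vtx edg : ℕ → ℕ → ℕ} {bas : ℕ → ℕ}
    (hv : ∀ τ : State, vertex.eval τ = vtx (τ.nat 0) (τ.nat 9))
    (he : ∀ τ : State, edge.eval τ = edg (τ.nat 0) (τ.nat 9))
    (hb : ∀ τ : State, base.eval τ = bas (τ.nat 0)) :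
    ∃ K : ℕ, ∀ (σ : State) (P : PathNet) (R : WeightRanges P.n) (i j k : ℕ) (B : WeightBox)
      (C : Chain), σ.HasInput P R i j k B → (∀ t ≤ P.n, vtx P.n t ≤ P.n) →
      (∀ t < P.n, edg P.n t < P.n) →
      (∀ t ≤ P.n, C.X t = ∑ r ∈ Finset.range t, P.len (edg P.n r)) →
      (∀ t ≤ P.n, C.S t = ∑ r ∈ Finset.range (t + 1), R.twoVarying i j B.a₁ B.b₁ (vtx P.n r)) →
      (∀ t < P.n, C.K t = P.cap (edg P.n t)) →
      HaltsWithin (chainProg vertex edge base) (K * (P.n + 1)) σ fun σ' =>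
        σ'.HoldsChain (bas P.n) (P.n + 1) C ∧ ∀ t < bas P.n, σ'.realArr 10 t = σ.realArr 10 t ∧
          σ'.realArr 11 t = σ.realArr 11 t ∧ σ'.realArr 12 t = σ.realArr 12 t := by
  refine ⟨chainInit.time + 2 * ((Test.natLt (.reg 9) (.add (.reg 0) (.lit 1))).cost + 1 +
    (chainBody vertex edge base).time), ?_⟩
  intro σ P R i j k B C hin hvtx hedg hX hS hK
  set b := bas P.n with hbdef
  refine HaltsWithin.mono (HaltsWithin.seq (haltsWithin_exec (p := chainInit) rfl
    (Q := fun σ' => σ'.nat 9 = 0 ∧ σ'.real 9 = 0 ∧ σ'.real 10 = 0)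
    (by simp [chainInit])) fun σ₀ hf hQ => HaltsWithin.mono
      (haltsWithin_loop rfl (fun τ μ => ∃ t, τ.nat 9 = t ∧ μ = P.n + 1 - t ∧ t ≤ P.n + 1 ∧
        (t ≤ P.n → τ.real 9 = C.X t) ∧
        τ.real 10 = ∑ r ∈ Finset.range t, R.twoVarying i j B.a₁ B.b₁ (vtx P.n r) ∧
        (∀ s < t, τ.realArr 10 (b + s) = C.X s ∧ τ.realArr 11 (b + s) = C.S s ∧
          (s < P.n → τ.realArr 12 (b + s) = C.K s)) ∧
        ∀ s < b, τ.realArr 10 s = σ.realArr 10 s ∧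
          τ.realArr 11 s = σ.realArr 11 s ∧ τ.realArr 12 s = σ.realArr 12 s) ?_ (P.n + 1)
      ⟨0, hQ.1, by omega, by omega, fun _ => by rw [hQ.2.1, hX 0 (by omega)]; simp,
        by rw [hQ.2.2]; simp, fun s hs => by omega, fun s hs => ?_⟩)
      le_rfl ?_) ?_ fun _ h => h
  · rintro τ μ hf' ⟨t, h9, hμ, htn, hx, hs, hent, hag⟩ hlt
    have hinτ : τ.HasInput P R i j k B := by
      refine (hin.of_frame hf fun r hr => ?_).of_frame hf' fun r hr => ?_ <;>
      interval_cases r <;> exact ⟨rfl, rfl, rfl⟩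
    have e0 : τ.nat 0 = P.n := hinτ.nat 0 (by omega)
    have ht : t < P.n + 1 := by simpa [h9, e0] using hlt
    rw [show (chainBody vertex edge base).exec τ = (chainStep edge base).exec
      (loadWeight.exec ((Prog.setNat 17 vertex).exec τ)) from rfl]
    have f1 := frame_exec (p := .setNat 17 vertex) rfl τ
    have k17 : ((Prog.setNat 17 vertex).exec τ).nat 17 = vtx P.n t := by simp [hv, e0, h9]
    generalize (Prog.setNat 17 vertex).exec τ = τ₁ at *
    have f2 := frame_exec (p := loadWeight) rfl τ₁
    have k16 := loadWeight_spec (hinτ.of_frame f1 fun r hr => by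
      interval_cases r <;> exact ⟨rfl, rfl, rfl⟩) k17 (hvtx t (by omega))
    generalize loadWeight.exec τ₁ = τ₂ at *
    have k0 : τ₂.nat 0 = P.n := by rw [f2.nat 0 rfl, f1.nat 0 rfl, e0]
    have k9 : τ₂.nat 9 = t := by rw [f2.nat 9 rfl, f1.nat 9 rfl, h9]
    have r9 : τ₂.real 9 = τ.real 9 := by rw [f2.real 9 rfl, f1.real 9 rfl]
    have r10 : τ₂.real 10 = τ.real 10 := by rw [f2.real 10 rfl, f1.real 10 rfl]
    have a0 : τ₂.realArr 0 = table P.n P.len := by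
      rw [f2.arr 0 rfl, f1.arr 0 rfl]; exact hinτ.arr 0 (by omega)
    have a1 : τ₂.realArr 1 = table P.n P.cap := by
      rw [f2.arr 1 rfl, f1.arr 1 rfl]; exact hinτ.arr 1 (by omega)
    have a10 : τ₂.realArr 10 = τ.realArr 10 := by rw [f2.arr 10 rfl, f1.arr 10 rfl]
    have a11 : τ₂.realArr 11 = τ.realArr 11 := by rw [f2.arr 11 rfl, f1.arr 11 rfl]
    have a12 : τ₂.realArr 12 = τ.realArr 12 := by rw [f2.arr 12 rfl, f1.arr 12 rfl]
    have hsum : τ.real 10 + τ₂.real 16 =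
        ∑ r ∈ Finset.range (t + 1), R.twoVarying i j B.a₁ B.b₁ (vtx P.n r) := by
      rw [Finset.sum_range_succ, hs, k16]
    have b10 : ∀ s, ((chainStep edge base).exec τ₂).realArr 10 s =
        if s = b + t then C.X t else τ.realArr 10 s := fun s => by
      simp [chainStep, hb, k0, k9, ← hbdef, r9, a10, hx (by omega)]
    have b11 : ∀ s, ((chainStep edge base).exec τ₂).realArr 11 s =
        if s = b + t then C.S t else τ.realArr 11 s := fun s => by
      simp [chainStep, hb, k0, k9, ← hbdef, r10, a11, hsum, hS t (by omega)]
    have b12 : ∀ s, ((chainStep edge base).exec τ₂).realArr 12 s =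
        if s = b + t then table P.n P.cap (edg P.n t) else τ.realArr 12 s := fun s => by
      simp [chainStep, hb, he, k0, k9, ← hbdef, a1, a12]
    refine ⟨_, ?_, t + 1, by simp [chainStep, k9], rfl, by omega, fun htn' => ?_, ?_,
      fun s hst => ?_, fun s hsb => ?_⟩
    · omega
    · rw [hX _ htn', Finset.sum_range_succ, ← hX t (by omega), ← hx (by omega)]
      simp [chainStep, hb, he, k0, k9, r9, a0, table, hedg t (by omega)]
    · rw [← hsum]
      simp [chainStep, r10]
    · rw [b10, b11, b12]
      by_cases hst' : s = t
      · subst hst'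
        rw [if_pos rfl, if_pos rfl, if_pos rfl]
        refine ⟨rfl, rfl, fun h => ?_⟩
        rw [hK s h]
        exact if_pos (hedg s h)
      · rw [if_neg (by omega), if_neg (by omega), if_neg (by omega)]
        exact hent s (by omega)
    · rw [b10, b11, b12, if_neg (by omega), if_neg (by omega), if_neg (by omega)]
      exact hag s hsb
  · rw [hf.arr 10 rfl, hf.arr 11 rfl, hf.arr 12 rfl]
    exact ⟨rfl, rfl, rfl⟩
  · rintro τ ⟨hf', ⟨μ, t, h9, hμ, htn, hx, hs, hent, hag⟩, hlt⟩
    have e0 : τ.nat 0 = P.n := by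
      rw [hf'.nat 0 rfl, hf.nat 0 rfl]; exact hin.nat 0 (by omega)
    have ht : ¬ t < P.n + 1 := by simpa [h9, e0] using hlt
    exact ⟨⟨fun s h => (hent s (by omega)).1, fun s h => (hent s (by omega)).2.1,
      fun s h => (hent s (by omega)).2.2 (by omega)⟩, hag⟩
  · generalize (Test.natLt (.reg 9) (.add (.reg 0) (.lit 1))).cost + 1 +
      (chainBody vertex edge base).time = k at *
    have h1 : chainInit.time ≤ chainInit.time * (P.n + 1) := Nat.le_mul_of_pos_right _ (by omega)
    refine le_trans (add_le_add h1 (Nat.mul_le_mul_left k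
      (show _ ≤ 2 * (P.n + 1) by omega))) (le_of_eq (by ring))

/-- The state holds the input, and the chains to the left and to the right. -/
structure State.Prepared (σ : State) (P : PathNet) (R : WeightRanges P.n) (i j k : ℕ)
    (B : WeightBox) : Prop where
  input : σ.HasInput P R i j k B
  left : σ.HoldsChain 0 (P.n + 1) (leftChain P R i j B)
  right : σ.HoldsChain (P.n + 1) (P.n + 1) (rightChain P R i j B)

theorem State.HoldsChain.of_arr {σ τ : State} {b N : ℕ} {C : Chain} (h : σ.HoldsChain b N C)
    (h10 : τ.realArr 10 = σ.realArr 10) (h11 : τ.realArr 11 = σ.realArr 11)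
    (h12 : τ.realArr 12 = σ.realArr 12) : τ.HoldsChain b N C :=
  ⟨by rw [h10]; exact h.X, by rw [h11]; exact h.S, by rw [h12]; exact h.K⟩

theorem State.Prepared.of_frame {p : Prog} {σ τ : State} {P : PathNet} {R : WeightRanges P.n}
    {i j k : ℕ} {B : WeightBox} (h : σ.Prepared P R i j k B) (hf : Frame p σ τ)
    (hp : ∀ r < 4, p.setsNat r = false ∧ p.setsReal r = false ∧ p.writesTo r = false)
    (hp' : p.writesTo 10 = false ∧ p.writesTo 11 = false ∧ p.writesTo 12 = false) :
    τ.Prepared P R i j k B :=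
  ⟨h.input.of_frame hf hp,
    h.left.of_arr (hf.arr 10 hp'.1) (hf.arr 11 hp'.2.1) (hf.arr 12 hp'.2.2),
    h.right.of_arr (hf.arr 10 hp'.1) (hf.arr 11 hp'.2.1) (hf.arr 12 hp'.2.2)⟩

def leftProg : Prog := chainProg (.reg 9) (.reg 9) (.lit 0)

def rightProg : Prog :=
  chainProg (.sub (.reg 0) (.reg 9)) (.sub (.sub (.reg 0) (.lit 1)) (.reg 9))
    (.add (.reg 0) (.lit 1))

theorem pos_sub_eq_sum (P : PathNet) {t : ℕ} (ht : t ≤ P.n) :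
    P.pos P.n - P.pos (P.n - t) = ∑ r ∈ Finset.range t, P.len (P.n - 1 - r) := by
  induction t with
  | zero => simp
  | succ t ih =>
    rw [Finset.sum_range_succ, ← ih (by omega)]
    have := P.pos_succ (P.n - (t + 1))
    rw [show P.n - (t + 1) + 1 = P.n - t by omega, show P.n - (t + 1) = P.n - 1 - t by omega]
      at this
    rw [show P.n - (t + 1) = P.n - 1 - t by omega]
    linarith

theorem total_eq_sum (w : ℕ → ℝ) {n t : ℕ} (ht : t ≤ n) :
    PathNet.total w (n - t) n = ∑ r ∈ Finset.range (t + 1), w (n - r) := by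
  induction t with
  | zero => simp [PathNet.total]
  | succ t ih =>
    rw [Finset.sum_range_succ, ← ih (by omega), PathNet.total, PathNet.total,
      show n - t = n - (t + 1) + 1 by omega, ← Finset.insert_Icc_add_one_left_eq_Icc (show n - (t + 1) ≤ n by omega),
      Finset.sum_insert (by simp), add_comm]

theorem prepare_spec : ∃ K : ℕ, ∀ (P : PathNet) (R : WeightRanges P.n) (i j k : ℕ)
    (B : WeightBox), HaltsWithin (leftProg ;; rightProg) (K * (P.n + 1)) (input P R i j k B)
      fun σ => σ.Prepared P R i j k B := by
  obtain ⟨K₁, h₁⟩ := chainProg_spec (vertex := .reg 9) (edge := .reg 9) (base := .lit 0)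
    (vtx := fun _ t => t) (edg := fun _ t => t) (bas := fun _ => 0) (fun _ => rfl) (fun _ => rfl)
    fun _ => rfl
  obtain ⟨K₂, h₂⟩ := chainProg_spec (vertex := .sub (.reg 0) (.reg 9))
    (edge := .sub (.sub (.reg 0) (.lit 1)) (.reg 9)) (base := .add (.reg 0) (.lit 1))
    (vtx := fun n t => n - t) (edg := fun n t => n - 1 - t) (bas := fun n => n + 1)
    (fun _ => rfl) (fun _ => rfl) fun _ => rfl
  refine ⟨K₁ + K₂, fun P R i j k B => ?_⟩
  have hin : (input P R i j k B).HasInput P R i j k B :=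
    ⟨fun _ _ => rfl, fun _ _ => rfl, fun _ _ => rfl⟩
  refine HaltsWithin.mono (HaltsWithin.seq (h₁ _ P R i j k B (leftChain P R i j B) hin
    (fun t ht => ht) (fun t ht => ht) (fun t _ => rfl) (fun t _ => ?_) (fun t _ => rfl))
    fun σ hf hQ => ?_) (add_mul K₁ K₂ (P.n + 1)).ge fun _ h => h
  · rw [Finset.range_eq_Ico]
    rfl
  · have hin' : σ.HasInput P R i j k B := hin.of_frame hf fun r hr => by
      interval_cases r <;> exact ⟨rfl, rfl, rfl⟩
    refine (h₂ σ P R i j k B (rightChain P R i j B) hin' (fun t ht => by omega)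
      (fun t ht => by omega) (fun t ht => pos_sub_eq_sum P ht)
      (fun t ht => total_eq_sum _ ht) (fun t _ => rfl)).frame.mono le_rfl ?_
    rintro τ ⟨hf', h3, h4⟩
    refine ⟨hin'.of_frame hf' fun r hr => ?_, ⟨fun t ht => ?_, fun t ht => ?_, fun t ht => ?_⟩, h3⟩
    · interval_cases r <;> exact ⟨rfl, rfl, rfl⟩
    · rw [(h4 _ (by omega)).1]; exact hQ.1.X t ht
    · rw [(h4 _ (by omega)).2.1]; exact hQ.1.S t ht
    · rw [(h4 _ (by omega)).2.2]; exact hQ.1.K t ht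

end RealRAM

namespace RealRAM

attribute [local simp] Prog.exec NExp.eval RExp.eval Test.Holds store_apply Function.update_apply

theorem HaltsWithin.exec_seq {p q : Prog} {T : ℕ} {σ : State} {Q : State → Prop}
    (hp : p.loopFree = true) (h : HaltsWithin q T (p.exec σ) Q) :
    HaltsWithin (p ;; q) (p.time + T) σ Q :=
  HaltsWithin.seq (haltsWithin_exec hp (Q := fun σ' => σ' = p.exec σ) rfl) fun _ _ e => e ▸ h

/-! ### The program for one position of the sink -/

def sideInit (count base v : NExp) (y : RExp) (lo hi : ℕ) : Prog :=
  .setNat 6 count ;; .setNat 7 base ;; .setNat 8 v ;; .setReal 4 y ;; .setReal 5 (.reg lo) ;;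
  .setReal 6 (.reg hi)

/-- The evacuation time from one side as a function of the varying weight. -/
def sideProg (count base v : NExp) (y : RExp) (lo hi : ℕ) : Prog :=
  sideInit count base v y lo hi ;; linesProg ;; envProg

/-- The values of the expressions are known in prepared states only, so the assignments are followed
one at a time; none of them touches the input or the chains. -/
theorem sideInit_spec {count base v : NExp} {y : RExp} {lo hi : ℕ} {σ : State} {P : PathNet}
    {R : WeightRanges P.n} {i j k : ℕ} {B : WeightBox} {c b v' : ℕ} {z A A' : ℝ}
    (hσ : σ.Prepared P R i j k B) (hev : ∀ τ : State, τ.Prepared P R i j k B →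
      count.eval τ = c ∧ base.eval τ = b ∧ v.eval τ = v' ∧ y.eval τ = z ∧ τ.real lo = A ∧
        τ.real hi = A') :
    ((sideInit count base v y lo hi).exec σ).nat 6 = c ∧
    ((sideInit count base v y lo hi).exec σ).nat 7 = b ∧
    ((sideInit count base v y lo hi).exec σ).nat 8 = v' ∧
    ((sideInit count base v y lo hi).exec σ).real 4 = z ∧
    ((sideInit count base v y lo hi).exec σ).real 5 = A ∧
    ((sideInit count base v y lo hi).exec σ).real 6 = A' := by
  have key : ∀ (p : Prog) (τ : State), τ.Prepared P R i j k B → p.loopFree = true →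
      (∀ r < 4, p.setsNat r = false ∧ p.setsReal r = false ∧ p.writesTo r = false) →
      (p.writesTo 10 = false ∧ p.writesTo 11 = false ∧ p.writesTo 12 = false) →
      Frame p τ (p.exec τ) ∧ (p.exec τ).Prepared P R i j k B := fun p τ hτ h1 h2 h3 =>
    ⟨frame_exec h1 τ, hτ.of_frame (frame_exec h1 τ) h2 h3⟩
  rw [show (sideInit count base v y lo hi).exec σ = (Prog.setReal 6 (.reg hi)).exec
    ((Prog.setReal 5 (.reg lo)).exec ((Prog.setReal 4 y).exec ((Prog.setNat 8 v).exec
    ((Prog.setNat 7 base).exec ((Prog.setNat 6 count).exec σ))))) from rfl]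
  obtain ⟨f1, p1⟩ := key (.setNat 6 count) σ hσ rfl
    (fun r hr => by interval_cases r <;> exact ⟨rfl, rfl, rfl⟩) ⟨rfl, rfl, rfl⟩
  have e1 : ((Prog.setNat 6 count).exec σ).nat 6 = c := by simp [(hev σ hσ).1]
  generalize (Prog.setNat 6 count).exec σ = τ₁ at *
  obtain ⟨f2, p2⟩ := key (.setNat 7 base) τ₁ p1 rfl
    (fun r hr => by interval_cases r <;> exact ⟨rfl, rfl, rfl⟩) ⟨rfl, rfl, rfl⟩
  have e2 : ((Prog.setNat 7 base).exec τ₁).nat 7 = b := by simp [(hev τ₁ p1).2.1]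
  generalize (Prog.setNat 7 base).exec τ₁ = τ₂ at *
  obtain ⟨f3, p3⟩ := key (.setNat 8 v) τ₂ p2 rfl
    (fun r hr => by interval_cases r <;> exact ⟨rfl, rfl, rfl⟩) ⟨rfl, rfl, rfl⟩
  have e3 : ((Prog.setNat 8 v).exec τ₂).nat 8 = v' := by simp [(hev τ₂ p2).2.2.1]
  generalize (Prog.setNat 8 v).exec τ₂ = τ₃ at *
  obtain ⟨f4, p4⟩ := key (.setReal 4 y) τ₃ p3 rfl
    (fun r hr => by interval_cases r <;> exact ⟨rfl, rfl, rfl⟩) ⟨rfl, rfl, rfl⟩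
  have e4 : ((Prog.setReal 4 y).exec τ₃).real 4 = z := by simp [(hev τ₃ p3).2.2.2.1]
  generalize (Prog.setReal 4 y).exec τ₃ = τ₄ at *
  obtain ⟨f5, p5⟩ := key (.setReal 5 (.reg lo)) τ₄ p4 rfl
    (fun r hr => by interval_cases r <;> exact ⟨rfl, rfl, rfl⟩) ⟨rfl, rfl, rfl⟩
  have e5 : ((Prog.setReal 5 (.reg lo)).exec τ₄).real 5 = A := by
    simp [(hev τ₄ p4).2.2.2.2.1]
  generalize (Prog.setReal 5 (.reg lo)).exec τ₄ = τ₅ at *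
  obtain ⟨f6, -⟩ := key (.setReal 6 (.reg hi)) τ₅ p5 rfl
    (fun r hr => by interval_cases r <;> exact ⟨rfl, rfl, rfl⟩) ⟨rfl, rfl, rfl⟩
  have e6 : ((Prog.setReal 6 (.reg hi)).exec τ₅).real 6 = A' := by
    simp [(hev τ₅ p5).2.2.2.2.2]
  generalize (Prog.setReal 6 (.reg hi)).exec τ₅ = τ₆ at *
  refine ⟨?_, ?_, ?_, ?_, ?_, e6⟩
  · rw [f6.nat 6 rfl, f5.nat 6 rfl, f4.nat 6 rfl, f3.nat 6 rfl, f2.nat 6 rfl, e1]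
  · rw [f6.nat 7 rfl, f5.nat 7 rfl, f4.nat 7 rfl, f3.nat 7 rfl, e2]
  · rw [f6.nat 8 rfl, f5.nat 8 rfl, f4.nat 8 rfl, e3]
  · rw [f6.real 4 rfl, f5.real 4 rfl, e4]
  · rw [f6.real 5 rfl, e5]

/-- The lines come out in order of slope (`LineArray.mono`), as the stack requires, and their
envelope is the evacuation time of the chain (`LineArray.upperEnv_eq`). -/
theorem sideProg_spec (count base v : NExp) (y : RExp) (lo hi : ℕ) :
    ∃ K : ℕ, ∀ (P : PathNet) (R : WeightRanges P.n) (i j k : ℕ) (B : WeightBox) (σ : State)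
      (C : Chain) (b c h : ℕ) (z A' : ℝ), σ.Prepared P R i j k B →
      (∀ τ : State, τ.Prepared P R i j k B → count.eval τ = c ∧ base.eval τ = b ∧ v.eval τ = C.v ∧
        y.eval τ = z ∧ τ.real lo = C.a ∧ τ.real hi = A') →
      (∀ τ : State, τ.Prepared P R i j k B → τ.HoldsChain b (P.n + 1) C) →
      c ≤ P.n → (∀ u < c, 0 < C.K u) → σ.nat 5 = h → C.a ≤ A' →
      HaltsWithin (sideProg count base v y lo hi) (K * (P.n + 1)) σ fun σ' => ∃ m,
        σ'.nat 10 = m ∧ 0 < m ∧ m ≤ c + 1 ∧ σ'.StoresConvex (C.fn c z) C.a A' h m ∧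
        State.AgreeBelow h σ σ' ∧ σ'.Prepared P R i j k B := by
  obtain ⟨K₁, h₁⟩ := linesProg_spec
  obtain ⟨K₂, h₂⟩ := envProg_spec
  refine ⟨(sideInit count base v y lo hi).time + (K₁ + K₂), ?_⟩
  intro P R i j k B σ C b c h z A' hσ hev hch hc hK h5 hA
  have f1 := frame_exec (p := sideInit count base v y lo hi) rfl σ
  have hQ := sideInit_spec hσ hev
  refine HaltsWithin.mono (HaltsWithin.frame (HaltsWithin.exec_seq
    (p := sideInit count base v y lo hi) rfl (HaltsWithin.seq (h₁ _ C b (P.n + 1) c z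
      (hch _ (hσ.of_frame f1 ?_ ⟨rfl, rfl, rfl⟩)) (by omega)
      hQ.1 hQ.2.1 hQ.2.2.1 hQ.2.2.2.1 hQ.2.2.2.2.1) fun σ₂ f2 hl => ?_)))
    (T₁ := (sideInit count base v y lo hi).time + (K₁ * (P.n + 1) + K₂ * (P.n + 1)))
    (Q₁ := fun σ' => Frame (sideProg count base v y lo hi) σ σ' ∧ ∃ m,
        σ'.nat 10 = m ∧ 0 < m ∧ m ≤ c + 1 ∧ σ'.StoresConvex (C.fn c z) C.a A' h m ∧
        State.AgreeBelow h σ σ') ?_ ?_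
  · intro r hr
    interval_cases r <;> exact ⟨rfl, rfl, rfl⟩
  · have hla : LineArray C c z (σ₂.realArr 13) (σ₂.realArr 14) :=
      ⟨fun t ht => (hl t ht).1, fun t ht => (hl t ht).2⟩
    refine (h₂ σ₂ (P.n + 1) c h C.a A' (by omega) (by rw [f2.nat 6 rfl, hQ.1])
      (by rw [f2.nat 5 rfl, f1.nat 5 rfl, h5]) (by rw [f2.real 5 rfl, hQ.2.2.2.2.1])
      (by rw [f2.real 6 rfl, hQ.2.2.2.2.2]) hA (hla.nonneg hK) (hla.mono hK)).mono le_rfl ?_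
    rintro σ₃ ⟨m, k1, k2, k3, k4, k5⟩
    rw [hla.upperEnv_eq] at k4
    exact ⟨m, k1, k2, k3, k4, ((State.AgreeBelow.of_frame f1 rfl h).trans
      (State.AgreeBelow.of_frame f2 rfl h)).trans k5⟩
  · have := Nat.le_mul_of_pos_right (sideInit count base v y lo hi).time (Nat.succ_pos P.n)
    calc _ ≤ (sideInit count base v y lo hi).time * (P.n + 1) +
        (K₁ * (P.n + 1) + K₂ * (P.n + 1)) := by
          exact Nat.add_le_add_right this _
      _ = _ := by ring
  · rintro σ' ⟨hf, m, k1, k2, k3, k4, k5⟩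
    refine ⟨m, k1, k2, k3, k4, k5, hσ.of_frame hf (fun r hr => ?_) ⟨rfl, rfl, rfl⟩⟩
    interval_cases r <;> exact ⟨rfl, rfl, rfl⟩

/-- Keep the function that has just been stored; the integer registers `b` and `m` receive its
place and its size. -/
def keep (b m : ℕ) : Prog :=
  .setNat b (.reg 5) ;; .setNat m (.reg 10) ;;
  -- A function with `m` pieces has `m + 1` critical points; the further entry is the one that
  -- `walkLoad` reads on an exhausted side.
  .setNat 5 (.add (.reg 5) (.add (.reg 10) (.lit 2)))

/-- The minimum over the ways to divide the weight, for the numbers `cL` and `cR` of vertices and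
the locations `yL` and `yR` on the two sides, and the offset `d`. -/
def caseProg (cL cR : NExp) (yL yR d : RExp) : Prog :=
  sideProg cL (.lit 0) (.reg 1) yL 0 1 ;; keep 11 12 ;;
  sideProg cR (.add (.reg 0) (.lit 1)) (.sub (.reg 0) (.reg 2)) yR 2 3 ;; keep 13 14 ;;
  .setReal 8 d ;; walkProg ;; keep 17 18

theorem keep_spec {σ : State} {b m : ℕ} (hb : b ≠ 5 ∧ b ≠ 10) (hm : m ≠ 5 ∧ m ≠ 10) (hbm : b ≠ m) :
    ((keep b m).exec σ).nat b = σ.nat 5 ∧ ((keep b m).exec σ).nat m = σ.nat 10 ∧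
    ((keep b m).exec σ).nat 5 = σ.nat 5 + (σ.nat 10 + 2) := by
  simp [keep, hb, hm, hb.1.symm, hb.2.symm, hm.1.symm, hm.2.symm, hbm]

/-- Both envelopes have at most `n + 1` pieces, hence the path has at most `6 * (n + 1) + 2`.
Results are stored one behind the other, so the earlier ones are preserved. -/
theorem caseProg_spec (cL cR : NExp) (yL yR d : RExp) :
    ∃ K : ℕ, ∀ (P : PathNet) (R : WeightRanges P.n) (i j k : ℕ) (B : WeightBox) (σ : State)
      (cL' cR' h : ℕ) (yL' yR' d' : ℝ), σ.Prepared P R i j k B →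
      (∀ τ : State, τ.Prepared P R i j k B → cL.eval τ = cL' ∧ cR.eval τ = cR' ∧
        yL.eval τ = yL' ∧ yR.eval τ = yR' ∧ d.eval τ = d') →
      cL' ≤ P.n → cR' ≤ P.n → 0 ≤ d' → σ.nat 5 = h →
      HaltsWithin (caseProg cL cR yL yR d) (K * (P.n + 1)) σ fun σ' => ∃ b m,
        σ'.nat 17 = b ∧ σ'.nat 18 = m ∧ σ'.nat 5 = b + (m + 2) ∧ h ≤ b ∧ 0 < m ∧
        m ≤ 8 * (P.n + 1) ∧
        σ'.Stores (minBalance ((leftChain P R i j B).fn cL' yL') ((rightChain P R i j B).fn cR' yR')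
          d' B.a₁ B.a₂ B.b₁ B.b₂) (B.a₁ + B.b₁) (B.a₂ + B.b₂) b m ∧
        State.AgreeBelow h σ σ' ∧ σ'.Prepared P R i j k B := by
  obtain ⟨K₁, h₁⟩ := sideProg_spec cL (.lit 0) (.reg 1) yL 0 1
  obtain ⟨K₂, h₂⟩ := sideProg_spec cR (.add (.reg 0) (.lit 1)) (.sub (.reg 0) (.reg 2)) yR 2 3
  obtain ⟨K₃, h₃⟩ := walkProg_spec
  refine ⟨K₁ + (keep 11 12).time + K₂ + (keep 13 14).time + (Prog.setReal 8 d).time + 2 * K₃ +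
    (keep 17 18).time, ?_⟩
  intro P R i j k B σ cL' cR' h yL' yR' d' hσ hev hcL hcR hd h5
  refine HaltsWithin.mono (Q₁ := fun σ' => Frame (caseProg cL cR yL yR d) σ σ' ∧ ∃ b m,
        σ'.nat 17 = b ∧ σ'.nat 18 = m ∧ σ'.nat 5 = b + (m + 2) ∧ h ≤ b ∧ 0 < m ∧
        m ≤ 8 * (P.n + 1) ∧
        σ'.Stores (minBalance ((leftChain P R i j B).fn cL' yL') ((rightChain P R i j B).fn cR' yR')
          d' B.a₁ B.a₂ B.b₁ B.b₂) (B.a₁ + B.b₁) (B.a₂ + B.b₂) b m ∧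
        State.AgreeBelow h σ σ') (HaltsWithin.frame ?_) (T₁ := K₁ * (P.n + 1) + ((keep 11 12).time +
          (K₂ * (P.n + 1) + ((keep 13 14).time + ((Prog.setReal 8 d).time +
          (K₃ * (2 * (P.n + 1)) + (keep 17 18).time)))))) ?_ ?_
  · refine HaltsWithin.seq (h₁ P R i j k B σ (leftChain P R i j B) 0 cL' h yL' B.a₂ hσ ?_
      (fun τ hτ => hτ.left) hcL (fun u hu => P.cap_pos u (by omega)) h5 B.a_le) ?_
    · intro τ hτ
      obtain ⟨e1, e2, e3, e4, e5⟩ := hev τ hτ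
      exact ⟨e1, rfl, hτ.input.nat 1 (by omega), e3, hτ.input.real 0 (by omega),
        hτ.input.real 1 (by omega)⟩
    rintro σ₁ f1 ⟨mF, k1, k2, k3, k4, k5, k6⟩
    refine HaltsWithin.exec_seq rfl ?_
    have f2 := frame_exec (p := keep 11 12) rfl σ₁
    obtain ⟨l1, l2, l3⟩ := keep_spec (σ := σ₁) (b := 11) (m := 12) (by decide) (by decide)
      (by decide)
    have p2 : ((keep 11 12).exec σ₁).Prepared P R i j k B := k6.of_frame f2 (fun r hr => by
      interval_cases r <;> exact ⟨rfl, rfl, rfl⟩) ⟨rfl, rfl, rfl⟩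
    generalize (keep 11 12).exec σ₁ = σ₂ at *
    rw [f1.nat 5 rfl, h5] at l1 l3
    rw [k1] at l2 l3
    refine HaltsWithin.seq (h₂ P R i j k B σ₂ (rightChain P R i j B) (P.n + 1) cR' _ yR' B.b₂ p2 ?_
      (fun τ hτ => hτ.right) hcR (fun u hu => P.cap_pos _ (by omega)) l3 B.b_le) ?_
    · intro τ hτ
      obtain ⟨e1, e2, e3, e4, e5⟩ := hev τ hτ
      have n0 : τ.nat 0 = P.n := hτ.input.nat 0 (by omega)
      have n2 : τ.nat 2 = j := hτ.input.nat 2 (by omega)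
      refine ⟨e2, ?_, ?_, e4, hτ.input.real 2 (by omega), hτ.input.real 3 (by omega)⟩
      · simp only [NExp.eval, n0]
      · simp only [NExp.eval, n0, n2]; rfl
    rintro σ₃ f3 ⟨mG, m1, m2, m3, m4, m5, m6⟩
    refine HaltsWithin.exec_seq rfl ?_
    have f4 := frame_exec (p := keep 13 14) rfl σ₃
    obtain ⟨n1, n2, n3⟩ := keep_spec (σ := σ₃) (b := 13) (m := 14) (by decide) (by decide)
      (by decide)
    have p4 : ((keep 13 14).exec σ₃).Prepared P R i j k B := m6.of_frame f4 (fun r hr => by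
      interval_cases r <;> exact ⟨rfl, rfl, rfl⟩) ⟨rfl, rfl, rfl⟩
    generalize (keep 13 14).exec σ₃ = σ₄ at *
    rw [f3.nat 5 rfl, l3] at n1 n3
    rw [m1] at n2 n3
    refine HaltsWithin.exec_seq rfl ?_
    have f5 := frame_exec (p := .setReal 8 d) rfl σ₄
    have o8 : ((Prog.setReal 8 d).exec σ₄).real 8 = d' := by simp [(hev σ₄ p4).2.2.2.2]
    generalize (Prog.setReal 8 d).exec σ₄ = σ₅ at *
    have ag12 : State.AgreeBelow (h + (mF + 2)) σ₁ σ₂ := State.AgreeBelow.of_frame f2 rfl _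
    have ag13 : State.AgreeBelow (h + (mF + 2)) σ₁ σ₃ := ag12.trans m5
    have ag35 : ∀ b, State.AgreeBelow b σ₃ σ₅ := fun b =>
      (State.AgreeBelow.of_frame f4 rfl b).trans (State.AgreeBelow.of_frame f5 rfl b)
    have ag15 : State.AgreeBelow (h + (mF + 2)) σ₁ σ₅ := ag13.trans (ag35 _)
    refine HaltsWithin.seq (h₃ σ₅ _ _ d' _ _ _ _ (2 * (P.n + 1)) h mF (h + (mF + 2)) mG
      (h + (mF + 2) + (mG + 2)) (by omega) k2 m2 (by omega) (by omega)
      (by rw [f5.nat 5 rfl, n3]) (by rw [f5.nat 11 rfl, f4.nat 11 rfl, f3.nat 11 rfl, l1])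
      (by rw [f5.nat 12 rfl, f4.nat 12 rfl, f3.nat 12 rfl, l2]) (by rw [f5.nat 13 rfl, n1])
      (by rw [f5.nat 14 rfl, n2]) o8 B.a_le B.b_le hd (k4.agree ag15 (by omega))
      (m4.agree (ag35 _) (Nat.lt_succ_self _))) ?_
    rintro σ₆ f6 ⟨m, q1, q2, q3, q4, q5⟩
    have f7 := frame_exec (p := keep 17 18) rfl σ₆
    obtain ⟨r1, r2, r3⟩ := keep_spec (σ := σ₆) (b := 17) (m := 18) (by decide) (by decide)
      (by decide)
    refine haltsWithin_exec rfl ⟨h + (mF + 2) + (mG + 2), m, ?_, ?_, ?_, by omega, q2, by omega,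
      q4.agree (State.AgreeBelow.of_frame f7 rfl _) (Nat.lt_succ_self _), ?_⟩
    · rw [r1, f6.nat 5 rfl, f5.nat 5 rfl, n3]
    · rw [r2, q1]
    · rw [r3, q1, f6.nat 5 rfl, f5.nat 5 rfl, n3]
    · exact ((k5.trans (ag15.mono (by omega))).trans (q5.mono (by omega))).trans
        (State.AgreeBelow.of_frame f7 rfl _)
  · have h11 := Nat.le_mul_of_pos_right (keep 11 12).time (Nat.succ_pos P.n)
    have h13 := Nat.le_mul_of_pos_right (keep 13 14).time (Nat.succ_pos P.n)
    have h17 := Nat.le_mul_of_pos_right (keep 17 18).time (Nat.succ_pos P.n)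
    have h8 := Nat.le_mul_of_pos_right (Prog.setReal 8 d).time (Nat.succ_pos P.n)
    generalize (keep 11 12).time = u₁ at *
    generalize (keep 13 14).time = u₂ at *
    generalize (keep 17 18).time = u₃ at *
    generalize (Prog.setReal 8 d).time = u₄ at *
    linarith
  · rintro σ' ⟨hf, b, m, k1, k2, k3, k4, k5, k6, k7, k8⟩
    refine ⟨b, m, k1, k2, k3, k4, k5, k6, k7, k8, hσ.of_frame hf (fun r hr => ?_) ⟨rfl, rfl, rfl⟩⟩
    interval_cases r <;> exact ⟨rfl, rfl, rfl⟩

end RealRAM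

namespace RealRAM

attribute [local simp] Prog.exec NExp.eval RExp.eval Test.Holds store_apply Function.update_apply

/-! ### The program for the theorem -/

def minOperands : Prog :=
  .setNat 11 (.reg 19) ;; .setNat 12 (.reg 20) ;; .setNat 13 (.reg 17) ;; .setNat 14 (.reg 18)

/-- Replace the function whose place and size are held by the integer registers `19` and `20` by
its minimum with the function that `caseProg` computes. -/
def foldProg (cL cR : NExp) (yL yR d : RExp) : Prog :=
  caseProg cL cR yL yR d ;; minOperands ;; minProg ;; keep 19 20

/-- The factor `2 * M + 17` is twice the sum of the factors `M` and `8` of the operands, and one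
more for the additive constant. -/
theorem foldProg_spec (cL cR : NExp) (yL yR d : RExp) (M : ℕ) :
    ∃ K : ℕ, ∀ (P : PathNet) (R : WeightRanges P.n) (i j k : ℕ) (B : WeightBox) (σ : State)
      (cL' cR' h b₀ m₀ : ℕ) (yL' yR' d' : ℝ) (f : ℝ → ℝ), σ.Prepared P R i j k B →
      (∀ τ : State, τ.Prepared P R i j k B → cL.eval τ = cL' ∧ cR.eval τ = cR' ∧
        yL.eval τ = yL' ∧ yR.eval τ = yR' ∧ d.eval τ = d') →
      cL' ≤ P.n → cR' ≤ P.n → 0 ≤ d' → σ.nat 5 = h → σ.nat 19 = b₀ → σ.nat 20 = m₀ →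
      b₀ + m₀ < h → 0 < m₀ → m₀ ≤ M * (P.n + 1) →
      σ.Stores f (B.a₁ + B.b₁) (B.a₂ + B.b₂) b₀ m₀ →
      HaltsWithin (foldProg cL cR yL yR d) (K * (P.n + 1)) σ fun σ' => ∃ b m,
        σ'.nat 19 = b ∧ σ'.nat 20 = m ∧ b + m < σ'.nat 5 ∧ 0 < m ∧
        m ≤ (2 * M + 17) * (P.n + 1) ∧
        σ'.Stores (fun α => min (f α) (minBalance ((leftChain P R i j B).fn cL' yL')
          ((rightChain P R i j B).fn cR' yR') d' B.a₁ B.a₂ B.b₁ B.b₂ α))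
          (B.a₁ + B.b₁) (B.a₂ + B.b₂) b m ∧ σ'.Prepared P R i j k B := by
  obtain ⟨K₁, h₁⟩ := caseProg_spec cL cR yL yR d
  obtain ⟨K₂, h₂⟩ := minProg_spec
  refine ⟨K₁ + minOperands.time + K₂ * (M + 8) + (keep 19 20).time, ?_⟩
  intro P R i j k B σ cL' cR' h b₀ m₀ yL' yR' d' f hσ hev hcL hcR hd h5 h19 h20 hbm hm0 hmM hS
  refine HaltsWithin.mono (Q₁ := fun σ' => Frame (foldProg cL cR yL yR d) σ σ' ∧ ∃ b m,
        σ'.nat 19 = b ∧ σ'.nat 20 = m ∧ b + m < σ'.nat 5 ∧ 0 < m ∧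
        m ≤ (2 * M + 17) * (P.n + 1) ∧
        σ'.Stores (fun α => min (f α) (minBalance ((leftChain P R i j B).fn cL' yL')
          ((rightChain P R i j B).fn cR' yR') d' B.a₁ B.a₂ B.b₁ B.b₂ α))
          (B.a₁ + B.b₁) (B.a₂ + B.b₂) b m) (HaltsWithin.frame ?_) (T₁ := K₁ * (P.n + 1) +
          (minOperands.time + (K₂ * ((M + 8) * (P.n + 1)) + (keep 19 20).time))) ?_ ?_
  · refine HaltsWithin.seq (h₁ P R i j k B σ cL' cR' h yL' yR' d' hσ hev hcL hcR hd h5) ?_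
    rintro σ₁ f1 ⟨b, m, k17, k18, k5, hhb, hm, hmn, kS, kag, -⟩
    refine HaltsWithin.exec_seq rfl ?_
    have f2 := frame_exec (p := minOperands) rfl σ₁
    have l19 : σ₁.nat 19 = b₀ := by rw [f1.nat 19 rfl, h19]
    have l20 : σ₁.nat 20 = m₀ := by rw [f1.nat 20 rfl, h20]
    have e11 : (minOperands.exec σ₁).nat 11 = b₀ := by simp [minOperands, l19]
    have e12 : (minOperands.exec σ₁).nat 12 = m₀ := by simp [minOperands, l20]
    have e13 : (minOperands.exec σ₁).nat 13 = b := by simp [minOperands, k17]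
    have e14 : (minOperands.exec σ₁).nat 14 = m := by simp [minOperands, k18]
    generalize minOperands.exec σ₁ = σ₂ at *
    have e5 : σ₂.nat 5 = b + (m + 2) := by rw [f2.nat 5 rfl, k5]
    refine HaltsWithin.seq (h₂ σ₂ f _ _ _ ((M + 8) * (P.n + 1)) b₀ m₀ b m (b + (m + 2))
      (by linarith) hm0 hm (by omega) (by omega) e5 e11 e12 e13 e14
      ((hS.agree kag hbm).agree (State.AgreeBelow.of_frame f2 rfl h) hbm)
      (kS.agree (State.AgreeBelow.of_frame f2 rfl _) (Nat.lt_succ_self _))) ?_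
    rintro σ₃ f3 ⟨m', q1, q2, q3, q4, q5⟩
    have f4 := frame_exec (p := keep 19 20) rfl σ₃
    obtain ⟨r1, r2, r3⟩ := keep_spec (σ := σ₃) (b := 19) (m := 20) (by decide) (by decide)
      (by decide)
    refine haltsWithin_exec rfl ⟨_, _, r1, r2, by omega, by omega, ?_, ?_⟩
    · rw [q1]
      linarith
    · rw [q1, f3.nat 5 rfl, e5]
      exact q4.agree (State.AgreeBelow.of_frame f4 rfl _) (Nat.lt_succ_self _)
  · have h11 := Nat.le_mul_of_pos_right minOperands.time (Nat.succ_pos P.n)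
    have h17 := Nat.le_mul_of_pos_right (keep 19 20).time (Nat.succ_pos P.n)
    generalize minOperands.time = u₁ at *
    generalize (keep 19 20).time = u₃ at *
    linarith
  · rintro σ' ⟨hf, b, m, k1, k2, k3, k4, k5, k6⟩
    refine ⟨b, m, k1, k2, k3, k4, k5, k6, hσ.of_frame hf (fun r hr => ?_) ⟨rfl, rfl, rfl⟩⟩
    interval_cases r <;> exact ⟨rfl, rfl, rfl⟩

def copyInit : Prog := .setNat 4 (.reg 20) ;; .setNat 9 (.lit 0)

def copyBody : Prog :=
  .writeReal 4 (.reg 9) (.read 7 (.add (.reg 19) (.reg 9))) ;;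
  .writeReal 5 (.reg 9) (.read 8 (.add (.reg 19) (.reg 9))) ;;
  .writeReal 6 (.reg 9) (.read 9 (.add (.reg 19) (.reg 9))) ;;
  .setNat 9 (.add (.reg 9) (.lit 1))

/-- Copy the function whose place and size are held by the integer registers `19` and `20` to the
output. -/
def copyProg : Prog := copyInit ;; .loop (.natLt (.reg 9) (.add (.reg 4) (.lit 1))) copyBody

/-- There are `m + 1` rounds because of the last critical point; the slope and the intercept copied
along with it are meaningless. -/
theorem copyProg_spec : ∃ K : ℕ, ∀ (σ : State) (f : ℝ → ℝ) (A B : ℝ) (N b m : ℕ),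
    σ.nat 19 = b → σ.nat 20 = m → m < N → σ.Stores f A B b m →
    HaltsWithin copyProg (K * N) σ fun σ' => σ'.nat 4 = m ∧
      PiecewiseLin f A B m (σ'.realArr 4) (σ'.realArr 5) (σ'.realArr 6) := by
  refine ⟨copyInit.time + 2 * ((Test.natLt (.reg 9) (.add (.reg 4) (.lit 1))).cost + 1 +
    copyBody.time), ?_⟩
  intro σ f A B N b m h19 h20 hmN hS
  have f0 := frame_exec (p := copyInit) rfl σ
  have c4 : (copyInit.exec σ).nat 4 = m := by simp [copyInit, h20]
  have c9 : (copyInit.exec σ).nat 9 = 0 := by simp [copyInit]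
  refine HaltsWithin.mono (HaltsWithin.exec_seq rfl (HaltsWithin.mono
      (haltsWithin_loop rfl (fun τ μ => ∃ t, τ.nat 9 = t ∧ μ = m + 1 - t ∧
        ∀ s < t, τ.realArr 4 s = σ.realArr 7 (b + s) ∧ τ.realArr 5 s = σ.realArr 8 (b + s) ∧
          τ.realArr 6 s = σ.realArr 9 (b + s)) ?_ (m + 1)
      ⟨0, c9, by omega, fun s hs => by omega⟩) le_rfl ?_)) ?_ fun _ h => h
  · rintro τ μ f1 ⟨t, h9, hμ, hent⟩ hlt
    have e4 : τ.nat 4 = m := by rw [f1.nat 4 rfl, c4]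
    have e19 : τ.nat 19 = b := by rw [f1.nat 19 rfl, f0.nat 19 rfl, h19]
    have e7 : τ.realArr 7 = σ.realArr 7 := by rw [f1.arr 7 rfl, f0.arr 7 rfl]
    have e8 : τ.realArr 8 = σ.realArr 8 := by rw [f1.arr 8 rfl, f0.arr 8 rfl]
    have e9 : τ.realArr 9 = σ.realArr 9 := by rw [f1.arr 9 rfl, f0.arr 9 rfl]
    have ht : t < m + 1 := by simpa [h9, e4] using hlt
    refine ⟨_, ?_, t + 1, by simp [copyBody, h9], rfl, fun s hs => ?_⟩
    · omega
    · by_cases hst : s = t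
      · subst hst
        simp [copyBody, h9, e19, e7, e8, e9]
      · have := hent s (by omega)
        simp [copyBody, h9, hst, this]
  · rintro τ ⟨f1, ⟨μ, t, h9, hμ, hent⟩, hlt⟩
    have e4 : τ.nat 4 = m := by rw [f1.nat 4 rfl, c4]
    have ht : ¬ t < m + 1 := by simpa [h9, e4] using hlt
    exact ⟨e4, PiecewiseLin.congr hS (fun s hs => (hent s (by omega)).1)
      (fun s hs => (hent s (by omega)).2.1) (fun s hs => (hent s (by omega)).2.2) fun _ _ => rfl⟩
  · generalize (Test.natLt (.reg 9) (.add (.reg 4) (.lit 1))).cost + 1 + copyBody.time = k at *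
    have h1 : copyInit.time ≤ copyInit.time * N := Nat.le_mul_of_pos_right _ (by omega)
    refine le_trans (add_le_add h1 (Nat.mul_le_mul_left k
      (show _ ≤ 2 * N by omega))) (le_of_eq (by ring))

/-- The number of vertices to the right of `v_{k+1}`, including it, and the location of `v_{k+1}`
on the right chain. -/
abbrev countRight : NExp := .sub (.sub (.reg 0) (.reg 3)) (.lit 1)

abbrev locLeft (t : NExp) : RExp := .read 10 t

abbrev locRight (t : NExp) : RExp := .read 10 (.add (.add (.reg 0) (.lit 1)) t)

def takeFirst : Prog := .setNat 19 (.reg 17) ;; .setNat 20 (.reg 18)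

/-- The program of the theorem: the sink lies inside the edge `e_k`, at `v_k`, or at `v_{k+1}`. -/
def evacProg : Prog :=
  (leftProg ;; rightProg) ;;
  caseProg (.add (.reg 3) (.lit 1)) (.sub (.reg 0) (.reg 3)) (locLeft (.reg 3))
    (locRight countRight) (.read 0 (.reg 3)) ;;
  takeFirst ;;
  foldProg (.reg 3) (.sub (.reg 0) (.reg 3)) (locLeft (.reg 3))
    (locRight (.sub (.reg 0) (.reg 3))) (.lit 0) ;;
  foldProg (.add (.reg 3) (.lit 1)) countRight (locLeft (.add (.reg 3) (.lit 1)))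
    (locRight countRight) (.lit 0) ;;
  copyProg

/-- The sizes are bounded by `8`, then `33 = 2 * 8 + 17`, then `83 = 2 * 33 + 17` times `n + 1`; the
factor `84` provides the strict inequality that copying needs. -/
theorem evacProg_spec : ∃ K : ℕ, ∀ (P : PathNet) (R : WeightRanges P.n) (i j k : ℕ)
    (B : WeightBox), k < P.n →
    HaltsWithin evacProg (K * (P.n + 1)) (input P R i j k B) fun σ => ∃ m, σ.nat 4 = m ∧ 0 < m ∧
      m ≤ K * (P.n + 1) ∧ PiecewiseLin (edgeMin P R i j k B) (B.a₁ + B.b₁) (B.a₂ + B.b₂) m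
        (σ.realArr 4) (σ.realArr 5) (σ.realArr 6) := by
  obtain ⟨K₀, h₀⟩ := prepare_spec
  obtain ⟨K₁, h₁⟩ := caseProg_spec (.add (.reg 3) (.lit 1)) (.sub (.reg 0) (.reg 3))
    (locLeft (.reg 3)) (locRight countRight) (.read 0 (.reg 3))
  obtain ⟨K₂, h₂⟩ := foldProg_spec (.reg 3) (.sub (.reg 0) (.reg 3)) (locLeft (.reg 3))
    (locRight (.sub (.reg 0) (.reg 3))) (.lit 0) 8
  obtain ⟨K₃, h₃⟩ := foldProg_spec (.add (.reg 3) (.lit 1)) countRight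
    (locLeft (.add (.reg 3) (.lit 1))) (locRight countRight) (.lit 0) 33
  obtain ⟨K₄, h₄⟩ := copyProg_spec
  refine ⟨K₀ + K₁ + takeFirst.time + K₂ + K₃ + 84 * K₄ + 83, ?_⟩
  intro P R i j k B hk
  have hreg : ∀ τ : State, τ.Prepared P R i j k B → τ.nat 0 = P.n ∧ τ.nat 3 = k := fun τ hτ =>
    ⟨hτ.input.nat 0 (by omega), hτ.input.nat 3 (by omega)⟩
  have hleft : ∀ τ : State, τ.Prepared P R i j k B → ∀ t ≤ P.n, τ.realArr 10 t = P.pos t :=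
    fun τ hτ t ht => by
      have h := hτ.left.X t (by omega)
      rw [Nat.zero_add] at h
      exact h
  have hright : ∀ τ : State, τ.Prepared P R i j k B → ∀ t ≤ P.n,
      τ.realArr 10 (P.n + 1 + t) = P.pos P.n - P.pos (P.n - t) :=
    fun τ hτ t ht => hτ.right.X t (by omega)
  have hlen : ∀ τ : State, τ.Prepared P R i j k B → τ.realArr 0 k = P.len k := fun τ hτ => by
    rw [hτ.input.arr 0 (by omega)]
    exact if_pos hk
  refine HaltsWithin.mono (T₁ := K₀ * (P.n + 1) + (K₁ * (P.n + 1) + (takeFirst.time +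
    (K₂ * (P.n + 1) + (K₃ * (P.n + 1) + K₄ * (84 * (P.n + 1))))))) (HaltsWithin.seq (h₀ P R i j k B) ?_) ?_
    fun _ h => h
  · rintro σ₀ f0 p0
    refine HaltsWithin.seq (h₁ P R i j k B σ₀ (k + 1) (P.n - k) 0 (P.pos k)
      (P.pos P.n - P.pos (k + 1)) (P.len k) p0 (fun τ hτ => ?_) hk (by omega)
      (P.len_pos k hk).le (by rw [f0.nat 5 rfl]; rfl)) ?_
    · obtain ⟨n0, n3⟩ := hreg τ hτ
      refine ⟨by simp [n3], by simp [n0, n3], by simp [n3, hleft τ hτ k hk.le], ?_,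
        by simp [n3, hlen τ hτ]⟩
      simp only [RExp.eval, NExp.eval, n0, n3]
      rw [hright τ hτ _ (by omega), show P.n - (P.n - k - 1) = k + 1 by omega]
    rintro σ₁ f1 ⟨b, m, k17, k18, k5, -, hm, hmn, kS, -, p1⟩
    refine HaltsWithin.exec_seq rfl ?_
    have f2 := frame_exec (p := takeFirst) rfl σ₁
    have e19 : (takeFirst.exec σ₁).nat 19 = b := by simp [takeFirst, k17]
    have e20 : (takeFirst.exec σ₁).nat 20 = m := by simp [takeFirst, k18]
    have p2 : (takeFirst.exec σ₁).Prepared P R i j k B := p1.of_frame f2 (fun r hr => by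
      interval_cases r <;> exact ⟨rfl, rfl, rfl⟩) ⟨rfl, rfl, rfl⟩
    generalize takeFirst.exec σ₁ = σ₂ at *
    refine HaltsWithin.seq (h₂ P R i j k B σ₂ k (P.n - k) (b + (m + 2)) b m (P.pos k)
      (P.pos P.n - P.pos k) 0 _ p2 (fun τ hτ => ?_) hk.le (by omega) le_rfl
      (by rw [f2.nat 5 rfl, k5]) e19 e20 (by omega) hm hmn
      (kS.agree (State.AgreeBelow.of_frame f2 rfl _) (Nat.lt_succ_self _))) ?_
    · obtain ⟨n0, n3⟩ := hreg τ hτ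
      refine ⟨by simp [n3], by simp [n0, n3], by simp [n3, hleft τ hτ k hk.le], ?_, by simp⟩
      simp only [RExp.eval, NExp.eval, n0, n3]
      rw [hright τ hτ _ (by omega), show P.n - (P.n - k) = k by omega]
    rintro σ₃ f3 ⟨b', m', e19', e20', hbm', hm', hmn', kS', p3⟩
    refine HaltsWithin.seq (h₃ P R i j k B σ₃ (k + 1) (P.n - k - 1) _ b' m' (P.pos (k + 1))
      (P.pos P.n - P.pos (k + 1)) 0 _ p3 (fun τ hτ => ?_) hk (by omega) le_rfl
      rfl e19' e20' hbm' hm' hmn' kS') ?_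
    · obtain ⟨n0, n3⟩ := hreg τ hτ
      refine ⟨by simp [n3], by simp [n0, n3], by simp [n3, hleft τ hτ (k + 1) hk], ?_, by simp⟩
      simp only [RExp.eval, NExp.eval, n0, n3]
      rw [hright τ hτ _ (by omega), show P.n - (P.n - k - 1) = k + 1 by omega]
    rintro σ₄ f4 ⟨b'', m'', e19'', e20'', -, hm'', hmn'', kS'', -⟩
    refine (h₄ σ₄ _ _ _ (84 * (P.n + 1)) b'' m'' e19'' e20'' (by omega) kS'').mono le_rfl ?_
    rintro σ₅ ⟨q1, q2⟩
    refine ⟨m'', q1, hm'', hmn''.trans (Nat.mul_le_mul_right _ (by omega)), q2⟩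
  · have h1 := Nat.le_mul_of_pos_right takeFirst.time (Nat.succ_pos P.n)
    generalize takeFirst.time = u at *
    linarith

end RealRAM

/-! ### The theorem. -/

theorem mainTheorem5 :
    ∃ (C : ℕ) (prog : RealRAM.Prog), ∀ (P : PathNet) (R : WeightRanges P.n) (i j k : ℕ)
      (B : WeightBox), i ≤ k → k < j → j ≤ P.n →
      (B.a₁ < B.a₂ → 0 < B.a₁ + ∑ t ∈ Finset.Ico 0 i, R.lo t) →
      (B.b₁ < B.b₂ → 0 < B.b₁ + ∑ t ∈ Finset.Ioc j P.n, R.lo t) →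
      (∀ α ∈ Icc (B.a₁ + B.b₁) (B.a₂ + B.b₂),
        IsLeast (evacTimes P R i j k B α) (minEvac P R i j k B α) ∧
        0 ≤ minEvac P R i j k B α ∧
        (0 < B.a₁ + ∑ t ∈ Finset.Ico 0 i, R.lo t →
          0 < B.b₁ + ∑ t ∈ Finset.Ioc j P.n, R.lo t → 0 < minEvac P R i j k B α)) ∧
      IsGoodOn (minEvac P R i j k B) (B.a₁ + B.b₁) (B.a₂ + B.b₂) (C * P.n) ∧
      ∃ T ≤ C * P.n, ∃ σ, RealRAM.Run prog (RealRAM.input P R i j k B) T σ ∧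
        σ.Holds (minEvac P R i j k B) (B.a₁ + B.b₁) (B.a₂ + B.b₂) ∧ σ.nat 4 ≤ C * P.n := by
  obtain ⟨K, hK⟩ := RealRAM.evacProg_spec
  refine ⟨2 * K, RealRAM.evacProg, ?_⟩
  intro P R i j k B hik hkj hj hA hB
  have hmin : ∀ α ∈ Icc (B.a₁ + B.b₁) (B.a₂ + B.b₂),
      minEvac P R i j k B α = edgeMin P R i j k B α := fun α hα =>
    (isLeast_evacTimes hik hkj hj hA hB hα).csInf_eq
  -- `k < j ≤ n` gives `1 ≤ n`, so that bounds linear in `n + 1` are linear in `n`.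
  have hle : K * (P.n + 1) ≤ 2 * K * P.n := by
    rw [mul_comm 2 K, mul_assoc]
    exact Nat.mul_le_mul_left _ (by omega)
  obtain ⟨T, hT, σ, hrun, m, h4, hm, hmK, hpl⟩ := hK P R i j k B (by omega)
  -- The output of the program serves twice: as the computed list, and as the witness for continuity
  -- and for the linear pieces.
  have hrep := PiecewiseLin.congr hpl (fun _ _ => rfl) (fun _ _ => rfl) (fun _ _ => rfl) hmin
  refine ⟨fun α hα => ?_, ⟨hrep.continuousOn, m, hmK.trans hle, _, _, _, hrep.isGoodRepr hm⟩,
    T, hT.trans hle, σ, hrun, ?_, ?_⟩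
  · have hleast := isLeast_evacTimes hik hkj hj hA hB hα
    rw [← hmin α hα] at hleast
    exact ⟨hleast, evacTimes_nonneg hleast.1,
      fun hA' hB' => evacTimes_pos hik hkj hj hA' hB' hleast.1⟩
  · rw [RealRAM.State.Holds, h4]
    exact hrep.isGoodRepr hm
  · rw [h4]
    exact hmK.trans hle
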